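/- Temporal graphs, mappings, warping paths. A temporal graph $\mathcal G=(V,E_1,\dots,E_T)$ consists of a finite vertex set $V$ and $T\ge 1$ edge sets; its layers are $G_i=(V,E_i)$. A vertex mapping between $V$ and $W$ is a set $M\subseteq V\times W$ of $\min(|V|,|W|)$ pairs in which every element of $V$ and every element of $W$ occurs at most once. A warping path of order $T\times U$ is a set $\{p_1,\dots,p_L\}$ of pairs with $p_1=(1,1)$, $p_L=(T,U)$ and $p_{\ell+1}-p_\ell\in\{(1,1),(0,1),(1,0)\}$ for all $\ell<L$. Fix $k$, a polynomial-time computable metric $d:\mathbb Q^k\times\mathbb Q^k\to\mathbb Q$, and a polynomial-time computable rule that assigns to the layers $G_i$ of every temporal graph $\mathcal G$ vertex signatures $f_{G_i}:V\to\mathbb Q^k$ and vertex deletion costs $\Delta_{G_i}:V\to\mathbb Q$. The dtgw-distance of $\mathcal G=(V,E_1,\dots,E_T)$ and $\mathcal H=(W,F_1,\dots,F_U)$ is $$\mathrm{dtgw}(\mathcal G,\mathcal H)=\min_{M}\min_{p}\sum_{(i,j)\in p}\Big(\sum_{(u,v)\in M}d\big(f_{G_i}(u),f_{H_j}(v)\big)+\sum_{u\in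 V\text{ not in }M}\Delta_{G_i}(u)+\sum_{v\in W\text{ not in }M}\Delta_{H_j}(v)\Big),$$ where $M$ ranges over the vertex mappings between $V$ and $W$ and $p$ over the warping paths of order $T\times U$. The problem DTGW asks, given $\mathcal G$, $\mathcal H$ and $c\in\mathbb Q$, whether $\mathrm{dtgw}(\mathcal G,\mathcal H)\le c$. Statement. Suppose there is a constant $\delta>0$ such that any two distinct vertex signatures $x\neq y$ (values of the signature functions, of any layers of any temporal graphs) satisfy $d(x,y)\ge\delta$. Then DTGW, restricted to the instances in which $|V|=|W|$ or all deletion costs $\Delta_{G_i}(u)$ and $\Delta_{H_j}(v)$ are at least $\delta$, is in XP with respect to the parameter $c$: there are one algorithm and a function $\varphi$ such that the algorithm decides every such instance $x=(\mathcal G,\mathcal H,c)$ in time at most $|x|^{\varphi(c)}$. (In particular, if all deletion costs are at least $\delta$, this holds for all instances.) -/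

import Mathlib

namespace DTGW

/-! ### Vertex mappings, warping paths and the dtgw-distance -/

section Distance

/-- A vertex mapping between `V` and `W`: a set of `min(|V|,|W|)` pairs such that every element
of `V` and every element of `W` occurs in at most one pair. -/
def IsVertexMapping {V W : Type} [Fintype V] [Fintype W] (M : Finset (V × W)) : Prop :=
  M.card = min (Fintype.card V) (Fintype.card W) ∧
    (∀ a ∈ M, ∀ b ∈ M, a.1 = b.1 → a = b) ∧ (∀ a ∈ M, ∀ b ∈ M, a.2 = b.2 → a = b)

/-- One step of a warping path: advance in the first, in the second, or in both coordinates. -/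
def WarpStep {T U : ℕ} (a b : Fin T × Fin U) : Prop :=
  (b.1.val = a.1.val + 1 ∧ b.2.val = a.2.val + 1) ∨
    (b.1.val = a.1.val ∧ b.2.val = a.2.val + 1) ∨
      (b.1.val = a.1.val + 1 ∧ b.2.val = a.2.val)

/-- A warping path of order `T × U`, as a set `{p_1, …, p_L}` of index pairs
(indices are counted from `0`, so the path leads from `(0,0)` to `(T-1,U-1)`). -/
def IsWarpingPath {T U : ℕ} (p : Finset (Fin T × Fin U)) : Prop :=
  ∃ l : List (Fin T × Fin U), l.toFinset = p ∧ l.IsChain WarpStep ∧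
    (∃ a ∈ l.head?, a.1.val = 0 ∧ a.2.val = 0) ∧
    (∃ b ∈ l.getLast?, b.1.val + 1 = T ∧ b.2.val + 1 = U)

/-- The cost `C(G,H,M)` of a vertex mapping `M`, where `f`, `g` are the vertex signatures of the
two graphs and `ΔG`, `ΔH` are their deletion costs. -/
def mappingCost {V W X : Type} [Fintype V] [Fintype W] [DecidableEq V] [DecidableEq W]
    (d : X → X → ℚ) (f : V → X) (g : W → X) (ΔG : V → ℚ) (ΔH : W → ℚ)
    (M : Finset (V × W)) : ℚ :=
  ∑ a ∈ M, d (f a.1) (g a.2)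
    + ∑ v ∈ Finset.univ.filter (fun v => v ∉ M.image Prod.fst), ΔG v
    + ∑ w ∈ Finset.univ.filter (fun w => w ∉ M.image Prod.snd), ΔH w

open Classical in
/-- The set `𝓜(V,W)` of all vertex mappings. -/
noncomputable def vertexMappings (V W : Type) [Fintype V] [Fintype W] : Finset (Finset (V × W)) :=
  Finset.univ.filter IsVertexMapping

open Classical in
/-- The set `𝓟_{T,U}` of all warping paths of order `T × U`. -/
noncomputable def warpingPaths (T U : ℕ) : Finset (Finset (Fin T × Fin U)) :=
  Finset.univ.filter IsWarpingPath

theorem vertexMappings_nonempty (V W : Type) [Fintype V] [Fintype W] :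
    (vertexMappings V W).Nonempty := by
  classical
  simp only [vertexMappings, Finset.filter_nonempty_iff, Finset.mem_univ, true_and]
  rcases le_total (Fintype.card V) (Fintype.card W) with h | h
  · obtain ⟨e⟩ := Function.Embedding.nonempty_of_card_le h
    refine ⟨Finset.univ.image fun v => (v, e v), ?_, ?_, ?_⟩
    · rw [Finset.card_image_of_injective _ fun a b hab => (Prod.ext_iff.1 hab).1]
      simp [h]
    all_goals simp
  · obtain ⟨e⟩ := Function.Embedding.nonempty_of_card_le h
    refine ⟨Finset.univ.image fun w => (e w, w), ?_, ?_, ?_⟩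
    · rw [Finset.card_image_of_injective _ fun a b hab => (Prod.ext_iff.1 hab).2]
      simp [h]
    all_goals simp

theorem warpingPaths_nonempty {T U : ℕ} (hT : 1 ≤ T) (hU : 1 ≤ U) :
    (warpingPaths T U).Nonempty := by
  have key : ∀ s : ℕ, ∀ c : Fin T × Fin U, c.1.val + c.2.val = s →
      ∃ l : List (Fin T × Fin U), l.IsChain WarpStep ∧
        (∃ a ∈ l.head?, a.1.val = 0 ∧ a.2.val = 0) ∧ l.getLast? = some c := by
    intro s
    induction s with
    | zero =>
      intro c hc
      exact ⟨[c], by simp, ⟨c, by simp, by omega, by omega⟩, by simp⟩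
    | succ s ih =>
      intro c hc
      obtain ⟨c', hc', hstep⟩ : ∃ c' : Fin T × Fin U, c'.1.val + c'.2.val = s ∧
          WarpStep c' c := by
        by_cases h : c.1.val = 0
        · exact ⟨(c.1, ⟨c.2.val - 1, by omega⟩), by simp; omega, by
            right; left; simp; omega⟩
        · exact ⟨(⟨c.1.val - 1, by omega⟩, c.2), by simp; omega, by
            right; right; simp; omega⟩
      obtain ⟨l, hl, ⟨a, ha, ha'⟩, hlast⟩ := ih c' hc'
      refine ⟨l ++ [c], ?_, ⟨a, ?_, ha'⟩, by simp⟩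
      · refine List.IsChain.append hl (by simp) ?_
        intro x hx y hy
        simp only [hlast, Option.mem_def, Option.some.injEq, List.head?_cons] at hx hy
        subst hx; subst hy
        exact hstep
      · cases l with
        | nil => simp at ha
        | cons b l => simpa using ha
  obtain ⟨l, hl, ha, hlast⟩ := key _ (⟨T - 1, by omega⟩, ⟨U - 1, by omega⟩) rfl
  refine ⟨l.toFinset, ?_⟩
  simp only [warpingPaths, Finset.mem_filter, Finset.mem_univ, true_and]
  exact ⟨l, rfl, hl, ha, (⟨T - 1, by omega⟩, ⟨U - 1, by omega⟩), hlast,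
    Nat.sub_add_cancel hT, Nat.sub_add_cancel hU⟩

/-- A temporal graph with vertex set `{0, …, n-1}`, lifetime `T ≥ 1` and layers
`G_0, …, G_{T-1}`. -/
structure TemporalGraph where
  n : ℕ
  T : ℕ
  T_pos : 1 ≤ T
  layer : Fin T → SimpleGraph (Fin n)

/-- Vertex signatures with values in `X`: to every layer `i` of every temporal graph, a function
from its vertices to `X`. -/
abbrev Signature (X : Type) : Type := (G : TemporalGraph) → Fin G.T → Fin G.n → X

/-- The dtgw-distance of two temporal graphs, for a cost function `d` on signatures, vertex
signatures `f` and deletion costs `Δ`: the minimum over all vertex mappings `M` and all warping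
paths `p` of the total cost of `M` along `p`. -/
noncomputable def dtgw {X : Type} (d : X → X → ℚ) (f : Signature X) (Δ : Signature ℚ)
    (G H : TemporalGraph) : ℚ :=
  (vertexMappings (Fin G.n) (Fin H.n)).inf' (vertexMappings_nonempty _ _) fun M =>
    (warpingPaths G.T H.T).inf' (warpingPaths_nonempty G.T_pos H.T_pos) fun p =>
      ∑ a ∈ p, mappingCost d (f G a.1) (f H a.2) (Δ G a.1) (Δ H a.2) M

/-- A rational-valued metric. -/
structure IsMetric {X : Type} (d : X → X → ℚ) : Prop where
  eq_zero_iff : ∀ x y, d x y = 0 ↔ x = y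
  symm : ∀ x y, d x y = d y x
  triangle : ∀ x y z, d x z ≤ d x y + d y z

end Distance

/-! ### A machine model with running times

Programs of a WHILE language that works on binary trees. Every elementary operation costs the
size of the tree that it is applied to, so that a run never handles trees larger than its running
time; hence time is polynomially related to time on multitape Turing machines. -/

section Machine

/-- The data: binary trees. -/
inductive Data : Type
  | nil : Data
  | cons : Data → Data → Data

/-- The number of nodes of a tree. -/
def Data.size : Data → ℕ
  | .nil => 1
  | .cons a b => a.size + b.size + 1

/-- Programs; each transforms an input tree into an output tree. -/
inductive Prog : Type
  | nil : Prog
  | id : Prog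
  | fst : Prog
  | snd : Prog
  | pair : Prog → Prog → Prog
  | comp : Prog → Prog → Prog
  | ite : Prog → Prog → Prog → Prog
  | loop : Prog → Prog → Prog

/-- `Runs p x y t`: on input `x`, program `p` halts with output `y` after time `t`. -/
inductive Runs : Prog → Data → Data → ℕ → Prop
  /-- output the empty tree -/
  | nil (x : Data) : Runs .nil x .nil x.size
  /-- output the input -/
  | id (x : Data) : Runs .id x x x.size
  /-- left and right subtree, by convention empty for the empty tree -/
  | fst_nil : Runs .fst .nil .nil Data.nil.size
  | fst_cons (a b : Data) : Runs .fst (.cons a b) a (Data.cons a b).size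
  | snd_nil : Runs .snd .nil .nil Data.nil.size
  | snd_cons (a b : Data) : Runs .snd (.cons a b) b (Data.cons a b).size
  /-- run `p` and `q` on the input and join the results -/
  | pair {p q : Prog} {x y z : Data} {s t : ℕ} :
      Runs p x y s → Runs q x z t → Runs (.pair p q) x (.cons y z) (s + t + 1)
  /-- run `p`, then run `q` on its output -/
  | comp {p q : Prog} {x y z : Data} {s t : ℕ} :
      Runs p x y s → Runs q y z t → Runs (.comp p q) x z (s + t + 1)
  /-- if `p` returns a nonempty tree then run `q`, else run `r` -/
  | ite_true {p q r : Prog} {x a b y : Data} {s t : ℕ} :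
      Runs p x (.cons a b) s → Runs q x y t → Runs (.ite p q r) x y (s + t + 1)
  | ite_false {p q r : Prog} {x y : Data} {s t : ℕ} :
      Runs p x .nil s → Runs r x y t → Runs (.ite p q r) x y (s + t + 1)
  /-- as long as `p` returns a nonempty tree, replace the current tree by the output of `q` -/
  | loop_stop {p q : Prog} {x : Data} {s : ℕ} :
      Runs p x .nil s → Runs (.loop p q) x x (s + 1)
  | loop_step {p q : Prog} {x a b y z : Data} {s t u : ℕ} :
      Runs p x (.cons a b) s → Runs q x y t → Runs (.loop p q) y z u →
        Runs (.loop p q) x z (s + t + u + 1)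

/-- Encodings of mathematical objects by trees. -/
class Enc (α : Type) where
  enc : α → Data

instance : Enc Bool := ⟨fun b => if b then .cons .nil .nil else .nil⟩

instance {α β : Type} [Enc α] [Enc β] : Enc (α × β) := ⟨fun a => .cons (Enc.enc a.1) (Enc.enc a.2)⟩

instance {α : Type} [Enc α] : Enc (List α) := ⟨fun l => l.foldr (fun a t => .cons (Enc.enc a) t) .nil⟩

/-- Natural numbers are written in binary, least significant bit first. -/
instance : Enc ℕ := ⟨fun m => Enc.enc m.bits⟩

/-- Integers: sign and absolute value. -/
instance : Enc ℤ := ⟨fun z => Enc.enc (decide (z < 0), z.natAbs)⟩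

/-- Rational numbers: numerator and denominator in lowest terms. -/
instance : Enc ℚ := ⟨fun q => Enc.enc (q.num, q.den)⟩

/-- Vectors: the list of entries. -/
instance {α : Type} [Enc α] {k : ℕ} : Enc (Fin k → α) := ⟨fun v => Enc.enc (List.ofFn v)⟩

open Classical in
/-- Temporal graphs: the list of the adjacency matrices of the layers. -/
noncomputable instance : Enc TemporalGraph :=
  ⟨fun G => Enc.enc fun (i : Fin G.T) (u v : Fin G.n) => decide ((G.layer i).Adj u v)⟩

instance {α : Type} [Enc α] {P : α → Prop} : Enc {x : α // P x} := ⟨fun x => Enc.enc x.1⟩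

/-- The size `|x|` of an object: that of its encoding. -/
def inputSize {α : Type} [Enc α] (x : α) : ℕ := (Enc.enc x).size

/-- Program `p` outputs `y` on input `x` after time at most `b`. -/
def ComputesWithin {α β : Type} [Enc α] [Enc β] (p : Prog) (x : α) (y : β) (b : ℕ) : Prop :=
  ∃ t ≤ b, Runs p (Enc.enc x) (Enc.enc y) t

/-- The function `F` is computable in polynomial time. -/
def PolyTime {α β : Type} [Enc α] [Enc β] (F : α → β) : Prop :=
  ∃ (p : Prog) (P : Polynomial ℕ), ∀ x, ComputesWithin p x (F x) (P.eval (inputSize x))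

/-- Vertex signatures are computable in polynomial time: so is the table of the signatures of all
vertices in all layers, as a function of the temporal graph. -/
def PolyTimeSignature {X : Type} [Enc X] (f : Signature X) : Prop :=
  ∃ (p : Prog) (P : Polynomial ℕ), ∀ G : TemporalGraph,
    ComputesWithin p G (f G) (P.eval (inputSize G))

open Classical in
/-- The decision problem `L` with parameter `κ` is in XP: one program decides `L`, on every
instance `x` in time `|x| ^ φ (κ x)`, for some function `φ`. -/
def InXP {α K : Type} [Enc α] (L : α → Prop) (κ : α → K) : Prop :=
  ∃ (p : Prog) (φ : K → ℕ), ∀ x, ComputesWithin p x (decide (L x)) (inputSize x ^ φ (κ x))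

end Machine

/-! ### The problem DTGW -/

/-- An instance of DTGW: two temporal graphs and a cost bound. -/
structure Instance where
  G : TemporalGraph
  H : TemporalGraph
  c : ℚ

noncomputable instance : Enc Instance := ⟨fun I => Enc.enc (I.G, I.H, I.c)⟩

/-- The question of DTGW: is the dtgw-distance at most `c`? -/
def IsYes {X : Type} (d : X → X → ℚ) (f : Signature X) (Δ : Signature ℚ) (I : Instance) : Prop :=
  dtgw d f Δ I.G I.H ≤ I.c

/-- The instances that are considered: no vertex has to be deleted, since both temporal graphs
have equally many vertices, or deleting a vertex always costs at least `δ`. -/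
def Admissible (δ : ℝ) (Δ : Signature ℚ) (I : Instance) : Prop :=
  I.G.n = I.H.n ∨ ((∀ i v, δ ≤ (Δ I.G i v : ℝ)) ∧ (∀ j w, δ ≤ (Δ I.H j w : ℝ)))

end DTGW

namespace DTGW

/-! ### Running times bounded by powers whose exponent depends on a parameter -/

/-! Choose a rational `ε` with `0 < ε < δ`, and suppose that a vertex mapping `M` and a warping path
`p` have total cost at most `c`. All summands are nonnegative: signature distances always are, and
deletion costs either are at least `δ` or do not occur because the vertex sets have equal size. Call
a pair of `M` free if its two vertices have equal signatures at every position of `p`. Each pair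
that is not free contributes at least `ε`, and so does each deleted vertex, since `p` is nonempty.
Hence there are at most `c / ε` of these, and all ordered selections of that many vertices on both
sides can be tried; their number is a power of the input size with an exponent depending on `c`.

The remaining vertices have to be matched at no cost, although `p` is unknown. Restrict every layer
to the row of signatures of the remaining vertices, and drop every row that occurs again later. As
`p` visits only positions with equal rows (after identifying the vertices along `M`), the reduced
sequences of rows of the two graphs agree (`IsWarping.distinctBy_eq`). So a vertex and its partner
have the same column in the reduced tables, the key (`vertexKey_eq_of_isWarping`). Conversely every
layer is represented by some row that is kept, so vertices of one graph with equal keys have equal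
signatures in all layers (`vertexKey_eq_iff`). Therefore any matching of equal keys is as good as
`M`, and a greedy one will do. For the resulting mapping, dynamic programming finds an optimal path
(`cell_spec`).

Whatever the greedy matching does, a genuine vertex mapping is evaluated, so nothing is accepted
wrongly (`exists_of_search`); the argument above gives the converse (`search_of_isAlignment`). Both
are joined in `search_iff`.

For the running time, `CT κ` expresses that time is a power of the input size with exponent
depending on `κ`. It is closed under composition, case distinction and folds with bounded
intermediate results; from this the program is assembled without being written down. The costs are
fractions that are never reduced, whose digits only add up along a path. -/

theorem Data.one_le_size (x : Data) : 1 ≤ x.size := by cases x <;> simp [Data.size]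

/-- Each primitive costs the size of the tree it reads. The bound on the output is what lets time
bounds be composed. -/
theorem Runs.size_le_and {p : Prog} {x y : Data} {t : ℕ} (h : Runs p x y t) :
    x.size ≤ t ∧ y.size ≤ t := by
  induction h
  case nil x => exact ⟨le_rfl, x.one_le_size⟩
  all_goals (try simp only [Data.size] at *); omega

theorem Runs.size_le {p : Prog} {x y : Data} {t : ℕ} (h : Runs p x y t) : y.size ≤ t :=
  h.size_le_and.2

section Calculus

variable {α β γ ε K : Type} [Enc α] [Enc β] [Enc γ] [Enc ε]

theorem one_le_inputSize (x : α) : 1 ≤ inputSize x := Data.one_le_size _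

theorem inputSize_prod (x : α) (y : β) : inputSize (x, y) = inputSize x + inputSize y + 1 := rfl

theorem inputSize_nil : inputSize ([] : List α) = 1 := rfl

theorem inputSize_cons (a : α) (l : List α) :
    inputSize (a :: l) = inputSize a + inputSize l + 1 := rfl

theorem inputSize_list (l : List α) : inputSize l = (l.map fun a => inputSize a + 1).sum + 1 := by
  induction l with
  | nil => rfl
  | cons a l ih => rw [inputSize_cons, ih, List.map_cons, List.sum_cons]; omega

theorem length_le_inputSize (l : List α) : l.length + 1 ≤ inputSize l := by
  induction l with
  | nil => simp [inputSize_nil]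
  | cons a l ih => rw [inputSize_cons, List.length_cons]; omega

theorem inputSize_append (l l' : List α) :
    inputSize (l ++ l') + 1 = inputSize l + inputSize l' := by
  simp only [inputSize_list, List.map_append, List.sum_append]; omega

theorem inputSize_perm {l l' : List α} (h : l.Perm l') : inputSize l = inputSize l' := by
  rw [inputSize_list, inputSize_list, (h.map _).sum_eq]

theorem inputSize_le_of_mem {l : List α} {a : α} (h : a ∈ l) : inputSize a ≤ inputSize l := by
  rw [inputSize_list]
  have := List.single_le_sum (l := l.map fun a => inputSize a + 1) (by simp) (inputSize a + 1)
    (List.mem_map.2 ⟨a, h, rfl⟩)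
  omega

theorem inputSize_list_le {l : List α} {B : ℕ} (h : ∀ a ∈ l, inputSize a ≤ B) :
    inputSize l ≤ l.length * (B + 1) + 1 := by
  rw [inputSize_list]
  have := List.sum_le_card_nsmul (l.map fun a => inputSize a + 1) (B + 1) (by simpa using h)
  simpa using this

/-- `b` is bounded by a power of the input size with an exponent that depends on `κ`. -/
def Bdd (κ : α → K) (b : α → ℕ) : Prop := ∃ φ : K → ℕ, ∀ x, b x ≤ (inputSize x + 2) ^ φ (κ x)

/-- `F` is computable in time bounded by a power of the input size whose exponent depends
on `κ`. -/
def CT (κ : α → K) (F : α → β) : Prop :=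
  ∃ (p : Prog) (φ : K → ℕ), ∀ x, ComputesWithin p x (F x) ((inputSize x + 2) ^ φ (κ x))

/-- `F` is computable in polynomial time. -/
abbrev PT (F : α → β) : Prop := CT (fun _ => ()) F

variable {κ : α → K}

/-- Since `n ≤ 2 ^ n`, any function of the parameter can be moved into the exponent. This is why the
base is kept at least 2. -/
theorem Bdd.param (φ : K → ℕ) : Bdd κ (fun x => φ (κ x)) :=
  ⟨φ, fun _ => (Nat.lt_two_pow_self.le).trans (Nat.pow_le_pow_left (by omega) _)⟩

theorem Bdd.const (n : ℕ) : Bdd κ (fun _ => n) := Bdd.param fun _ => n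

theorem Bdd.size : Bdd κ (fun x => inputSize x) := ⟨fun _ => 1, fun x => by simp⟩

theorem Bdd.mul {b b' : α → ℕ} (h : Bdd κ b) (h' : Bdd κ b') : Bdd κ (fun x => b x * b' x) := by
  obtain ⟨φ, hφ⟩ := h
  obtain ⟨ψ, hψ⟩ := h'
  refine ⟨fun k => φ k + ψ k, fun x => ?_⟩
  rw [pow_add]
  exact Nat.mul_le_mul (hφ x) (hψ x)

theorem Bdd.add {b b' : α → ℕ} (h : Bdd κ b) (h' : Bdd κ b') : Bdd κ (fun x => b x + b' x) := by
  obtain ⟨φ, hφ⟩ := h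
  obtain ⟨ψ, hψ⟩ := h'
  refine ⟨fun k => φ k + ψ k + 1, fun x => ?_⟩
  have h1 : (inputSize x + 2) ^ φ (κ x) ≤ (inputSize x + 2) ^ (φ (κ x) + ψ (κ x)) :=
    Nat.pow_le_pow_right (by omega) (by omega)
  have h2 : (inputSize x + 2) ^ ψ (κ x) ≤ (inputSize x + 2) ^ (φ (κ x) + ψ (κ x)) :=
    Nat.pow_le_pow_right (by omega) (by omega)
  calc b x + b' x ≤ (inputSize x + 2) ^ (φ (κ x) + ψ (κ x)) * 2 := by
        have := hφ x; have := hψ x; omega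
    _ ≤ _ := by rw [pow_succ]; exact Nat.mul_le_mul_left _ (by omega)

theorem Bdd.pow {b : α → ℕ} (h : Bdd κ b) (φ : K → ℕ) : Bdd κ (fun x => b x ^ φ (κ x)) := by
  obtain ⟨ψ, hψ⟩ := h
  refine ⟨fun k => ψ k * φ k, fun x => ?_⟩
  rw [pow_mul]
  exact Nat.pow_le_pow_left (hψ x) _

theorem Bdd.pow_const {b : α → ℕ} (h : Bdd κ b) (n : ℕ) : Bdd κ (fun x => b x ^ n) :=
  h.pow fun _ => n

theorem CT.of_bdd {F : α → β} {b : α → ℕ} (p : Prog) (h : ∀ x, ComputesWithin p x (F x) (b x))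
    (hb : Bdd κ b) : CT κ F := by
  obtain ⟨φ, hφ⟩ := hb
  refine ⟨p, φ, fun x => ?_⟩
  obtain ⟨t, ht, hr⟩ := h x
  exact ⟨t, ht.trans (hφ x), hr⟩

theorem CT.bdd {F : α → β} (h : CT κ F) : Bdd κ (fun x => inputSize (F x)) := by
  obtain ⟨p, φ, h⟩ := h
  refine ⟨φ, fun x => ?_⟩
  obtain ⟨t, ht, hr⟩ := h x
  exact hr.size_le.trans ht

theorem CT.of_eq {F G : α → β} (h : CT κ F) (e : ∀ x, F x = G x) : CT κ G :=
  (funext e : F = G) ▸ h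

theorem PT.exists_bound {F : α → β} (h : PT F) :
    ∃ (p : Prog) (c : ℕ), ∀ x, ComputesWithin p x (F x) ((inputSize x + 2) ^ c) := by
  obtain ⟨p, φ, h⟩ := h
  exact ⟨p, φ (), h⟩

/-- The outputs of a polynomial-time function on inputs of bounded size have bounded size. -/
theorem PT.bdd_on {F : β → γ} (h : PT F) {S : α → ℕ} (hS : Bdd κ S) :
    ∃ B : α → ℕ, Bdd κ B ∧ ∀ x y, inputSize y ≤ S x → inputSize (F y) ≤ B x := by
  obtain ⟨p, c, h⟩ := h.exists_bound
  refine ⟨fun x => (S x + 2) ^ c, (hS.add (.const 2)).pow_const c, fun x y hy => ?_⟩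
  obtain ⟨t, ht, hr⟩ := h y
  exact (hr.size_le.trans ht).trans (Nat.pow_le_pow_left (by omega) _)

/-- The outer function has to be polynomial because it sees only the intermediate value, not the
parameter. A polynomial in a power of the input size is again such a power. -/
theorem CT.comp {g : β → γ} {f : α → β} (hg : PT g) (hf : CT κ f) : CT κ (fun x => g (f x)) := by
  have hb := hf.bdd
  obtain ⟨p, c, hp⟩ := hg.exists_bound
  obtain ⟨q, φ, hq⟩ := hf
  refine .of_bdd (.comp q p) (b := fun x => (inputSize x + 2) ^ φ (κ x) +
    (inputSize (f x) + 2) ^ c + 1) (fun x => ?_)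
    ((((Bdd.size.add (.const 2)).pow φ).add ((hb.add (.const 2)).pow_const c)).add (.const 1))
  obtain ⟨s, hs, hsr⟩ := hq x
  obtain ⟨t, ht, htr⟩ := hp (f x)
  exact ⟨_, by omega, .comp hsr htr⟩

theorem CT.pair {f : α → β} {g : α → γ} (hf : CT κ f) (hg : CT κ g) :
    CT κ (fun x => (f x, g x)) := by
  obtain ⟨p, φ, hp⟩ := hf
  obtain ⟨q, ψ, hq⟩ := hg
  refine .of_bdd (.pair p q) (b := fun x => (inputSize x + 2) ^ φ (κ x) +
    (inputSize x + 2) ^ ψ (κ x) + 1) (fun x => ?_)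
    ((((Bdd.size.add (.const 2)).pow φ).add ((Bdd.size.add (.const 2)).pow ψ)).add (.const 1))
  obtain ⟨s, hs, hsr⟩ := hp x
  obtain ⟨t, ht, htr⟩ := hq x
  exact ⟨_, by omega, .pair hsr htr⟩

theorem CT.id : CT κ (fun x => x) :=
  .of_bdd .id (fun _ => ⟨_, le_rfl, .id _⟩) Bdd.size

/-- A nonempty list and the pair of its head and tail have the same encoding. -/
theorem CT.cons {f : α → β} {g : α → List β} (hf : CT κ f) (hg : CT κ g) :
    CT κ (fun x => f x :: g x) := hf.pair hg

theorem CT.fst {f : α → β × γ} (hf : CT κ f) : CT κ (fun x => (f x).1) :=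
  .comp (g := fun q : β × γ => q.1) (.of_bdd .fst (fun _ => ⟨_, le_rfl, .fst_cons _ _⟩) Bdd.size) hf

theorem CT.snd {f : α → β × γ} (hf : CT κ f) : CT κ (fun x => (f x).2) :=
  .comp (g := fun q : β × γ => q.2) (.of_bdd .snd (fun _ => ⟨_, le_rfl, .snd_cons _ _⟩) Bdd.size) hf

theorem exists_prog_const (d : Data) :
    ∃ (p : Prog) (c : ℕ), ∀ x, ∃ t ≤ c * x.size, Runs p x d t := by
  induction d with
  | nil => exact ⟨.nil, 1, fun x => ⟨_, by simp, .nil x⟩⟩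
  | cons a b iha ihb =>
    obtain ⟨p, c, hp⟩ := iha
    obtain ⟨q, c', hq⟩ := ihb
    refine ⟨.pair p q, c + c' + 1, fun x => ?_⟩
    obtain ⟨s, hs, hsr⟩ := hp x
    obtain ⟨t, ht, htr⟩ := hq x
    refine ⟨_, ?_, .pair hsr htr⟩
    have := x.one_le_size
    rw [add_mul, add_mul]
    omega

theorem CT.const (b : β) : CT κ (fun _ => b) := by
  obtain ⟨p, c, hp⟩ := exists_prog_const (Enc.enc b)
  exact .of_bdd p (fun x => hp (Enc.enc x)) ((Bdd.const c).mul .size)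

/-- Case distinction on any data whose encoding is empty in one case. -/
theorem CT.branch {c : α → β} {f g h : α → γ} (hc : CT κ c) (hf : CT κ f) (hg : CT κ g)
    (hnil : ∀ x, Enc.enc (c x) = .nil → h x = g x)
    (hcons : ∀ x a b, Enc.enc (c x) = .cons a b → h x = f x) : CT κ h := by
  obtain ⟨p, φ, hp⟩ := hc
  obtain ⟨q, ψ, hq⟩ := hf
  obtain ⟨r, ξ, hr⟩ := hg
  refine .of_bdd (.ite p q r) (b := fun x => (inputSize x + 2) ^ φ (κ x) +
    (inputSize x + 2) ^ ψ (κ x) + (inputSize x + 2) ^ ξ (κ x) + 1) (fun x => ?_)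
    (((((Bdd.size.add (.const 2)).pow φ).add ((Bdd.size.add (.const 2)).pow ψ)).add
      ((Bdd.size.add (.const 2)).pow ξ)).add (.const 1))
  obtain ⟨s, hs, hsr⟩ := hp x
  obtain ⟨t, ht, htr⟩ := hq x
  obtain ⟨u, hu, hur⟩ := hr x
  cases he : Enc.enc (c x) with
  | nil =>
    rw [he] at hsr
    rw [hnil x he]
    exact ⟨_, by omega, .ite_false hsr hur⟩
  | cons a b =>
    rw [he] at hsr
    rw [hcons x a b he]
    exact ⟨_, by omega, .ite_true hsr htr⟩

theorem CT.ite {c : α → Bool} {f g : α → γ} (hc : CT κ c) (hf : CT κ f) (hg : CT κ g) :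
    CT κ (fun x => if c x = true then f x else g x) := by
  refine .branch hc hf hg (fun x h => ?_) fun x a b h => ?_
  · cases hb : c x with
    | false => simp
    | true => rw [hb] at h; cases h
  · cases hb : c x with
    | false => rw [hb] at h; cases h
    | true => simp

/-- Branching on whether a list is empty. -/
def listCases (l : List β) (b : γ) (g : β → List β → γ) : γ :=
  match l with
  | [] => b
  | a :: t => g a t

theorem CT.listCases {l : α → List β} {b : α → γ} {g : α → β → List β → γ} (hl : CT κ l)
    (hb : CT κ b) (hg : PT (fun q : α × β × List β => g q.1 q.2.1 q.2.2)) :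
    CT κ (fun x => listCases (l x) (b x) (g x)) := by
  have hb' := hl.bdd
  obtain ⟨p, φ, hp⟩ := hl
  obtain ⟨q, ψ, hq⟩ := hb
  obtain ⟨r, c, hr⟩ := hg.exists_bound
  let S := fun x => inputSize x + inputSize (l x) + 1
  have hS : Bdd κ S := (Bdd.size.add hb').add (.const 1)
  -- The list is computed twice, once for the test and once to hand `(x, a, m)` to `r`; hence the
  -- factor 2. No unpacking is needed, because `a :: m` and `(a, m)` are encoded alike.
  have key : ∀ x, ComputesWithin (.ite p (.comp (.pair .id p) r) q) x
      (DTGW.listCases (l x) (b x) (g x)) (inputSize x + 2 * (inputSize x + 2) ^ φ (κ x) +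
      (inputSize x + 2) ^ ψ (κ x) + (S x + 2) ^ c + 3) := by
    intro x
    obtain ⟨s, hs, hsr⟩ := hp x
    obtain ⟨t, ht, htr⟩ := hq x
    cases he : l x with
    | nil =>
      rw [he] at hsr
      exact ⟨_, by omega, .ite_false hsr htr⟩
    | cons a m =>
      obtain ⟨u, hu, hur⟩ := hr (x, a, m)
      rw [he] at hsr
      have h1 := Runs.pair (.id _) hsr
      have e : inputSize (x, a, m) = S x := by simp only [S, he]; rfl
      rw [e] at hu
      refine ⟨_, ?_, .ite_true hsr (.comp h1 hur)⟩
      change s + (inputSize x + s + 1 + u + 1) + 1 ≤ _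
      omega
  exact .of_bdd _ key ((((Bdd.size.add ((Bdd.const 2).mul ((Bdd.size.add (.const 2)).pow φ))).add
      ((Bdd.size.add (.const 2)).pow ψ)).add ((hS.add (.const 2)).pow_const c)).add (.const 3))

/-- The loop state is the fixed argument, the accumulator and the unread part of the list, and the
loop runs until the last one is empty. `N` bounds the size of the state throughout, so each round
has the same time bound. -/
theorem computesWithin_loop {g : α → β → γ → β} {body : Prog} {c : ℕ}
    (hbody : ∀ q : α × β × γ × List γ, ComputesWithin body q
      (q.1, g q.1 q.2.1 q.2.2.1, q.2.2.2) ((inputSize q + 2) ^ c)) (x : α) (M : ℕ) :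
    ∀ (l : List γ) (a : β) (N : ℕ),
      (∀ l₁ l₂, l = l₁ ++ l₂ → inputSize (l₁.foldl (g x) a) ≤ M) →
      inputSize x + M + inputSize l + 2 ≤ N →
      ComputesWithin (.loop (.comp .snd .snd) body) (x, a, l)
        (x, l.foldl (g x) a, ([] : List γ)) ((l.length + 1) * (2 * N + 2 + (N + 2) ^ c)) := by
  intro l
  induction l with
  | nil =>
    intro a N hM hN
    have ha : inputSize a ≤ M := hM [] [] rfl
    refine ⟨_, ?_, Runs.loop_stop (.comp (.snd_cons _ _) (.snd_cons _ _))⟩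
    change inputSize (x, a, ([] : List γ)) + inputSize (a, ([] : List γ)) + 1 + 1 ≤ _
    simp only [inputSize_prod, List.length_nil] at hN ⊢
    omega
  | cons b l ih =>
    intro a N hM hN
    have ha : inputSize a ≤ M := hM [] _ rfl
    rw [inputSize_cons] at hN
    obtain ⟨t, ht, htr⟩ := hbody (x, a, b, l)
    obtain ⟨u, hu, hur⟩ := ih (g x a b) N (fun l₁ l₂ h => hM (b :: l₁) l₂ (by simp [h])) (by omega)
    refine ⟨_, ?_, .loop_step (.comp (.snd_cons _ _) (.snd_cons _ _)) htr hur⟩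
    change inputSize (x, a, b :: l) + inputSize (a, b :: l) + 1 + t + u + 1 ≤ _
    have h3 : (inputSize (x, a, b, l) + 2) ^ c ≤ (N + 2) ^ c :=
      Nat.pow_le_pow_left (by simp only [inputSize_prod]; omega) _
    simp only [inputSize_prod, inputSize_cons, List.length_cons] at ht ⊢
    rw [add_mul (l.length + 1), one_mul]
    simp only [inputSize_prod] at h3
    omega

/-- A polynomial step could double the accumulator in each round, so polynomially many rounds alone
do not suffice. The bound `B` on the results for all prefixes excludes this. -/
theorem CT.foldl {l : α → List γ} {a : α → β} {g : α → β → γ → β} (hl : CT κ l) (ha : CT κ a)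
    (hg : PT (fun q : α × β × γ => g q.1 q.2.1 q.2.2)) {B : α → ℕ} (hB : Bdd κ B)
    (hM : ∀ x l₁ l₂, l x = l₁ ++ l₂ → inputSize (l₁.foldl (g x) (a x)) ≤ B x) :
    CT κ (fun x => (l x).foldl (g x) (a x)) := by
  have hbody : PT (fun q : α × β × γ × List γ => (q.1, g q.1 q.2.1 q.2.2.1, q.2.2.2)) := by
    refine .pair (.fst .id) (.pair (.comp (f := fun q : α × β × γ × List γ => (q.1, q.2.1, q.2.2.1))
      hg ?_) (.snd (.snd (.snd .id))))
    exact .pair (.fst .id) (.pair (.fst (.snd .id)) (.fst (.snd (.snd .id))))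
  have hlb := hl.bdd
  obtain ⟨body, c, hbody⟩ := hbody.exists_bound
  obtain ⟨p, φ, hp⟩ := CT.pair .id (.pair ha hl)
  let N := fun x => inputSize x + B x + inputSize (l x) + 2
  have hN : Bdd κ N := ((Bdd.size.add hB).add hlb).add (.const 2)
  refine CT.snd (f := fun x => (x, (l x).foldl (g x) (a x))) ?_
  have h3 : CT κ (fun x => (x, (l x).foldl (g x) (a x), ([] : List γ))) := by
    refine .of_bdd (.comp p (.loop (.comp .snd .snd) body)) (b := fun x =>
      (inputSize x + 2) ^ φ (κ x) + (inputSize (l x) + 1) * (2 * N x + 2 + (N x + 2) ^ c) + 1)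
      (fun x => ?_) ((((Bdd.size.add (.const 2)).pow φ).add ((hlb.add (.const 1)).mul
        ((((Bdd.const 2).mul hN).add (.const 2)).add
          ((hN.add (.const 2)).pow_const c)))).add (.const 1))
    obtain ⟨s, hs, hsr⟩ := hp x
    obtain ⟨t, ht, htr⟩ := computesWithin_loop hbody x (B x) (l x) (a x) (N x) (hM x) le_rfl
    refine ⟨_, ?_, .comp hsr htr⟩
    have := Nat.mul_le_mul_right (2 * N x + 2 + (N x + 2) ^ c)
      (show (l x).length + 1 ≤ inputSize (l x) + 1 by have := length_le_inputSize (l x); omega)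
    omega
  exact .pair (.fst h3) (.fst (.snd h3))

end Calculus

/-! ### Functions on lists -/

section Lists

variable {α β γ ε K : Type} [Enc α] [Enc β] [Enc γ] [Enc ε] {κ : α → K}

theorem CT.reverse {l : α → List β} (hl : CT κ l) : CT κ (fun x => (l x).reverse) := by
  have h : ∀ l : List β, l.foldl (fun acc a => a :: acc) [] = l.reverse := by simp
  refine (CT.foldl (g := fun _ acc a => a :: acc) hl (.const []) ?_ hl.bdd
    (fun x l₁ l₂ h' => ?_)).of_eq fun x => h _
  · exact .cons (.snd (.snd .id)) (.fst (.snd .id))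
  · rw [h, inputSize_perm (List.reverse_perm l₁), h']
    have := inputSize_append l₁ l₂
    have := one_le_inputSize l₂
    omega

theorem CT.foldr {l : α → List γ} {b : α → β} {g : α → γ → β → β} (hl : CT κ l) (hb : CT κ b)
    (hg : PT (fun q : α × γ × β => g q.1 q.2.1 q.2.2)) {B : α → ℕ} (hB : Bdd κ B)
    (hM : ∀ x l₁ l₂, l x = l₁ ++ l₂ → inputSize (l₂.foldr (g x) (b x)) ≤ B x) :
    CT κ (fun x => (l x).foldr (g x) (b x)) := by
  refine (CT.foldl (l := fun x => (l x).reverse) (a := b) (g := fun x acc a => g x a acc) hl.reverse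
    hb ?_ hB fun x l₁ l₂ h => ?_).of_eq fun x => List.foldl_reverse
  · exact .comp (f := fun q : α × β × γ => (q.1, q.2.2, q.2.1)) hg
      (.pair (.fst .id) (.pair (.snd (.snd .id)) (.fst (.snd .id))))
  · have := hM x l₂.reverse l₁.reverse (by rw [← List.reverse_append, ← h, List.reverse_reverse])
    rwa [List.foldr_reverse] at this

theorem CT.append {l l' : α → List β} (hl : CT κ l) (hl' : CT κ l') :
    CT κ (fun x => l x ++ l' x) := by
  have h : ∀ l l' : List β, l.foldr List.cons l' = l ++ l' := by simp
  refine (CT.foldr (g := fun _ => List.cons) hl hl' ?_ (hl.bdd.add hl'.bdd)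
    (fun x l₁ l₂ h' => ?_)).of_eq fun x => h _ _
  · exact .cons (.fst (.snd .id)) (.snd (.snd .id))
  · rw [h, h']
    have := inputSize_append l₁ l₂
    have := inputSize_append l₂ (l' x)
    have := one_le_inputSize l₁
    omega

theorem PT.bdd_on_mem {g : α → β → γ} (hg : PT (fun q : α × β => g q.1 q.2)) {l : α → List β}
    (hl : Bdd κ fun x => inputSize (l x)) :
    ∃ B : α → ℕ, Bdd κ B ∧ ∀ x, ∀ a ∈ l x, inputSize (g x a) ≤ B x := by
  obtain ⟨B, hB, h⟩ := hg.bdd_on (κ := κ) (S := fun x => inputSize x + inputSize (l x) + 1)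
    ((Bdd.size.add hl).add (.const 1))
  refine ⟨B, hB, fun x a ha => h x (x, a) ?_⟩
  have := inputSize_le_of_mem ha
  rw [inputSize_prod]
  omega

theorem CT.map {l : α → List β} {g : α → β → γ} (hl : CT κ l)
    (hg : PT (fun q : α × β => g q.1 q.2)) : CT κ (fun x => (l x).map (g x)) := by
  obtain ⟨B, hB, hM⟩ := hg.bdd_on_mem hl.bdd
  have h : ∀ x (l : List β), l.foldr (fun a acc => g x a :: acc) [] = l.map (g x) := by
    intro x l
    rw [List.map_eq_foldr]
  refine (CT.foldr (g := fun x a acc => g x a :: acc) (B := fun x =>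
    inputSize (l x) * (B x + 1) + 1) hl (.const []) ?_
    ((hl.bdd.mul (hB.add (.const 1))).add (.const 1)) (fun x l₁ l₂ h' => ?_)).of_eq fun x => h _ _
  · exact .cons (.comp (f := fun q : α × β × List γ => (q.1, q.2.1)) hg
      (.pair (.fst .id) (.fst (.snd .id)))) (.snd (.snd .id))
  · rw [h]
    refine (inputSize_list_le (B := B x) ?_).trans ?_
    · simp only [List.mem_map, forall_exists_index, and_imp, forall_apply_eq_imp_iff₂]
      exact fun a ha => hM x a (by simp [h', ha])
    · have := length_le_inputSize (l x)
      gcongr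
      rw [h', List.length_append] at this
      rw [h', List.length_map]
      omega

theorem CT.filter {l : α → List β} {p : α → β → Bool} (hl : CT κ l)
    (hp : PT (fun q : α × β => p q.1 q.2)) : CT κ (fun x => (l x).filter (p x)) := by
  have h : ∀ x (l : List β), l.foldr (fun a acc => if p x a = true then a :: acc else acc) [] =
      l.filter (p x) := by
    intro x l
    induction l with
    | nil => rfl
    | cons a l ih => rw [List.foldr_cons, ih, List.filter_cons]
  refine (CT.foldr (g := fun x a acc => if p x a = true then a :: acc else acc) hl (.const []) ?_
    hl.bdd (fun x l₁ l₂ h' => ?_)).of_eq fun x => h _ _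
  · exact .ite (.comp (f := fun q : α × β × List β => (q.1, q.2.1)) hp
      (.pair (.fst .id) (.fst (.snd .id)))) (.cons (.fst (.snd .id)) (.snd (.snd .id)))
      (.snd (.snd .id))
  · have h2 := inputSize_append l₁ l₂
    have h3 := inputSize_append (l₂.filter (p x)) (l₂.filter fun a => !p x a)
    rw [inputSize_perm (List.filter_append_perm (p x) l₂)] at h3
    have := one_le_inputSize l₁
    have := one_le_inputSize (l₂.filter fun a => !p x a)
    rw [h, h']
    omega

theorem inputSize_flatten_le (l : List (List β)) : inputSize l.flatten ≤ inputSize l := by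
  induction l with
  | nil => exact le_rfl
  | cons a l ih =>
    have := inputSize_append a l.flatten
    rw [List.flatten_cons, inputSize_cons]
    omega

theorem CT.flatten {l : α → List (List β)} (hl : CT κ l) : CT κ (fun x => (l x).flatten) := by
  have h : ∀ l : List (List β), l.foldr (fun a acc => a ++ acc) [] = l.flatten := by
    intro l
    induction l with
    | nil => rfl
    | cons a l ih => rw [List.foldr_cons, ih, List.flatten_cons]
  refine (CT.foldr (g := fun _ a acc => a ++ acc) hl (.const []) ?_ hl.bdd
    (fun x l₁ l₂ h' => ?_)).of_eq fun x => h _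
  · exact .append (.fst (.snd .id)) (.snd (.snd .id))
  · have h2 := inputSize_append l₁ l₂
    have := one_le_inputSize l₁
    rw [h, h']
    exact (inputSize_flatten_le _).trans (by omega)

theorem CT.flatMap {l : α → List β} {g : α → β → List γ} (hl : CT κ l)
    (hg : PT (fun q : α × β => g q.1 q.2)) : CT κ (fun x => (l x).flatMap (g x)) :=
  (CT.flatten (hl.map hg)).of_eq fun x => by rw [List.flatMap_def]

theorem CT.tail {l : α → List β} (hl : CT κ l) : CT κ (fun x => (l x).tail) :=
  (CT.listCases (g := fun _ _ t => t) hl (.const []) (.snd (.snd .id))).of_eq fun x => by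
    cases l x <;> rfl

theorem CT.headD {l : α → List β} {b : α → β} (hl : CT κ l) (hb : CT κ b) :
    CT κ (fun x => (l x).headD (b x)) :=
  (CT.listCases (g := fun _ a _ => a) hl hb (.fst (.snd .id))).of_eq fun x => by
    cases l x <;> rfl

theorem CT.zip {l : α → List β} {l' : α → List γ} (hl : CT κ l) (hl' : CT κ l') :
    CT κ (fun x => (l x).zip (l' x)) := by
  -- The state holds the unread part of the second list and the output in reverse order; once the
  -- second list is exhausted, nothing changes any more.
  let step : List γ × List (β × γ) → β → List γ × List (β × γ) := fun s a =>
    DTGW.listCases s.1 ([], s.2) fun b t => (t, (a, b) :: s.2)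
  have h : ∀ (l : List β) (r : List γ) (acc : List (β × γ)), l.foldl step (r, acc) =
      (r.drop l.length, (l.zip r).reverse ++ acc) := by
    intro l
    induction l with
    | nil => simp
    | cons a l ih =>
      intro r acc
      cases r with
      | nil => simpa [step, DTGW.listCases] using ih [] acc
      | cons b r => exact (ih r ((a, b) :: acc)).trans (by simp)
  refine (CT.reverse (CT.snd (CT.foldl (g := fun _ => step) (B := fun x => inputSize (l' x) +
      (inputSize (l x) * ((inputSize (l x) + inputSize (l' x) + 1) + 1) + 1) + 1) hl
      (.pair hl' (.const [])) ?_ ((hl'.bdd.add ((hl.bdd.mul (((hl.bdd.add hl'.bdd).add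
        (.const 1)).add (.const 1))).add (.const 1))).add (.const 1)) fun x l₁ l₂ h' => ?_))).of_eq
      fun x => ?_
  · refine CT.listCases (g := fun (q : α × (List γ × List (β × γ)) × β) b t =>
      (t, (q.2.2, b) :: q.2.1.2)) (.fst (.fst (.snd .id))) (.pair (.const [])
      (.snd (.fst (.snd .id)))) ?_
    exact .pair (.snd (.snd .id)) (.cons (.pair (.snd (.snd (.fst .id))) (.fst (.snd .id)))
      (.snd (.fst (.snd (.fst .id)))))
  · rw [h, List.append_nil, inputSize_prod, inputSize_perm (List.reverse_perm _)]
    have h1 := inputSize_append ((l' x).take l₁.length) ((l' x).drop l₁.length)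
    rw [List.take_append_drop] at h1
    have h2 := one_le_inputSize ((l' x).take l₁.length)
    have h3 : inputSize (l₁.zip (l' x)) ≤
        inputSize (l x) * ((inputSize (l x) + inputSize (l' x) + 1) + 1) + 1 := by
      refine (inputSize_list_le (B := inputSize (l x) + inputSize (l' x) + 1) ?_).trans ?_
      · rintro ⟨a, b⟩ hab
        have h4 := inputSize_le_of_mem (l := l x) (a := a) (by
          rw [h']; exact List.mem_append_left _ (List.of_mem_zip hab).1)
        have h5 := inputSize_le_of_mem (l := l' x) (List.of_mem_zip hab).2
        rw [inputSize_prod]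
        omega
      · have := length_le_inputSize (l x)
        gcongr
        rw [h', List.length_append] at this
        rw [h', List.length_zip]
        omega
    omega
  · simp only [h, List.append_nil, List.reverse_reverse]

theorem CT.zipWith {l : α → List β} {l' : α → List γ} {g : α → β → γ → ε} (hl : CT κ l)
    (hl' : CT κ l') (hg : PT (fun q : α × β × γ => g q.1 q.2.1 q.2.2)) :
    CT κ (fun x => List.zipWith (g x) (l x) (l' x)) :=
  (CT.map (g := fun x (q : β × γ) => g x q.1 q.2) (hl.zip hl') hg).of_eq fun x => by
    rw [List.zip, List.map_zipWith]

theorem inputSize_bool_le (b : Bool) : inputSize b ≤ 3 := by cases b <;> decide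

theorem CT.any {l : α → List β} {p : α → β → Bool} (hl : CT κ l)
    (hp : PT (fun q : α × β => p q.1 q.2)) : CT κ (fun x => (l x).any (p x)) := by
  have h : ∀ x (l : List β), l.foldr (fun a acc => if p x a = true then true else acc) false =
      l.any (p x) := by
    intro x l
    induction l with
    | nil => rfl
    | cons a l ih => rw [List.foldr_cons, ih, List.any_cons]; cases p x a <;> simp
  refine (CT.foldr (g := fun x a acc => if p x a = true then true else acc) hl (.const false) ?_
    (Bdd.const 3) (fun x l₁ l₂ h' => inputSize_bool_le _)).of_eq fun x => h _ _
  exact .ite (.comp (f := fun q : α × β × Bool => (q.1, q.2.1)) hp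
      (.pair (.fst .id) (.fst (.snd .id)))) (.const true) (.snd (.snd .id))

theorem CT.and {p q : α → Bool} (hp : CT κ p) (hq : CT κ q) : CT κ (fun x => p x && q x) :=
  (CT.ite hp hq (.const false)).of_eq fun x => by cases p x <;> simp

theorem CT.not {p : α → Bool} (hp : CT κ p) : CT κ (fun x => !p x) :=
  (CT.ite hp (.const false) (.const true)).of_eq fun x => by cases p x <;> simp

theorem CT.or {p q : α → Bool} (hp : CT κ p) (hq : CT κ q) : CT κ (fun x => p x || q x) :=
  (CT.ite hp (.const true) hq).of_eq fun x => by cases p x <;> simp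

theorem CT.isEmpty {l : α → List β} (hl : CT κ l) : CT κ (fun x => (l x).isEmpty) :=
  (CT.listCases (g := fun _ _ _ => false) hl (.const true) (.const false)).of_eq fun x => by
    cases l x <;> rfl

/-- Equality of lists is decidable in polynomial time if equality of the entries is. -/
theorem PT.list_beq {e : β → β → Bool} (he : PT (fun q : β × β => e q.1 q.2))
    (hee : ∀ a b, e a b = true ↔ a = b) :
    ∃ E : List β → List β → Bool, PT (fun q : List β × List β => E q.1 q.2) ∧
      ∀ a b, E a b = true ↔ a = b := by
  -- The state holds the unread part of the second list and the verdict so far. The lists are equal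
  -- if the verdict survives and nothing is left unread.
  let step : List β × Bool → β → List β × Bool := fun s a =>
    DTGW.listCases s.1 ([], false) fun b t => (t, s.2 && e a b)
  let E : List β → List β → Bool := fun l r => (l.foldl step (r, true)).2 &&
    (l.foldl step (r, true)).1.isEmpty
  have h : ∀ (l r : List β) (ok : Bool), (l.foldl step (r, ok)).1 = r.drop l.length ∧
      (((l.foldl step (r, ok)).2 && (l.foldl step (r, ok)).1.isEmpty) = true ↔
        ok = true ∧ l = r) := by
    intro l
    induction l with
    | nil => intro r ok; cases r <;> simp
    | cons a l ih =>
      intro r ok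
      cases r with
      | nil => simpa [step, DTGW.listCases] using ih [] false
      | cons b r =>
        obtain ⟨h1, h2⟩ := ih r (ok && e a b)
        refine ⟨h1, ?_⟩
        simp only [List.foldl_cons, step, DTGW.listCases] at h2 ⊢
        rw [h2]
        simp [hee, and_assoc]
  refine ⟨E, ?_, fun a b => by simp only [E, (h a b true).2, true_and]⟩
  have hf : PT (fun q : List β × List β => q.1.foldl step (q.2, true)) := by
    refine CT.foldl (g := fun _ => step) (B := fun q => inputSize q.2 + 3 + 1) (.fst .id)
      (.pair (.snd .id) (.const true)) ?_ ((((CT.snd .id).bdd).add (.const 3)).add (.const 1))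
      fun q l₁ l₂ _ => ?_
    · refine CT.listCases (g := fun (q : (List β × List β) × (List β × Bool) × β) b t =>
        (t, q.2.1.2 && e q.2.2 b)) (.fst (.fst (.snd .id))) (.const _) ?_
      exact .pair (.snd (.snd .id)) (.and (.snd (.fst (.snd (.fst .id)))) (.comp he
        (.pair (.snd (.snd (.fst .id))) (.fst (.snd .id)))))
    · rw [show l₁.foldl step (q.2, true) = (_, _) from rfl, inputSize_prod, (h l₁ q.2 true).1]
      have h1 := inputSize_append (q.2.take l₁.length) (q.2.drop l₁.length)
      rw [List.take_append_drop] at h1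
      have h2 := one_le_inputSize (q.2.take l₁.length)
      have h3 := inputSize_bool_le (l₁.foldl step (q.2, true)).2
      omega
  exact .and (.snd hf) (.isEmpty (.fst hf))

end Lists

/-! ### Arithmetic of natural numbers in binary -/

section Nat

variable {α K : Type} [Enc α] {κ : α → K}

/-- The number with the given binary digits, least significant first. -/
def ofBits (l : List Bool) : ℕ := l.foldr Nat.bit 0

theorem ofBits_cons (b : Bool) (l : List Bool) : ofBits (b :: l) = Nat.bit b (ofBits l) := rfl

theorem ofBits_bits (n : ℕ) : ofBits n.bits = n := by
  induction n using Nat.binaryRec' with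
  | zero => simp [ofBits]
  | bit b n h ih => rw [Nat.bits_append_bit n b h, ofBits_cons, ih]

/-- Prepend a digit, but do not create leading zeros. -/
def consBit (b : Bool) (l : List Bool) : List Bool := if b || !l.isEmpty then b :: l else l

/-- Digit lists that arise in computations may end in zeros, while the encoding of a number may not;
`consBit` restores the canonical form. -/
theorem foldr_consBit (l : List Bool) : l.foldr consBit [] = (ofBits l).bits := by
  induction l with
  | nil => simp [ofBits]
  | cons b l ih =>
    rw [List.foldr_cons, ih, ofBits_cons, consBit]
    -- This is the condition under which prepending `b` creates no superfluous zero.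
    by_cases h : ofBits l = 0 → b = true
    · rw [Nat.bits_append_bit _ _ h]
      cases b
      · have : (ofBits l) ≠ 0 := by simpa using h
        have h2 : (ofBits l).bits ≠ [] := fun h0 => this (by
          rw [← ofBits_bits (ofBits l), h0]; rfl)
        simp [h2]
      · simp
    · push Not at h
      obtain ⟨h1, h2⟩ := h
      simp only [Bool.not_eq_true] at h2
      simp [h1, h2]

theorem CT.bits {f : α → ℕ} (h : CT κ f) : CT κ (fun x => (f x).bits) := h

theorem CT.of_bits {f : α → List Bool} (h : CT κ f) : CT κ (fun x => ofBits (f x)) := by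
  change CT κ (fun x => (ofBits (f x)).bits)
  refine (CT.foldr (g := fun _ => consBit) (B := fun x => inputSize (f x)) h (.const []) ?_ h.bdd
    fun x l₁ l₂ h' => ?_).of_eq fun x => foldr_consBit _
  · exact CT.ite (.or (.fst (.snd .id)) (.not (.isEmpty (.snd (.snd .id)))))
      (.cons (.fst (.snd .id)) (.snd (.snd .id))) (.snd (.snd .id))
  · have : ∀ l : List Bool, inputSize (l.foldr consBit []) ≤ inputSize l := by
      intro l
      induction l with
      | nil => exact le_rfl
      | cons b l ih =>
        rw [List.foldr_cons, consBit, inputSize_cons]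
        split
        · rw [inputSize_cons]; omega
        · omega
    have h1 := inputSize_append l₁ l₂
    have h2 := one_le_inputSize l₁
    have h3 := this l₂
    rw [h']
    omega

theorem inputSize_nat_le (n : ℕ) : inputSize n ≤ 4 * n.size + 1 := by
  have := inputSize_list_le (l := n.bits) (B := 3) fun a _ => inputSize_bool_le a
  rw [← Nat.size_eq_bits_len]
  exact this.trans (by omega)

theorem size_le_inputSize (n : ℕ) : n.size + 1 ≤ inputSize n := by
  rw [← Nat.size_eq_bits_len]
  exact length_le_inputSize n.bits

theorem size_add_le (m n : ℕ) : (m + n).size ≤ max m.size n.size + 1 := by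
  rw [Nat.size_le, pow_succ, mul_two]
  exact add_lt_add (Nat.size_le.1 (le_max_left _ _)) (Nat.size_le.1 (le_max_right _ _))

theorem size_mul_le (m n : ℕ) : (m * n).size ≤ m.size + n.size := by
  rw [Nat.size_le, pow_add]
  exact Nat.mul_lt_mul'' (Nat.lt_size_self _) (Nat.lt_size_self _)

/-- One step of binary addition: remaining digits of the summands, carry, reversed output. -/
def addStep (s : (List Bool × List Bool) × Bool × List Bool) (_ : Bool) :
    (List Bool × List Bool) × Bool × List Bool :=
  ((s.1.1.tail, s.1.2.tail),
    ((s.1.1.headD false && s.1.2.headD false) ||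
      (s.2.1 && (s.1.1.headD false || s.1.2.headD false))),
    (Bool.xor (Bool.xor (s.1.1.headD false) (s.1.2.headD false)) s.2.1) :: s.2.2)

theorem ofBits_headD_tail (l : List Bool) : ofBits l = Nat.bit (l.headD false) (ofBits l.tail) := by
  cases l <;> rfl

/-- The list `w` is only a clock that outlasts both summands. The final carry is the top digit, so
it is appended after the output has been reversed. -/
theorem foldl_addStep (w a b : List Bool) (c : Bool) (o : List Bool)
    (ha : a.length ≤ w.length) (hb : b.length ≤ w.length) :
    ∃ r : List Bool, ∃ c' : Bool, w.foldl addStep ((a, b), c, o) =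
      (([], []), c', r.reverse ++ o) ∧ 
      ofBits (r ++ [c']) = ofBits a + ofBits b + c.toNat ∧ r.length = w.length := by
  induction w generalizing a b c o with
  | nil =>
    simp only [List.length_nil, Nat.le_zero, List.length_eq_zero_iff] at ha hb
    subst ha hb
    exact ⟨[], c, by simp, by cases c <;> simp [ofBits], rfl⟩
  | cons x w ih =>
    -- The full adder: the exclusive or is the digit, the majority is the carry.
    have key : ∀ (p q c : Bool) (m n : ℕ), Nat.bit (Bool.xor (Bool.xor p q) c)
        (m + n + ((p && q) || (c && (p || q))).toNat) = Nat.bit p m + Nat.bit q n + c.toNat := by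
      intro p q c m n
      cases p <;> cases q <;> cases c <;> simp [Nat.bit_val] <;> omega
    obtain ⟨r, c', h1, h2, h3⟩ := ih a.tail b.tail _ _ (by simp at *; omega) (by simp at *; omega)
    refine ⟨Bool.xor (Bool.xor (a.headD false) (b.headD false)) c :: r, c', ?_, ?_, by simp [h3]⟩
    · rw [List.reverse_cons, List.append_assoc]
      exact h1
    rw [List.cons_append, ofBits_cons, h2, ofBits_headD_tail a, ofBits_headD_tail b]
    exact key _ _ _ _ _

theorem inputSize_bools_le (l : List Bool) : inputSize l ≤ 4 * l.length + 1 :=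
  (inputSize_list_le fun a _ => inputSize_bool_le a).trans (by omega)

theorem CT.nat_add {f g : α → ℕ} (hf : CT κ f) (hg : CT κ g) : CT κ (fun x => f x + g x) := by
  refine CT.comp (g := fun q : ℕ × ℕ => q.1 + q.2) ?_ (.pair hf hg)
  let F : ℕ × ℕ → (List Bool × List Bool) × Bool × List Bool := fun q =>
    (q.1.bits ++ q.2.bits).foldl addStep ((q.1.bits, q.2.bits), false, [])
  have hF : PT F := by
    refine CT.foldl (g := fun _ => addStep) (B := fun q : ℕ × ℕ => 12 * inputSize q + 20)
      (.append (.bits (.fst .id)) (.bits (.snd .id))) (.pair (.pair (.bits (.fst .id))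
      (.bits (.snd .id))) (.const _)) ?_ (((Bdd.const 12).mul Bdd.size).add (.const 20)) ?_
    · have ha : PT (fun q : (ℕ × ℕ) × ((List Bool × List Bool) × Bool × List Bool) × Bool =>
          q.2.1.1.1.headD false) := .headD (.fst (.fst (.fst (.snd .id)))) (.const false)
      have hb : PT (fun q : (ℕ × ℕ) × ((List Bool × List Bool) × Bool × List Bool) × Bool =>
          q.2.1.1.2.headD false) := .headD (.snd (.fst (.fst (.snd .id)))) (.const false)
      have hc : PT (fun q : (ℕ × ℕ) × ((List Bool × List Bool) × Bool × List Bool) × Bool =>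
          q.2.1.2.1) := .fst (.snd (.fst (.snd .id)))
      have hx : ∀ p q : (ℕ × ℕ) × ((List Bool × List Bool) × Bool × List Bool) × Bool → Bool,
          PT p → PT q → PT (fun x => Bool.xor (p x) (q x)) := fun p q hp hq =>
        (CT.ite hp (.not hq) hq).of_eq fun x => by cases p x <;> simp
      exact .pair (.pair (.tail (.fst (.fst (.fst (.snd .id)))))
        (.tail (.snd (.fst (.fst (.snd .id)))))) (.pair (.or (.and ha hb) (.and hc (.or ha hb)))
        (.cons (hx _ _ (hx _ _ ha hb) hc) (.snd (.snd (.fst (.snd .id))))))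
    · rintro ⟨m, n⟩ l₁ l₂ h
      have hl : ∀ (w : List Bool) s, (w.foldl addStep s).1.1.length ≤ s.1.1.length ∧
          (w.foldl addStep s).1.2.length ≤ s.1.2.length ∧
          (w.foldl addStep s).2.2.length = s.2.2.length + w.length := by
        intro w
        induction w with
        | nil => simp
        | cons a w ih =>
          intro s
          have := ih (addStep s a)
          simp only [addStep, List.length_tail, List.length_cons, List.foldl_cons] at this ⊢
          omega
      have h0 := hl l₁ ((m.bits, n.bits), false, [])
      generalize l₁.foldl addStep ((m.bits, n.bits), false, []) = s at h0
      have hm := length_le_inputSize m.bits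
      have hn := length_le_inputSize n.bits
      have h1 := inputSize_bools_le s.1.1
      have h2 := inputSize_bools_le s.1.2
      have h3 := inputSize_bools_le s.2.2
      have h4 := inputSize_bool_le s.2.1
      have h5 := congrArg List.length h
      simp only [List.length_append, List.length_nil] at h5 h0
      change inputSize s.1.1 + inputSize s.1.2 + 1 + (inputSize s.2.1 + inputSize s.2.2 + 1) + 1 ≤
        12 * (inputSize m.bits + inputSize n.bits + 1) + 20
      omega
  refine (CT.of_bits (.append (.reverse (.snd (.snd hF))) (.cons (.fst (.snd hF))
    (.const [])))).of_eq fun q => ?_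
  obtain ⟨r, c, h1, h2, -⟩ := foldl_addStep (q.1.bits ++ q.2.bits) q.1.bits q.2.bits false []
    (by simp) (by simp)
  simp only [F, h1, List.append_nil, List.reverse_reverse, h2, ofBits_bits, Bool.toNat_false,
    add_zero]

theorem CT.nat_ite_zero {b : α → Bool} {f : α → ℕ} (hb : CT κ b) (hf : CT κ f) :
    CT κ (fun x => if b x = true then f x else 0) := .ite hb hf (.const 0)

theorem foldr_mul (a : List Bool) (n : ℕ) :
    a.foldr (fun b acc => acc + acc + if b = true then n else 0) 0 = ofBits a * n := by
  induction a with
  | nil => simp [ofBits]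
  | cons b a ih =>
    rw [List.foldr_cons, ih, ofBits_cons]
    cases b <;> simp [Nat.bit_val] <;> ring

theorem CT.nat_mul {f g : α → ℕ} (hf : CT κ f) (hg : CT κ g) : CT κ (fun x => f x * g x) := by
  refine CT.comp (g := fun q : ℕ × ℕ => q.1 * q.2) ?_ (.pair hf hg)
  refine (CT.foldr (l := fun q : ℕ × ℕ => q.1.bits) (b := fun _ => 0)
    (g := fun q b acc => acc + acc + if b = true then q.2 else 0)
    (B := fun q => 4 * inputSize q + 1) (.bits (.fst .id)) (.const 0) ?_
    (((Bdd.const 4).mul Bdd.size).add (.const 1)) ?_).of_eq fun q => ?_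
  · exact .nat_add (.nat_add (.snd (.snd .id)) (.snd (.snd .id)))
      (.nat_ite_zero (.fst (.snd .id)) (.snd (.fst .id)))
  · rintro ⟨m, n⟩ l₁ l₂ h
    -- The intermediate values of Horner's scheme are `ofBits l₂ * n`, where `l₂` consists of the
    -- leading digits of `m`.
    have h1 : (ofBits l₂).size ≤ m.size := by
      have : ∀ l : List Bool, (ofBits l).size ≤ l.length := by
        intro l
        induction l with
        | nil => simp [ofBits]
        | cons b l ih =>
          rw [Nat.size_le] at ih ⊢
          rw [ofBits_cons, List.length_cons, pow_succ, Nat.bit_val]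
          cases b <;> simp <;> omega
      refine (this l₂).trans ?_
      rw [← Nat.size_eq_bits_len, show m.bits = l₁ ++ l₂ from h, List.length_append]
      omega
    rw [foldr_mul]
    have h2 := inputSize_nat_le (ofBits l₂ * n)
    have h3 := size_mul_le (ofBits l₂) n
    have h4 := size_le_inputSize m
    have h5 := size_le_inputSize n
    rw [inputSize_prod]
    change inputSize (ofBits l₂ * n) ≤ _
    omega
  · rw [foldr_mul, ofBits_bits]

/-- One step of binary comparison: remaining digits, result so far. -/
def leStep (s : (List Bool × List Bool) × Bool) (_ : Bool) : (List Bool × List Bool) × Bool :=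
  ((s.1.1.tail, s.1.2.tail),
    ((!s.1.1.headD false) && s.1.2.headD false) ||
      (((!s.1.1.headD false) || s.1.2.headD false) && s.2))

/-- The least significant digits come first, so each later difference overrides the result so far.
The initial value `c` survives exactly if the numbers are equal; `true` gives `≤`. -/
theorem foldl_leStep (w a b : List Bool) (c : Bool) (ha : a.length ≤ w.length)
    (hb : b.length ≤ w.length) : (w.foldl leStep ((a, b), c)).2 = true ↔
      ofBits a < ofBits b ∨ ofBits a = ofBits b ∧ c = true := by
  induction w generalizing a b c with
  | nil =>
    simp only [List.length_nil, Nat.le_zero, List.length_eq_zero_iff] at ha hb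
    subst ha hb
    simp
  | cons x w ih =>
    have key : ∀ (p q c : Bool) (m n : ℕ), (m < n ∨ m = n ∧
        (((!p) && q) || (((!p) || q) && c)) = true) ↔ (Nat.bit p m < Nat.bit q n ∨
          Nat.bit p m = Nat.bit q n ∧ c = true) := by
      intro p q c m n
      cases p <;> cases q <;> cases c <;> simp [Nat.bit_val] <;> omega
    rw [List.foldl_cons, leStep, ih _ _ _ (by simp at *; omega) (by simp at *; omega),
      ofBits_headD_tail a, ofBits_headD_tail b]
    exact key _ _ _ _ _

theorem CT.nat_le {f g : α → ℕ} (hf : CT κ f) (hg : CT κ g) :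
    CT κ (fun x => decide (f x ≤ g x)) := by
  refine CT.comp (g := fun q : ℕ × ℕ => decide (q.1 ≤ q.2)) ?_ (.pair hf hg)
  let F : ℕ × ℕ → (List Bool × List Bool) × Bool := fun q =>
    (q.1.bits ++ q.2.bits).foldl leStep ((q.1.bits, q.2.bits), true)
  have hF : PT F := by
    refine CT.foldl (g := fun _ => leStep) (B := fun q : ℕ × ℕ => 12 * inputSize q + 20)
      (.append (.bits (.fst .id)) (.bits (.snd .id))) (.pair (.pair (.bits (.fst .id))
      (.bits (.snd .id))) (.const _)) ?_ (((Bdd.const 12).mul Bdd.size).add (.const 20)) ?_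
    · have ha : PT (fun q : (ℕ × ℕ) × ((List Bool × List Bool) × Bool) × Bool =>
          q.2.1.1.1.headD false) := .headD (.fst (.fst (.fst (.snd .id)))) (.const false)
      have hb : PT (fun q : (ℕ × ℕ) × ((List Bool × List Bool) × Bool) × Bool =>
          q.2.1.1.2.headD false) := .headD (.snd (.fst (.fst (.snd .id)))) (.const false)
      exact .pair (.pair (.tail (.fst (.fst (.fst (.snd .id)))))
        (.tail (.snd (.fst (.fst (.snd .id)))))) (.or (.and (.not ha) hb)
        (.and (.or (.not ha) hb) (.snd (.fst (.snd .id)))))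
    · rintro ⟨m, n⟩ l₁ l₂ h
      have hl : ∀ (w : List Bool) s, (w.foldl leStep s).1.1.length ≤ s.1.1.length ∧
          (w.foldl leStep s).1.2.length ≤ s.1.2.length := by
        intro w
        induction w with
        | nil => simp
        | cons a w ih =>
          intro s
          have := ih (leStep s a)
          simp only [leStep, List.length_tail, List.foldl_cons] at this ⊢
          omega
      have h0 := hl l₁ ((m.bits, n.bits), true)
      generalize l₁.foldl leStep ((m.bits, n.bits), true) = s at h0
      have hm := length_le_inputSize m.bits
      have hn := length_le_inputSize n.bits
      have h1 := inputSize_bools_le s.1.1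
      have h2 := inputSize_bools_le s.1.2
      have h4 := inputSize_bool_le s.2
      change inputSize s.1.1 + inputSize s.1.2 + 1 + inputSize s.2 + 1 ≤
        12 * (inputSize m.bits + inputSize n.bits + 1) + 20
      simp only at h0
      omega
  refine (CT.snd hF).of_eq fun q => ?_
  rw [Bool.eq_iff_iff, foldl_leStep _ _ _ _ (by simp) (by simp), ofBits_bits, ofBits_bits,
    decide_eq_true_iff, le_iff_lt_or_eq]
  simp

end Nat

/-! ### Nonnegative fractions -/

section Fractions

variable {α β γ K : Type} [Enc α] [Enc β] [Enc γ] {κ : α → K}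

/-- The sum of two fractions, not in lowest terms. -/
def fracAdd (p q : ℕ × ℕ) : ℕ × ℕ := (p.1 * q.2 + q.1 * p.2, p.2 * q.2)

/-- Comparison of fractions. -/
def fracLe (p q : ℕ × ℕ) : Bool := decide (p.1 * q.2 ≤ q.1 * p.2)

/-- The smaller one of two fractions. -/
def fracMin (p q : ℕ × ℕ) : ℕ × ℕ := if fracLe p q = true then p else q

/-- The sum of a list of fractions. -/
def fracSum (l : List (ℕ × ℕ)) : ℕ × ℕ := l.foldr fracAdd (0, 1)

/-- The absolute value of a rational number as a fraction. -/
def fracAbs (q : ℚ) : ℕ × ℕ := (q.num.natAbs, q.den)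

/-- The number of binary digits of a fraction. -/
def fracSize (p : ℕ × ℕ) : ℕ := max p.1.size p.2.size + 1

/-- The digits of the factors add up, and the `+ 1` in `fracSize` pays for the carry of the sum. So
unreduced fractions grow only linearly in the number of additions. -/
theorem fracSize_fracAdd (p q : ℕ × ℕ) : fracSize (fracAdd p q) ≤ fracSize p + fracSize q := by
  have h1 := size_add_le (p.1 * q.2) (q.1 * p.2)
  have h2 := size_mul_le p.1 q.2
  have h3 := size_mul_le q.1 p.2
  have h4 := size_mul_le p.2 q.2
  simp only [fracSize, fracAdd]
  omega

theorem fracSize_le_inputSize (p : ℕ × ℕ) : fracSize p ≤ inputSize p := by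
  have h1 := size_le_inputSize p.1
  have h2 := size_le_inputSize p.2
  change max p.1.size p.2.size + 1 ≤ inputSize p.1 + inputSize p.2 + 1
  omega

theorem inputSize_frac_le (p : ℕ × ℕ) : inputSize p ≤ 8 * fracSize p + 3 := by
  have h1 := inputSize_nat_le p.1
  have h2 := inputSize_nat_le p.2
  change inputSize p.1 + inputSize p.2 + 1 ≤ 8 * (max p.1.size p.2.size + 1) + 3
  omega

theorem fracSize_fracSum (l : List (ℕ × ℕ)) : fracSize (fracSum l) ≤ inputSize l + 1 := by
  induction l with
  | nil => exact le_rfl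
  | cons p l ih =>
    have h1 := fracSize_fracAdd p (fracSum l)
    have h2 := fracSize_le_inputSize p
    rw [inputSize_cons]
    change fracSize (fracAdd p (fracSum l)) ≤ _
    omega

theorem CT.fracAdd {f g : α → ℕ × ℕ} (hf : CT κ f) (hg : CT κ g) :
    CT κ (fun x => fracAdd (f x) (g x)) :=
  .pair (.nat_add (.nat_mul (.fst hf) (.snd hg)) (.nat_mul (.fst hg) (.snd hf)))
    (.nat_mul (.snd hf) (.snd hg))

theorem CT.fracLe {f g : α → ℕ × ℕ} (hf : CT κ f) (hg : CT κ g) :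
    CT κ (fun x => fracLe (f x) (g x)) :=
  .nat_le (.nat_mul (.fst hf) (.snd hg)) (.nat_mul (.fst hg) (.snd hf))

theorem CT.fracMin {f g : α → ℕ × ℕ} (hf : CT κ f) (hg : CT κ g) :
    CT κ (fun x => fracMin (f x) (g x)) := .ite (.fracLe hf hg) hf hg

theorem CT.fracSum {l : α → List (ℕ × ℕ)} (hl : CT κ l) : CT κ (fun x => fracSum (l x)) := by
  refine CT.foldr (g := fun _ => DTGW.fracAdd) (B := fun x => 8 * (inputSize (l x) + 1) + 3) hl
    (.const _) (.fracAdd (.fst (.snd .id)) (.snd (.snd .id)))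
    (((Bdd.const 8).mul (hl.bdd.add (.const 1))).add (.const 3)) fun x l₁ l₂ h => ?_
  have h1 := inputSize_append l₁ l₂
  have h2 := one_le_inputSize l₁
  have h3 := fracSize_fracSum l₂
  rw [h]
  exact (inputSize_frac_le _).trans (by unfold DTGW.fracSum at h3; omega)

theorem CT.fracAbs {f : α → ℚ} (hf : CT κ f) : CT κ (fun x => fracAbs (f x)) := by
  have h : CT κ (fun x => ((decide ((f x).num < 0), (f x).num.natAbs), (f x).den)) := hf
  exact .pair (.snd (.fst h)) (.snd h)

theorem CT.rat_neg {f : α → ℚ} (hf : CT κ f) : CT κ (fun x => decide ((f x).num < 0)) := by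
  have h : CT κ (fun x => ((decide ((f x).num < 0), (f x).num.natAbs), (f x).den)) := hf
  exact .fst (.fst h)

/-- The least of the given fractions, if any, increased by `w`. -/
def minAdd (w : ℕ × ℕ) (l : List (ℕ × ℕ)) : List (ℕ × ℕ) :=
  listCases l [] fun v t => [fracAdd w (t.foldl fracMin v)]

theorem foldl_fracMin_mem (v : ℕ × ℕ) (t : List (ℕ × ℕ)) : t.foldl fracMin v ∈ v :: t := by
  induction t generalizing v with
  | nil => simp
  | cons a t ih =>
    have h := ih (fracMin v a)
    rw [List.foldl_cons]
    rcases List.mem_cons.1 h with h | h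
    · rw [h, fracMin]; split <;> simp
    · simp [h]

theorem CT.minAdd {w : α → ℕ × ℕ} {l : α → List (ℕ × ℕ)} (hw : CT κ w) (hl : CT κ l) :
    CT κ (fun x => minAdd (w x) (l x)) := by
  refine CT.comp (g := fun q : (ℕ × ℕ) × List (ℕ × ℕ) => DTGW.minAdd q.1 q.2) ?_ (.pair hw hl)
  refine CT.listCases (g := fun (q : (ℕ × ℕ) × List (ℕ × ℕ)) v t =>
    [DTGW.fracAdd q.1 (t.foldl DTGW.fracMin v)]) (.snd .id) (.const []) (.cons
      (.fracAdd (.fst (.fst .id)) ?_) (.const []))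
  refine CT.foldl (g := fun _ => DTGW.fracMin) (B := inputSize) (.snd (.snd .id)) (.fst (.snd .id))
    (.fracMin (.fst (.snd .id)) (.snd (.snd .id))) Bdd.size fun x l₁ l₂ h => ?_
  have h1 := inputSize_le_of_mem (foldl_fracMin_mem x.2.1 l₁)
  have h2 := inputSize_append l₁ l₂
  have h3 := one_le_inputSize l₂
  rw [inputSize_cons] at h1
  change _ ≤ inputSize x.1 + (inputSize x.2.1 + inputSize x.2.2 + 1) + 1
  rw [h]
  omega

end Fractions

/-! ### Tables -/

section Tables

variable {β γ : Type}

/-- The transpose of a table given by its rows; the number of columns is the length of `ref`. -/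
def transpose (ref : List γ) (l : List (List β)) : List (List β) :=
  l.foldr (List.zipWith List.cons) (ref.map fun _ => [])

/-- The reference list matters when there are no rows: the number of columns could then not be read
off the table. -/
theorem transpose_map {ι ρ : Type} {ref : List γ} {r : List ρ} (h : ref.length = r.length)
    (is : List ι) (g : ι → ρ → β) : transpose ref (is.map fun i => r.map (g i)) =
      r.map fun u => is.map fun i => g i u := by
  induction is with
  | nil => simp [transpose, List.map_const', h]
  | cons i is ih =>
    simp only [transpose, List.map_cons, List.foldr_cons] at ih ⊢
    rw [ih, List.zipWith_map, List.zipWith_self]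

/-- Remove all entries that are equal to a later one, with respect to the test `e`. -/
def distinctBy (e : β → β → Bool) (l : List β) : List β :=
  l.foldr (fun a acc => if acc.any (e a) = true then acc else a :: acc) []

theorem distinctBy_cons (e : β → β → Bool) (a : β) (l : List β) : distinctBy e (a :: l) =
    if (distinctBy e l).any (e a) = true then distinctBy e l else a :: distinctBy e l := rfl

theorem distinctBy_sublist (e : β → β → Bool) (l : List β) : (distinctBy e l).Sublist l := by
  induction l with
  | nil => exact List.Sublist.slnil
  | cons a l ih =>
    rw [distinctBy_cons]
    split
    · exact ih.cons a
    · exact ih.cons_cons a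

end Tables

/-! ### Running times of the operations on tables -/

section TableTimes

variable {α β γ K : Type} [Enc α] [Enc β] [Enc γ] {κ : α → K}

theorem CT.dropLength {l : α → List β} {l' : α → List γ} (hl : CT κ l) (hl' : CT κ l') :
    CT κ (fun x => (l x).drop (l' x).length) := by
  have h : ∀ (w : List γ) (l : List β), w.foldl (fun r _ => r.tail) l = l.drop w.length := by
    intro w
    induction w with
    | nil => simp
    | cons a w ih => intro l; rw [List.foldl_cons, ih]; cases l <;> simp
  refine (CT.foldl (g := fun _ r _ => r.tail) hl' hl (.tail (.fst (.snd .id))) hl.bdd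
    fun x l₁ l₂ _ => ?_).of_eq fun x => h _ _
  have h1 := inputSize_append ((l x).take l₁.length) ((l x).drop l₁.length)
  rw [List.take_append_drop] at h1
  have h2 := one_le_inputSize ((l x).take l₁.length)
  rw [h]
  omega

theorem inputSize_transpose_le (ref : List γ) (l : List (List β)) :
    inputSize (transpose ref l) ≤ 2 * inputSize ref + inputSize l := by
  have h1 : ∀ (r : List β) (t : List (List β)),
      inputSize (List.zipWith List.cons r t) ≤ inputSize r + inputSize t := by
    intro r
    induction r with
    | nil => intro t; rw [List.zipWith_nil_left]; have := one_le_inputSize t; simp only [inputSize_nil]; omega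
    | cons a r ih =>
      intro t
      cases t with
      | nil => rw [List.zipWith_nil_right]; simp only [inputSize_nil]; omega
      | cons b t =>
        have := ih t
        rw [List.zipWith_cons_cons]
        simp only [inputSize_cons]
        omega
  induction l with
  | nil =>
    have h2 := inputSize_list_le (l := ref.map fun _ => ([] : List β)) (B := 1) (by
      simp [inputSize_nil])
    have h3 := length_le_inputSize ref
    rw [List.length_map] at h2
    change inputSize (ref.map fun _ => ([] : List β)) ≤ _
    rw [inputSize_nil]
    omega
  | cons r l ih =>
    have := h1 r (transpose ref l)
    rw [inputSize_cons]
    change inputSize (List.zipWith List.cons r (transpose ref l)) ≤ _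
    omega

theorem CT.transpose {ref : α → List γ} {l : α → List (List β)} (hr : CT κ ref) (hl : CT κ l) :
    CT κ (fun x => transpose (ref x) (l x)) := by
  refine CT.foldr (g := fun _ => List.zipWith List.cons)
    (B := fun x => 2 * inputSize (ref x) + inputSize (l x)) hl (.map hr (.const [])) ?_
    (((Bdd.const 2).mul hr.bdd).add hl.bdd) fun x l₁ l₂ h => ?_
  · exact .zipWith (g := fun _ => List.cons) (.fst (.snd .id)) (.snd (.snd .id))
      (.cons (.fst (.snd .id)) (.snd (.snd .id)))
  · refine (inputSize_transpose_le (ref x) l₂).trans ?_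
    have h2 := inputSize_append l₁ l₂
    have h3 := one_le_inputSize l₁
    rw [h]
    omega

theorem inputSize_le_of_sublist {l l' : List β} (h : l.Sublist l') :
    inputSize l ≤ inputSize l' := by
  induction h with
  | slnil => exact le_rfl
  | cons a h ih => rw [inputSize_cons]; omega
  | cons_cons a h ih => rw [inputSize_cons, inputSize_cons]; omega

theorem CT.distinctBy {e : β → β → Bool} (he : PT (fun q : β × β => e q.1 q.2)) {l : α → List β}
    (hl : CT κ l) : CT κ (fun x => distinctBy e (l x)) := by
  refine CT.foldr (g := fun _ a acc => if acc.any (e a) = true then acc else a :: acc) hl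
    (.const []) (.ite ?_ (.snd (.snd .id)) (.cons (.fst (.snd .id)) (.snd (.snd .id)))) hl.bdd
    fun x l₁ l₂ h => ?_
  · exact .any (p := fun (q : α × β × List β) => e q.2.1) (.snd (.snd .id))
      (.comp he (.pair (.fst (.snd (.fst .id))) (.snd .id)))
  · refine inputSize_le_of_sublist ((distinctBy_sublist e l₂).trans ?_)
    rw [h]
    exact List.sublist_append_right _ _

end TableTimes

/-! ### Shortest warping paths -/

section Warping

variable {β γ : Type}

/-- The cost of an optimal warping path between two sequences (a list of at most one fraction). -/
def cell (cost : β → γ → ℕ × ℕ) : List β → List γ → List (ℕ × ℕ)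
  | [], [] => [(0, 1)]
  | [], _ :: _ => []
  | _ :: _, [] => []
  | x :: xs, y :: ys =>
    minAdd (cost x y) (cell cost xs (y :: ys) ++ cell cost xs ys ++ cell cost (x :: xs) ys)
termination_by xs ys => xs.length + ys.length

/-- The costs for `x :: xs` and all tails of `ys`, given those for `xs`. -/
def nextRow (cost : β → γ → ℕ × ℕ) (ys : List γ) (x : β) (o : List (List (ℕ × ℕ))) :
    List (List (ℕ × ℕ)) :=
  (ys.zip (o.zip o.tail)).foldr
    (fun q r => minAdd (cost x q.1) (q.2.1 ++ q.2.2 ++ r.headD []) :: r) [[]]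

/-- The dynamic program for optimal warping paths. -/
def warpRow (cost : β → γ → ℕ × ℕ) (xs : List β) (ys : List γ) : List (List (ℕ × ℕ)) :=
  xs.foldr (nextRow cost ys) (ys.map (fun _ => []) ++ [[(0, 1)]])

/-- The row is built from its right end. At `y`, the three successors of the cell are the entries of
`o` and `o.tail` at this position and the head of what is already built; the final `[]` records that
nothing can be warped to an empty sequence. -/
theorem nextRow_tails (cost : β → γ → ℕ × ℕ) (xs : List β) (x : β) (ys : List γ) :
    nextRow cost ys x (ys.tails.map (cell cost xs)) = ys.tails.map (cell cost (x :: xs)) := by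
  induction ys with
  | nil => simp [nextRow, cell]
  | cons y ys ih =>
    have h : ∀ (zs : List β), ∃ t, ys.tails.map (cell cost zs) = cell cost zs ys :: t := by
      intro zs; cases ys <;> simp
    obtain ⟨t, ht⟩ := h xs
    obtain ⟨t', ht'⟩ := h (x :: xs)
    simp only [nextRow, List.tails_cons, List.map_cons, List.tail_cons] at ih ⊢
    rw [ht'] at ih ⊢
    rw [ht] at ih ⊢
    rw [List.zip_cons_cons, List.zip_cons_cons, List.foldr_cons]
    rw [List.tail_cons] at ih
    rw [ih, List.headD_cons, cell]

theorem warpRow_eq (cost : β → γ → ℕ × ℕ) (xs : List β) (ys : List γ) :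
    warpRow cost xs ys = ys.tails.map (cell cost xs) := by
  induction xs with
  | nil =>
    induction ys with
    | nil => simp [warpRow, cell]
    | cons y ys ih =>
      simp only [warpRow, List.foldr_nil, List.tails_cons, List.map_cons, List.cons_append] at ih ⊢
      rw [ih, cell]
  | cons x xs ih =>
    rw [← nextRow_tails, ← ih]
    rfl

theorem minAdd_bound {w : ℕ × ℕ} {l : List (ℕ × ℕ)} {C M : ℕ} (hw : fracSize w ≤ C)
    (hl : ∀ v ∈ l, fracSize v ≤ M) :
    (minAdd w l).length ≤ 1 ∧ ∀ v ∈ minAdd w l, fracSize v ≤ C + M := by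
  cases l with
  | nil => simp [minAdd, listCases]
  | cons v t =>
    have h1 := hl _ (foldl_fracMin_mem v t)
    have h2 := fracSize_fracAdd w (t.foldl fracMin v)
    simp only [minAdd, listCases, List.length_singleton, le_refl, List.mem_singleton, forall_eq,
      true_and]
    omega

/-- Each recursion adds one cost of size at most `C` and shortens the two sequences by at least one
entry in total. The 2 is `fracSize (0, 1)`. -/
theorem cell_bound {cost : β → γ → ℕ × ℕ} {C : ℕ} (xs : List β) (ys : List γ)
    (h : ∀ x ∈ xs, ∀ y ∈ ys, fracSize (cost x y) ≤ C) :
    (cell cost xs ys).length ≤ 1 ∧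
      ∀ v ∈ cell cost xs ys, fracSize v ≤ (xs.length + ys.length) * C + 2 := by
  induction xs, ys using cell.induct with
  | case1 =>
    rw [cell]
    simp [fracSize]
  | case2 => rw [cell]; simp
  | case3 => rw [cell]; simp
  | case4 x xs y ys ih1 ih2 ih3 =>
    rw [cell]
    have e : (xs.length + 1 + (ys.length + 1)) * C + 2 =
      C + ((xs.length + ys.length + 1) * C + 2) := by ring
    rw [List.length_cons, List.length_cons, e]
    refine minAdd_bound (h x (by simp) y (by simp)) fun v hv => ?_
    simp only [List.mem_append] at hv
    have hC : 0 ≤ C := Nat.zero_le _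
    rcases hv with (hv | hv) | hv
    · refine ((ih1 fun x hx => h x (by simp [hx])).2 v hv).trans ?_
      rw [List.length_cons]
      gcongr ?_ * C + 2
      omega
    · refine ((ih2 fun x hx y hy => h x (by simp [hx]) y (by simp [hy])).2 v hv).trans ?_
      gcongr ?_ * C + 2
      omega
    · refine ((ih3 fun x hx y hy => h x hx y (by simp [hy])).2 v hv).trans ?_
      rw [List.length_cons]
      gcongr ?_ * C + 2
      omega

end Warping

/-! ### Running time of the dynamic program -/

section WarpingTimes

variable {α β γ K : Type} [Enc α] [Enc β] [Enc γ] {κ : α → K}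

theorem inputSize_row_le {r : List (List (ℕ × ℕ))} {M : ℕ}
    (h : ∀ o ∈ r, o.length ≤ 1 ∧ ∀ v ∈ o, fracSize v ≤ M) :
    inputSize r ≤ r.length * (8 * M + 6) + 1 := by
  refine inputSize_list_le (B := 8 * M + 5) fun o ho => ?_
  obtain ⟨h1, h2⟩ := h o ho
  refine (inputSize_list_le (B := 8 * M + 3) fun v hv =>
    (inputSize_frac_le v).trans (by have := h2 v hv; omega)).trans ?_
  have := Nat.mul_le_mul_right (8 * M + 3 + 1) h1
  omega

/-- The old row `o` is arbitrary here, so its fractions are bounded only by the input size; each new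
entry adds at most one cost to an earlier one. -/
theorem PT.nextRow {cost : β → γ → ℕ × ℕ} (hc : PT (fun q : β × γ => cost q.1 q.2)) :
    PT (fun q : List γ × β × List (List (ℕ × ℕ)) => nextRow cost q.1 q.2.1 q.2.2) := by
  obtain ⟨C, hC, hC'⟩ := hc.bdd_on (Bdd.size (α := List γ × β × List (List (ℕ × ℕ)))
    (κ := fun _ => ()))
  refine CT.foldr (g := fun (q : List γ × β × List (List (ℕ × ℕ)))
    (q' : γ × List (ℕ × ℕ) × List (ℕ × ℕ)) r =>
      DTGW.minAdd (cost q.2.1 q'.1) (q'.2.1 ++ q'.2.2 ++ r.headD []) :: r)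
    (B := fun q => (inputSize q + 1) * (8 * (inputSize q * C q + inputSize q) + 6) + 1)
    (.zip (.fst .id) (.zip (.snd (.snd .id)) (.tail (.snd (.snd .id))))) (.const _) ?_ ?_ ?_
  · exact .cons (.minAdd (.comp hc (.pair (.fst (.snd (.fst .id))) (.fst (.fst (.snd .id)))))
      (.append (.append (.fst (.snd (.fst (.snd .id)))) (.snd (.snd (.fst (.snd .id)))))
        (.headD (.snd (.snd .id)) (.const [])))) (.snd (.snd .id))
  · exact ((Bdd.size.add (.const 1)).mul (((Bdd.const 8).mul ((Bdd.size.mul hC).add .size)).add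
      (.const 6))).add (.const 1)
  · rintro ⟨ys, x, o⟩ l₁ l₂ h
    simp only at h
    set N := inputSize (ys, x, o) with hN
    have hN' : N = inputSize ys + (inputSize x + inputSize o + 1) + 1 := rfl
    have hlen : l₂.length ≤ N := by
      have h1 := congrArg List.length h
      rw [List.length_append, List.length_zip] at h1
      have := length_le_inputSize ys
      omega
    have hmem : ∀ q ∈ l₂, fracSize (cost x q.1) ≤ C (ys, x, o) ∧
        ∀ v ∈ q.2.1 ++ q.2.2, fracSize v ≤ N := by
      rintro ⟨y, o₁, o₂⟩ hq
      have h1 : (y, o₁, o₂) ∈ ys.zip (o.zip o.tail) := by rw [h]; exact List.mem_append_right _ hq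
      have h2 := List.of_mem_zip h1
      have h3 := List.of_mem_zip h2.2
      refine ⟨(fracSize_le_inputSize _).trans (hC' (ys, x, o) (x, y) ?_), fun v hv => ?_⟩
      · have := inputSize_le_of_mem h2.1
        rw [inputSize_prod]
        omega
      · have hv' : ∃ p ∈ o, v ∈ p := by
          rcases List.mem_append.1 hv with hv | hv
          · exact ⟨o₁, h3.1, hv⟩
          · exact ⟨o₂, List.mem_of_mem_tail h3.2, hv⟩
        obtain ⟨p, hp, hvp⟩ := hv'
        have h4 := inputSize_le_of_mem hp
        have h5 := inputSize_le_of_mem hvp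
        have h6 := fracSize_le_inputSize v
        omega
    have key : (l₂.foldr (fun q r => DTGW.minAdd (cost x q.1) (q.2.1 ++ q.2.2 ++ r.headD []) :: r)
        [[]]).length = l₂.length + 1 ∧ ∀ p ∈ (l₂.foldr (fun q r =>
        DTGW.minAdd (cost x q.1) (q.2.1 ++ q.2.2 ++ r.headD []) :: r) [[]]),
        p.length ≤ 1 ∧ ∀ v ∈ p, fracSize v ≤ l₂.length * C (ys, x, o) + N := by
      clear h hlen
      induction l₂ with
      | nil => simp
      | cons q l₂ ih =>
        obtain ⟨ih1, ih2⟩ := ih fun q hq => hmem q (List.mem_cons_of_mem _ hq)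
        obtain ⟨h1, h2⟩ := hmem q List.mem_cons_self
        rw [List.foldr_cons]
        generalize l₂.foldr (fun q r => DTGW.minAdd (cost x q.1) (q.2.1 ++ q.2.2 ++ r.headD []) :: r)
          [[]] = r at ih1 ih2
        refine ⟨by simp [ih1], fun p hp => ?_⟩
        rw [List.length_cons, add_mul, one_mul]
        rcases List.mem_cons.1 hp with rfl | hp
        · refine (minAdd_bound h1 (M := l₂.length * C (ys, x, o) + N) fun v hv => ?_).imp _root_.id
            fun h v hv => (h v hv).trans (by omega)
          rcases List.mem_append.1 hv with hv | hv
          · exact (h2 v hv).trans (by omega)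
          · cases r with
            | nil => simp at hv
            | cons p r => exact (ih2 p (by simp)).2 v hv
        · exact ⟨(ih2 p hp).1, fun v hv => ((ih2 p hp).2 v hv).trans (by omega)⟩
    refine (inputSize_row_le key.2).trans ?_
    rw [key.1]
    gcongr

theorem CT.cell {cost : β → γ → ℕ × ℕ} (hc : PT (fun q : β × γ => cost q.1 q.2))
    {xs : α → List β} {ys : α → List γ} (hx : CT κ xs) (hy : CT κ ys) :
    CT κ (fun x => cell cost (xs x) (ys x)) := by
  refine CT.comp (g := fun q : List β × List γ => DTGW.cell cost q.1 q.2) ?_ (.pair hx hy)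
  obtain ⟨C, hC, hC'⟩ := hc.bdd_on (Bdd.size (α := List β × List γ) (κ := fun _ => ()))
  have h : PT (fun q : List β × List γ => warpRow cost q.1 q.2) := by
    refine CT.foldr (g := fun (q : List β × List γ) => DTGW.nextRow cost q.2)
      (B := fun q => (inputSize q + 1) * (8 * (inputSize q * C q + 2) + 6) + 1) (.fst .id)
      (.append (.map (.snd .id) (.const [])) (.const _)) ?_ ?_ ?_
    · exact .comp (PT.nextRow hc) (.pair (.snd (.fst .id)) (.pair (.fst (.snd .id))
        (.snd (.snd .id))))
    · exact ((Bdd.size.add (.const 1)).mul (((Bdd.const 8).mul ((Bdd.size.mul hC).add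
        (.const 2))).add (.const 6))).add (.const 1)
    · rintro ⟨xs, ys⟩ l₁ l₂ h
      simp only at h
      have h0 : inputSize (xs, ys) = inputSize xs + inputSize ys + 1 := rfl
      have h1 := length_le_inputSize xs
      have h2 := length_le_inputSize ys
      have h3 : l₂.length ≤ xs.length := by rw [h, List.length_append]; omega
      -- The intermediate rows are genuine rows of the dynamic program, so `cell_bound` applies to
      -- each of them. Iterating the time bound for a single row would not give a polynomial.
      have key : ∀ o ∈ ys.tails.map (DTGW.cell cost l₂), o.length ≤ 1 ∧
          ∀ v ∈ o, fracSize v ≤ inputSize (xs, ys) * C (xs, ys) + 2 := by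
        intro o ho
        obtain ⟨zs, hz, rfl⟩ := List.mem_map.1 ho
        rw [List.mem_tails] at hz
        refine (cell_bound (C := C (xs, ys)) l₂ zs fun x hx y hy => ?_).imp _root_.id
          fun h v hv => (h v hv).trans ?_
        · refine (fracSize_le_inputSize _).trans (hC' (xs, ys) (x, y) ?_)
          have h4 := inputSize_le_of_mem (l := xs) (a := x) (by simp [h, hx])
          have h5 := inputSize_le_of_mem (hz.subset hy)
          rw [inputSize_prod]
          omega
        · have := hz.length_le
          gcongr
          omega
      change inputSize (warpRow cost l₂ ys) ≤ _
      rw [warpRow_eq]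
      refine (inputSize_row_le key).trans ?_
      rw [List.length_map, List.length_tails]
      gcongr
      omega
  -- The first tail of `ys` is `ys` itself.
  refine (CT.headD h (.const [])).of_eq fun q => ?_
  rw [warpRow_eq]
  cases q.2 <;> simp

end WarpingTimes

/-! ### Enumeration of all short selections from a list -/

section Picks

variable {β γ : Type}

/-- One step of the computation of `splits`. -/
def splitStep (a : β) (s : List β × List (β × List β)) : List β × List (β × List β) :=
  (a :: s.1, (a, s.1) :: s.2.map fun q => (q.1, a :: q.2))

/-- All ways to take one entry out of a list. -/
def splits (l : List β) : List (β × List β) := (l.foldr splitStep ([], [])).2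

theorem foldr_splitStep (l : List β) : l.foldr splitStep ([], []) = (l, splits l) := by
  have h : ∀ l : List β, (l.foldr splitStep ([], [])).1 = l := by
    intro l
    induction l with
    | nil => rfl
    | cons a l ih => rw [List.foldr_cons, splitStep, ih]
  exact Prod.ext (h l) rfl

theorem splits_cons (a : β) (l : List β) :
    splits (a :: l) = (a, l) :: (splits l).map fun q => (q.1, a :: q.2) := by
  rw [splits, List.foldr_cons, foldr_splitStep, splitStep]

theorem length_splits (l : List β) : (splits l).length = l.length := by
  induction l with
  | nil => rfl
  | cons a l ih => simp [splits_cons, ih]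

theorem perm_of_mem_splits {l : List β} {q : β × List β} (h : q ∈ splits l) :
    (q.1 :: q.2).Perm l := by
  induction l generalizing q with
  | nil => cases h
  | cons a l ih =>
    rw [splits_cons, List.mem_cons, List.mem_map] at h
    rcases h with rfl | ⟨q', hq', rfl⟩
    · rfl
    · exact (List.Perm.swap a q'.1 q'.2).trans ((ih hq').cons a)

theorem exists_mem_splits {l : List β} {a : β} (h : a ∈ l) : ∃ t, (a, t) ∈ splits l := by
  induction l with
  | nil => cases h
  | cons b l ih =>
    rw [splits_cons]
    rcases List.mem_cons.1 h with rfl | h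
    · exact ⟨l, List.mem_cons_self⟩
    · obtain ⟨t, ht⟩ := ih h
      exact ⟨b :: t, List.mem_cons_of_mem _ (List.mem_map.2 ⟨_, ht, rfl⟩)⟩

/-- Extend each selection in all possible ways by at most one entry. -/
def pickStep (s : List (List β × List β)) : List (List β × List β) :=
  s.flatMap fun q => q :: (splits q.2).map fun p => (p.1 :: q.1, p.2)

/-- All selections of at most `w.length` entries of `l`, together with the remaining entries. -/
def picks (w : List Bool) (l : List β) : List (List β × List β) :=
  w.foldl (fun s _ => pickStep s) [([], l)]

theorem mem_pickStep {s : List (List β × List β)} {q : List β × List β} : q ∈ pickStep s ↔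
    ∃ q' ∈ s, q = q' ∨ ∃ p ∈ splits q'.2, q = (p.1 :: q'.1, p.2) := by
  simp [pickStep, List.mem_flatMap, eq_comm]

theorem picks_concat (w : List Bool) (b : Bool) (l : List β) :
    picks (w ++ [b]) l = pickStep (picks w l) := by
  rw [picks, List.foldl_append]
  rfl

theorem perm_of_mem_picks {w : List Bool} {l : List β} {q : List β × List β}
    (h : q ∈ picks w l) : (q.1 ++ q.2).Perm l := by
  induction w using List.reverseRecOn generalizing q with
  | nil => rw [picks, List.foldl_nil, List.mem_singleton] at h; subst h; rfl
  | append_singleton w b ih =>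
    rw [picks_concat, mem_pickStep] at h
    obtain ⟨q', hq', rfl | ⟨p, hp, rfl⟩⟩ := h
    · exact ih hq'
    · refine List.Perm.trans ?_ (ih hq')
      exact List.perm_middle.symm.trans ((perm_of_mem_splits hp).append_left _)

/-- In each round, a selection is either kept or extended by one of at most `l.length` remaining
entries. -/
theorem length_picks_le (w : List Bool) (l : List β) :
    (picks w l).length ≤ (l.length + 1) ^ w.length := by
  induction w using List.reverseRecOn with
  | nil => simp [picks]
  | append_singleton w b ih =>
    rw [picks_concat, pickStep, List.length_flatMap, List.length_append, List.length_singleton,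
      pow_succ]
    refine (List.sum_le_card_nsmul _ (l.length + 1) ?_).trans ?_
    · intro n hn
      obtain ⟨q, hq, rfl⟩ := List.mem_map.1 hn
      have := (perm_of_mem_picks hq).length_eq
      rw [List.length_append] at this
      rw [List.length_cons, List.length_map, length_splits]
      omega
    · rw [List.length_map, smul_eq_mul]
      exact Nat.mul_le_mul_right _ ih

/-- Selections grow at the front, so the head of `e` is picked last; before that it belongs to the
rest. Every order of the selected entries is found, whereas the order of the rest is not controlled.
-/
theorem exists_mem_picks {w : List Bool} {l e s : List β} (h : (e ++ s).Perm l)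
    (hw : e.length ≤ w.length) : ∃ r, r.Perm s ∧ (e, r) ∈ picks w l := by
  induction w using List.reverseRecOn generalizing e s with
  | nil =>
    rw [List.length_nil, Nat.le_zero, List.length_eq_zero_iff] at hw
    subst hw
    exact ⟨l, h.symm, by simp [picks]⟩
  | append_singleton w b ih =>
    rw [picks_concat]
    cases e with
    | nil =>
      obtain ⟨r, hr, hm⟩ := ih h (by simp)
      exact ⟨r, hr, mem_pickStep.2 ⟨_, hm, .inl rfl⟩⟩
    | cons a e =>
      obtain ⟨r, hr, hm⟩ := ih (e := e) (s := a :: s) (List.perm_middle.trans h)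
        (by simp at hw; omega)
      obtain ⟨t, ht⟩ := exists_mem_splits (hr.symm.subset (List.mem_cons_self (a := a) (l := s)))
      exact ⟨t, ((perm_of_mem_splits ht).trans hr).cons_inv,
        mem_pickStep.2 ⟨_, hm, .inr ⟨_, ht, rfl⟩⟩⟩

/-! ### Greedy matching of equal keys -/

/-- Take an entry with key `k` out of the pool, if there is one, and else any entry. -/
def greedyStep (e : γ → γ → Bool) (s : List (γ × β) × List (γ × β)) (k : γ) :
    List (γ × β) × List (γ × β) :=
  listCases (s.1.filter (fun p => e k p.1) ++ s.1.filter (fun p => !e k p.1)) ([], s.2)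
    fun h t => (t, h :: s.2)

/-- Reorder the pool such that its keys become `ks`, if possible. -/
def greedy (e : γ → γ → Bool) (ks : List γ) (pool : List (γ × β)) : List (γ × β) :=
  (ks.foldl (greedyStep e) (pool, [])).2.reverse ++ (ks.foldl (greedyStep e) (pool, [])).1

theorem greedyStep_perm (e : γ → γ → Bool) (s : List (γ × β) × List (γ × β)) (k : γ) :
    ((greedyStep e s k).1 ++ (greedyStep e s k).2).Perm (s.1 ++ s.2) := by
  have h := List.filter_append_perm (fun p => e k p.1) s.1
  rw [greedyStep]
  cases he : s.1.filter (fun p => e k p.1) ++ s.1.filter (fun p => !e k p.1) with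
  | nil =>
    rw [he, List.nil_perm] at h
    rw [h]
    rfl
  | cons p t =>
    rw [he] at h
    exact List.perm_middle.trans (h.append_right s.2)

theorem foldl_greedyStep_perm (e : γ → γ → Bool) (ks : List γ)
    (s : List (γ × β) × List (γ × β)) :
    ((ks.foldl (greedyStep e) s).1 ++ (ks.foldl (greedyStep e) s).2).Perm (s.1 ++ s.2) := by
  induction ks generalizing s with
  | nil => rfl
  | cons k ks ih => exact (ih _).trans (greedyStep_perm e s k)

/-- No assumption on the keys: even if the greedy matching fails, the result is a reordering.
Soundness of the algorithm rests on this. -/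
theorem greedy_perm (e : γ → γ → Bool) (ks : List γ) (pool : List (γ × β)) :
    (greedy e ks pool).Perm pool := by
  have h := foldl_greedyStep_perm e ks (pool, [])
  rw [List.append_nil] at h
  exact (List.perm_append_comm.trans ((List.reverse_perm _).append_left _)).trans h

theorem map_fst_greedy {e : γ → γ → Bool} (he : ∀ a b, e a b = true ↔ a = b) {ks : List γ}
    {pool : List (γ × β)} (h : ks.Perm (pool.map Prod.fst)) :
    (greedy e ks pool).map Prod.fst = ks := by
  have key : ∀ (ks : List γ) (pool acc : List (γ × β)), ks.Perm (pool.map Prod.fst) →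
      (ks.foldl (greedyStep e) (pool, acc)).1 = [] ∧
        (ks.foldl (greedyStep e) (pool, acc)).2.reverse.map Prod.fst =
          acc.reverse.map Prod.fst ++ ks := by
    intro ks
    induction ks with
    | nil =>
      intro pool acc h
      rw [List.nil_perm, List.map_eq_nil_iff] at h
      subst h
      simp
    | cons k ks ih =>
      intro pool acc h
      obtain ⟨p, hp, rfl⟩ := List.mem_map.1 (h.subset List.mem_cons_self)
      have hf := List.filter_append_perm (fun q => e p.1 q.1) pool
      -- The pool contains an entry with the required key, so the first entry taken by `greedyStep`
      -- has this key; removing it leaves the remaining keys permuted.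
      obtain ⟨p', t, ht⟩ : ∃ p' t, pool.filter (fun q => e p.1 q.1) = p' :: t := by
        cases hc : pool.filter (fun q => e p.1 q.1) with
        | nil =>
          have : p ∈ pool.filter (fun q => e p.1 q.1) :=
            List.mem_filter.2 ⟨hp, (he _ _).2 rfl⟩
          rw [hc] at this
          cases this
        | cons p' t => exact ⟨p', t, rfl⟩
      have hp' : p.1 = p'.1 := by
        have : p' ∈ pool.filter (fun q => e p.1 q.1) := by rw [ht]; exact List.mem_cons_self
        exact (he _ _).1 (List.mem_filter.1 this).2
      have hs : greedyStep e (pool, acc) p.1 =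
          (t ++ pool.filter (fun q => !e p.1 q.1), p' :: acc) := by
        rw [greedyStep]
        simp only [ht]
        rfl
      rw [ht, List.cons_append] at hf
      have h2 := h.trans (hf.map Prod.fst).symm
      rw [List.map_cons, ← hp'] at h2
      obtain ⟨h3, h4⟩ := ih _ (p' :: acc) h2.cons_inv
      rw [List.foldl_cons, hs]
      refine ⟨h3, ?_⟩
      rw [h4, List.reverse_cons, List.map_append, List.map_singleton, List.append_assoc, hp']
      rfl
  obtain ⟨h1, h2⟩ := key ks pool [] h
  rw [greedy, List.map_append, h1, h2]
  simp

end Picks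

/-! ### Running times of selections and of the greedy matching -/

section Times

variable {α β γ K : Type} [Enc α] [Enc β] [Enc γ] {κ : α → K}

theorem CT.map_fst {l : α → List (β × γ)} (hl : CT κ l) : CT κ (fun x => (l x).map Prod.fst) :=
  .map (g := fun _ q => q.1) hl (.fst (.snd .id))

theorem CT.map_snd {l : α → List (β × γ)} (hl : CT κ l) : CT κ (fun x => (l x).map Prod.snd) :=
  .map (g := fun _ q => q.2) hl (.snd (.snd .id))

theorem inputSize_splits_le (l : List β) :
    inputSize (splits l) ≤ inputSize l * (inputSize l + 1) + 1 := by
  refine (inputSize_list_le (B := inputSize l) fun q hq => ?_).trans ?_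
  -- The pair `q` is encoded like the list `q.1 :: q.2`, a permutation of `l`.
  · exact (inputSize_perm (perm_of_mem_splits hq)).le
  · rw [length_splits]
    have := length_le_inputSize l
    gcongr
    omega

theorem CT.splits {l : α → List β} (hl : CT κ l) : CT κ (fun x => splits (l x)) := by
  refine .snd (CT.foldr (g := fun _ => splitStep) (B := fun x => inputSize (l x) +
    (inputSize (l x) * (inputSize (l x) + 1) + 1) + 1) hl (.const ([], [])) ?_
    ((hl.bdd.add ((hl.bdd.mul (hl.bdd.add (.const 1))).add (.const 1))).add (.const 1))
    fun x l₁ l₂ h => ?_)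
  · refine .pair (.cons (.fst (.snd .id)) (.fst (.snd (.snd .id))))
      (.cons (.pair (.fst (.snd .id)) (.fst (.snd (.snd .id)))) ?_)
    exact .map (g := fun (x : α × β × List β × List (β × List β)) q => (q.1, x.2.1 :: q.2))
      (.snd (.snd (.snd .id))) (.pair (.fst (.snd .id)) (.cons (.fst (.snd (.fst .id)))
        (.snd (.snd .id))))
  · have h1 : inputSize l₂ ≤ inputSize (l x) := by
      rw [h]; exact inputSize_le_of_sublist (List.sublist_append_right _ _)
    rw [foldr_splitStep, inputSize_prod]
    have h2 := inputSize_splits_le l₂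
    have h3 : inputSize l₂ * (inputSize l₂ + 1) ≤ inputSize (l x) * (inputSize (l x) + 1) := by
      gcongr
    omega

/-- The number of rounds is bounded in terms of the parameter, and it is the exponent in the number
of selections. This is where the time ceases to be polynomial. -/
theorem CT.picks {w : α → List Bool} {l : α → List β} (hw : CT κ w) (hl : CT κ l) {φ : K → ℕ}
    (hφ : ∀ x, (w x).length ≤ φ (κ x)) : CT κ (fun x => picks (w x) (l x)) := by
  refine CT.foldl (g := fun _ s _ => pickStep s) (B := fun x =>
    (inputSize (l x) + 1) ^ φ (κ x) * (inputSize (l x) + 2 + 1) + 1) hw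
    (.cons (.pair (.const []) hl) (.const [])) ?_
    ((((hl.bdd.add (.const 1)).pow φ).mul ((hl.bdd.add (.const 2)).add (.const 1))).add (.const 1))
    fun x l₁ l₂ h => ?_
  · refine CT.flatMap (g := fun (_ : α × List (List β × List β) × Bool) (q : List β × List β) => q :: (DTGW.splits q.2).map
      fun p => (p.1 :: q.1, p.2)) (.fst (.snd .id)) (.cons (.snd .id) ?_)
    exact .map (g := fun (x : (α × List (List β × List β) × Bool) × List β × List β)
      (p : β × List β) => (p.1 :: x.2.1, p.2)) (.splits (.snd (.snd .id)))
      (.pair (.cons (.fst (.snd .id)) (.fst (.snd (.fst .id)))) (.snd (.snd .id)))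
  · change inputSize (DTGW.picks l₁ (l x)) ≤ _
    refine (inputSize_list_le (B := inputSize (l x) + 2) fun q hq => ?_).trans ?_
    · have h1 := inputSize_perm (perm_of_mem_picks hq)
      have h2 := inputSize_append q.1 q.2
      change inputSize q.1 + inputSize q.2 + 1 ≤ _
      omega
    · have h1 := hφ x
      rw [h, List.length_append] at h1
      have h2 := length_le_inputSize (l x)
      gcongr
      refine (length_picks_le _ _).trans ?_
      calc ((l x).length + 1) ^ l₁.length ≤ (inputSize (l x) + 1) ^ l₁.length := by
            gcongr; omega
        _ ≤ _ := Nat.pow_le_pow_right (by omega) (by omega)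

theorem CT.greedy {e : γ → γ → Bool} (he : PT (fun q : γ × γ => e q.1 q.2)) {ks : α → List γ}
    {pool : α → List (γ × β)} (hk : CT κ ks) (hp : CT κ pool) :
    CT κ (fun x => greedy e (ks x) (pool x)) := by
  have h : CT κ (fun x => (ks x).foldl (greedyStep e) (pool x, [])) := by
    refine CT.foldl (g := fun _ => greedyStep e) (B := fun x => inputSize (pool x) + 2) hk
      (.pair hp (.const [])) ?_ (hp.bdd.add (.const 2)) fun x l₁ l₂ _ => ?_
    · have hm : PT (fun q : (α × (List (γ × β) × List (γ × β)) × γ) × γ × β => e q.1.2.2 q.2.1) :=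
        .comp he (.pair (.snd (.snd (.fst .id))) (.fst (.snd .id)))
      exact .listCases (g := fun (q : α × (List (γ × β) × List (γ × β)) × γ) h t =>
        (t, h :: q.2.1.2))
        (.append (.filter (p := fun (q : α × (List (γ × β) × List (γ × β)) × γ) p => e q.2.2 p.1)
          (.fst (.fst (.snd .id))) hm)
        (.filter (p := fun (q : α × (List (γ × β) × List (γ × β)) × γ) p => !e q.2.2 p.1)
          (.fst (.fst (.snd .id))) (.not hm))) (.pair (.const []) (.snd (.fst (.snd .id))))
        (.pair (.snd (.snd .id)) (.cons (.fst (.snd .id)) (.snd (.fst (.snd (.fst .id))))))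
    · have h1 := inputSize_perm (foldl_greedyStep_perm e l₁ (pool x, []))
      have h2 := inputSize_append (l₁.foldl (greedyStep e) (pool x, [])).1
        (l₁.foldl (greedyStep e) (pool x, [])).2
      rw [List.append_nil] at h1
      change inputSize (l₁.foldl (greedyStep e) (pool x, [])).1 +
        inputSize (l₁.foldl (greedyStep e) (pool x, [])).2 + 1 ≤ _
      simp only at h1
      omega
  exact .append (.reverse (.snd h)) (.fst h)

/-- A list of length `m * n`. -/
def unary (m n : ℕ) : List Bool :=
  n.bits.foldr (fun b acc => acc ++ acc ++ if b = true then List.replicate m true else []) []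

theorem length_unary_aux (m : ℕ) (l : List Bool) : (l.foldr (fun b acc =>
    acc ++ acc ++ if b = true then List.replicate m true else []) []).length = m * ofBits l := by
  induction l with
  | nil => simp [ofBits]
  | cons b l ih =>
    rw [List.foldr_cons, List.length_append, List.length_append, ih, ofBits_cons, Nat.bit_val]
    cases b <;> simp <;> ring

theorem length_unary (m n : ℕ) : (unary m n).length = m * n := by
  rw [unary, length_unary_aux, ofBits_bits]

/-- A unary number may be exponentially longer than its binary digits; it is affordable because `f`
is bounded in terms of the parameter. The intermediate lists belong to the leading digits, hence to
smaller numbers. -/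
theorem CT.unary {f : α → ℕ} (hf : CT κ f) (m : ℕ) {φ : K → ℕ} (hφ : ∀ x, f x ≤ φ (κ x)) :
    CT κ (fun x => unary m (f x)) := by
  refine CT.foldr (g := fun _ b acc =>
    acc ++ acc ++ if b = true then List.replicate m true else [])
    (B := fun x => 4 * (m * φ (κ x)) + 1) (.bits hf) (.const []) ?_
    (((Bdd.const 4).mul ((Bdd.const m).mul (.param φ))).add (.const 1)) fun x l₁ l₂ h => ?_
  · exact .append (.append (.snd (.snd .id)) (.snd (.snd .id)))
      (.ite (.fst (.snd .id)) (.const _) (.const _))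
  · refine (inputSize_bools_le _).trans ?_
    rw [length_unary_aux]
    have h1 : ∀ l₁ l₂ : List Bool, ofBits l₂ ≤ ofBits (l₁ ++ l₂) := by
      intro l₁ l₂
      induction l₁ with
      | nil => rfl
      | cons b l ih => rw [List.cons_append, ofBits_cons, Nat.bit_val]; omega
    have h2 := (h1 l₁ l₂).trans_eq ((congrArg ofBits h).symm.trans (ofBits_bits _))
    gcongr
    exact h2.trans (hφ x)

end Times

/-! ### The algorithm -/

section Algorithm

variable {X : Type}

/-- The cost of matching two layers, given by the signatures and deletion costs of their
vertices: entries in equal positions are matched, the others are deleted. -/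
def rowCost (d : X → X → ℚ) (x y : List (X × ℚ)) : ℕ × ℕ :=
  fracSum ((x.zip y).map (fun q => fracAbs (d q.1.1 q.2.1)) ++
    ((x.drop y.length).map (fun q => fracAbs q.2) ++ (y.drop x.length).map (fun q => fracAbs q.2)))

/-- For each of the columns `r`, its signatures in pairwise distinct rows of the table. -/
def columnKeys (e : List X → List X → Bool) (A : List (List (X × ℚ)))
    (r : List (List (X × ℚ))) : List (List X) :=
  transpose r (distinctBy e (transpose A (r.map fun c => c.map Prod.fst)))

/-- Reorder the columns `r'` such that they have the same keys as the columns `r`. -/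
def matchColumns (e : List X → List X → Bool) (A B : List (List (X × ℚ)))
    (r r' : List (List (X × ℚ))) : List (List (X × ℚ)) :=
  (greedy e (columnKeys e A r) ((columnKeys e B r').zip r')).map Prod.snd

/-- Is there a warping path of cost at most `c` if the columns `q.1` and `q'.1` are matched in the
given order, and the columns `q.2` and `q'.2` greedily? -/
def accepts (d : X → X → ℚ) (e : List X → List X → Bool) (A B : List (List (X × ℚ)))
    (c : ℕ × ℕ) (q q' : List (List (X × ℚ)) × List (List (X × ℚ))) : Bool :=
  (cell (rowCost d) (transpose A (q.2 ++ q.1))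
    (transpose B (matchColumns e A B q.2 q'.2 ++ q'.1))).any fun v => fracLe v c

/-- Try all selections of columns that are matched in the given order. -/
def search (d : X → X → ℚ) (e : List X → List X → Bool) (A B : List (List (X × ℚ)))
    (c : ℕ × ℕ) (w : List Bool) : Bool :=
  (picks w (transpose (A.headD []) A)).any fun q =>
    (picks w (transpose (B.headD []) B)).any fun q' => accepts d e A B c q q'

variable [Enc X] {α K : Type} [Enc α] {κ : α → K}

theorem PT.rowCost {d : X → X → ℚ} (hd : PT (fun q : X × X => d q.1 q.2)) :
    PT (fun q : List (X × ℚ) × List (X × ℚ) => rowCost d q.1 q.2) := by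
  have hs : PT (fun q : (List (X × ℚ) × List (X × ℚ)) × (X × ℚ) => DTGW.fracAbs q.2.2) :=
    .fracAbs (.snd (.snd .id))
  refine .fracSum (.append (.map (g := fun _ (q : (X × ℚ) × X × ℚ) => DTGW.fracAbs (d q.1.1 q.2.1))
    (.zip (.fst .id) (.snd .id)) (.fracAbs ?_))
    (.append (.map (g := fun _ (q : X × ℚ) => DTGW.fracAbs q.2) (.dropLength (.fst .id) (.snd .id)) hs)
      (.map (g := fun _ (q : X × ℚ) => DTGW.fracAbs q.2) (.dropLength (.snd .id) (.fst .id)) hs)))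
  exact .comp hd (.pair (.fst (.fst (.snd .id))) (.fst (.snd (.snd .id))))

theorem CT.columnKeys {e : List X → List X → Bool} (he : PT (fun q : List X × List X => e q.1 q.2))
    {A r : α → List (List (X × ℚ))} (hA : CT κ A) (hr : CT κ r) :
    CT κ (fun x => columnKeys e (A x) (r x)) :=
  .transpose hr (.distinctBy he (.transpose hA (.map (g := fun _ (c : List (X × ℚ)) =>
    c.map Prod.fst) hr (.map_fst (.snd .id)))))

theorem CT.search {d : X → X → ℚ} (hd : PT (fun q : X × X => d q.1 q.2))
    {e : List X → List X → Bool} (he : PT (fun q : List X × List X => e q.1 q.2))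
    {A B : α → List (List (X × ℚ))} (hA : CT κ A) (hB : CT κ B) {c : α → ℕ × ℕ} (hc : CT κ c)
    {w : α → List Bool} (hw : CT κ w) {φ : K → ℕ} (hφ : ∀ x, (w x).length ≤ φ (κ x)) :
    CT κ (fun x => search d e (A x) (B x) (c x) (w x)) := by
  let T := List (List (X × ℚ))
  refine CT.comp (f := fun x => (((A x, B x), c x),
    DTGW.picks (w x) (DTGW.transpose ((A x).headD []) (A x)),
    DTGW.picks (w x) (DTGW.transpose ((B x).headD []) (B x))))
    (g := fun z : ((T × T) × (ℕ × ℕ)) × List (T × T) × List (T × T) =>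
      z.2.1.any fun q => z.2.2.any fun q' => accepts d e z.1.1.1 z.1.1.2 z.1.2 q q') ?_
    (.pair (.pair (.pair hA hB) hc) (.pair
      (.picks hw (.transpose (.headD hA (.const [])) hA) hφ)
      (.picks hw (.transpose (.headD hB (.const [])) hB) hφ)))
  refine .any (p := fun (z : ((T × T) × (ℕ × ℕ)) × List (T × T) × List (T × T)) (q : T × T) =>
    z.2.2.any fun q' => accepts d e z.1.1.1 z.1.1.2 z.1.2 q q') (.fst (.snd .id)) ?_
  refine .any (p := fun (z : (((T × T) × (ℕ × ℕ)) × List (T × T) × List (T × T)) × (T × T))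
    (q' : T × T) => accepts d e z.1.1.1.1 z.1.1.1.2 z.1.1.2 z.2 q') (.snd (.snd (.fst .id))) ?_
  refine CT.comp (g := fun z : ((T × T) × (ℕ × ℕ)) × (T × T) × (T × T) =>
    accepts d e z.1.1.1 z.1.1.2 z.1.2 z.2.1 z.2.2)
    (f := fun z : ((((T × T) × (ℕ × ℕ)) × List (T × T) × List (T × T)) × (T × T)) × (T × T) =>
      (z.1.1.1, z.1.2, z.2)) ?_
    (.pair (.fst (.fst (.fst .id))) (.pair (.snd (.fst .id)) (.snd .id)))
  have h1 : PT (fun z : ((T × T) × (ℕ × ℕ)) × (T × T) × (T × T) => z.1.1.1) :=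
    .fst (.fst (.fst .id))
  have h2 : PT (fun z : ((T × T) × (ℕ × ℕ)) × (T × T) × (T × T) => z.1.1.2) :=
    .snd (.fst (.fst .id))
  have h3 : PT (fun z : ((T × T) × (ℕ × ℕ)) × (T × T) × (T × T) => z.2.1.2) :=
    .snd (.fst (.snd .id))
  have h4 : PT (fun z : ((T × T) × (ℕ × ℕ)) × (T × T) × (T × T) => z.2.2.2) :=
    .snd (.snd (.snd .id))
  refine .any (p := fun (z : ((T × T) × (ℕ × ℕ)) × (T × T) × (T × T)) v => DTGW.fracLe v z.1.2)
    (.cell (PT.rowCost hd) (.transpose h1 (.append h3 (.fst (.fst (.snd .id)))))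
      (.transpose h2 (.append (.map_snd (.greedy he (.columnKeys he h1 h3)
        (.zip (.columnKeys he h2 h4) h4))) (.fst (.snd (.snd .id))))))
    (.fracLe (.snd .id) (.snd (.fst (.fst .id))))

end Algorithm

/-! ### Values of fractions -/

section Values

/-- The rational number that a fraction represents. -/
def fracVal (p : ℕ × ℕ) : ℚ := p.1 / p.2

theorem fracVal_fracAdd {p q : ℕ × ℕ} (hp : 0 < p.2) (hq : 0 < q.2) :
    fracVal (fracAdd p q) = fracVal p + fracVal q := by
  have hp' : (p.2 : ℚ) ≠ 0 := by positivity
  have hq' : (q.2 : ℚ) ≠ 0 := by positivity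
  simp only [fracVal, fracAdd]
  push_cast
  field_simp

theorem fracLe_iff {p q : ℕ × ℕ} (hp : 0 < p.2) (hq : 0 < q.2) :
    fracLe p q = true ↔ fracVal p ≤ fracVal q := by
  rw [fracLe, decide_eq_true_iff, fracVal, fracVal, div_le_div_iff₀ (by positivity) (by positivity)]
  exact_mod_cast Iff.rfl

theorem fracVal_fracAbs (q : ℚ) : fracVal (fracAbs q) = |q| := by
  rw [fracVal, fracAbs, Rat.abs_def, Rat.divInt_eq_div]
  simp

theorem fracSum_spec {l : List (ℕ × ℕ)} (h : ∀ p ∈ l, 0 < p.2) :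
    0 < (fracSum l).2 ∧ fracVal (fracSum l) = (l.map fracVal).sum := by
  induction l with
  | nil => simp [fracSum, fracVal]
  | cons p l ih =>
    obtain ⟨h1, h2⟩ := ih fun q hq => h q (List.mem_cons_of_mem _ hq)
    have hp := h p List.mem_cons_self
    change 0 < (fracAdd p (fracSum l)).2 ∧ fracVal (fracAdd p (fracSum l)) = _
    exact ⟨Nat.mul_pos hp h1, by rw [fracVal_fracAdd hp h1, h2, List.map_cons, List.sum_cons]⟩

theorem exists_of_mem_minAdd {w v : ℕ × ℕ} {l : List (ℕ × ℕ)} (h : v ∈ minAdd w l) :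
    ∃ u ∈ l, v = fracAdd w u := by
  cases l with
  | nil => cases h
  | cons a l => exact ⟨_, foldl_fracMin_mem a l, List.mem_singleton.1 h⟩

theorem foldl_fracMin_le {v : ℕ × ℕ} {l : List (ℕ × ℕ)} (h : ∀ p ∈ v :: l, 0 < p.2) :
    ∀ p ∈ v :: l, fracVal (l.foldl fracMin v) ≤ fracVal p := by
  induction l generalizing v with
  | nil => simp
  | cons a l ih =>
    have hv := h v (by simp)
    have ha := h a (by simp)
    have hm : fracVal (fracMin v a) ≤ fracVal v ∧ fracVal (fracMin v a) ≤ fracVal a := by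
      rw [fracMin]
      split
      · next hle => exact ⟨le_rfl, (fracLe_iff hv ha).1 hle⟩
      · next hle =>
        rw [fracLe_iff hv ha, not_le] at hle
        exact ⟨hle.le, le_rfl⟩
    have hm2 : 0 < (fracMin v a).2 := by rw [fracMin]; split <;> assumption
    have ih' := ih (v := fracMin v a) (by
      intro p hp
      rcases List.mem_cons.1 hp with rfl | hp
      · exact hm2
      · exact h p (by simp [hp]))
    intro p hp
    rw [List.foldl_cons]
    simp only [List.mem_cons] at hp
    rcases hp with rfl | rfl | hp
    · exact (ih' _ List.mem_cons_self).trans hm.1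
    · exact (ih' _ List.mem_cons_self).trans hm.2
    · exact ih' p (List.mem_cons_of_mem _ hp)

theorem exists_mem_minAdd {w u : ℕ × ℕ} {l : List (ℕ × ℕ)} (hw : 0 < w.2)
    (hl : ∀ p ∈ l, 0 < p.2) (hu : u ∈ l) :
    ∃ v ∈ minAdd w l, fracVal v ≤ fracVal w + fracVal u := by
  cases l with
  | nil => cases hu
  | cons a l =>
    refine ⟨_, List.mem_singleton_self _, ?_⟩
    rw [fracVal_fracAdd hw (hl _ (foldl_fracMin_mem a l))]
    have := foldl_fracMin_le hl u hu
    linarith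

end Values

/-! ### Warping paths as lists -/

section Paths

variable {β γ β' γ' : Type}

/-- The lists of pairs of entries that are visited by a warping path between two sequences. -/
inductive IsWarping : List β → List γ → List (β × γ) → Prop
  | nil : IsWarping [] [] []
  | diag {x xs y ys l} : IsWarping xs ys l → IsWarping (x :: xs) (y :: ys) ((x, y) :: l)
  | right {x xs y ys l} : IsWarping (x :: xs) ys l → IsWarping (x :: xs) (y :: ys) ((x, y) :: l)
  | down {x xs y ys l} : IsWarping xs (y :: ys) l → IsWarping (x :: xs) (y :: ys) ((x, y) :: l)

theorem IsWarping.map {xs : List β} {ys : List γ} {l : List (β × γ)} (h : IsWarping xs ys l)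
    (F : β → β') (G : γ → γ') :
    IsWarping (xs.map F) (ys.map G) (l.map (Prod.map F G)) := by
  induction h with
  | nil => exact .nil
  | diag _ ih => exact .diag ih
  | right _ ih => exact .right ih
  | down _ ih => exact .down ih

/-- The dynamic program sees only the rows of the tables. Its path lifts to one between layer
indices, even if several layers have the same row. -/
theorem IsWarping.exists_of_map {F : β → β'} {G : γ → γ'} {xs' : List β'} {ys' : List γ'}
    {l' : List (β' × γ')} (h : IsWarping xs' ys' l') {xs : List β} {ys : List γ}
    (hx : xs.map F = xs') (hy : ys.map G = ys') :
    ∃ l, IsWarping xs ys l ∧ l.map (Prod.map F G) = l' := by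
  induction h generalizing xs ys with
  | nil =>
    rw [List.map_eq_nil_iff] at hx hy
    subst hx hy
    exact ⟨[], .nil, rfl⟩
  | diag _ ih =>
    obtain ⟨x, xs, rfl, rfl, hx'⟩ := List.map_eq_cons_iff.1 hx
    obtain ⟨y, ys, rfl, rfl, hy'⟩ := List.map_eq_cons_iff.1 hy
    obtain ⟨l, hl, rfl⟩ := ih hx' hy'
    exact ⟨_, .diag hl, rfl⟩
  | right _ ih =>
    obtain ⟨y, ys, rfl, rfl, hy'⟩ := List.map_eq_cons_iff.1 hy
    obtain ⟨l, hl, rfl⟩ := ih hx hy'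
    obtain ⟨x, xs, rfl, rfl, hx'⟩ := List.map_eq_cons_iff.1 hx
    exact ⟨_, .right hl, rfl⟩
  | down _ ih =>
    obtain ⟨x, xs, rfl, rfl, hx'⟩ := List.map_eq_cons_iff.1 hx
    obtain ⟨l, hl, rfl⟩ := ih hx' hy
    obtain ⟨y, ys, rfl, rfl, hy'⟩ := List.map_eq_cons_iff.1 hy
    exact ⟨_, .down hl, rfl⟩

/-- The recursion of `cell` mirrors the three ways in which a warping begins. Every value returned
is the cost of some path, and no path is cheaper. -/
theorem cell_spec {cost : β → γ → ℕ × ℕ} (hc : ∀ x y, 0 < (cost x y).2) (xs : List β)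
    (ys : List γ) :
    (∀ v ∈ cell cost xs ys, 0 < v.2 ∧ ∃ l, IsWarping xs ys l ∧
      fracVal v = (l.map fun a => fracVal (cost a.1 a.2)).sum) ∧
    ∀ l, IsWarping xs ys l → ∃ v ∈ cell cost xs ys,
      fracVal v ≤ (l.map fun a => fracVal (cost a.1 a.2)).sum := by
  induction xs, ys using cell.induct with
  | case1 =>
    rw [cell]
    refine ⟨?_, ?_⟩
    · simp only [List.mem_singleton, forall_eq]
      exact ⟨one_pos, [], .nil, by simp [fracVal]⟩
    · rintro l ⟨⟩
      exact ⟨_, List.mem_singleton_self _, by simp [fracVal]⟩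
  | case2 => rw [cell]; exact ⟨by simp, by rintro l ⟨⟩⟩
  | case3 => rw [cell]; exact ⟨by simp, by rintro l ⟨⟩⟩
  | case4 x xs y ys ih1 ih2 ih3 =>
    rw [cell]
    have hpos : ∀ p ∈ cell cost xs (y :: ys) ++ cell cost xs ys ++ cell cost (x :: xs) ys,
        0 < p.2 := by
      intro p hp
      simp only [List.mem_append] at hp
      rcases hp with (hp | hp) | hp
      · exact (ih1.1 p hp).1
      · exact (ih2.1 p hp).1
      · exact (ih3.1 p hp).1
    refine ⟨fun v hv => ?_, fun l hl => ?_⟩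
    · obtain ⟨u, hu, rfl⟩ := exists_of_mem_minAdd hv
      refine ⟨Nat.mul_pos (hc x y) (hpos u hu), ?_⟩
      rw [fracVal_fracAdd (hc x y) (hpos u hu)]
      simp only [List.mem_append] at hu
      rcases hu with (hu | hu) | hu
      · obtain ⟨-, l, hl, e⟩ := ih1.1 u hu
        exact ⟨_, .down hl, by rw [e, List.map_cons, List.sum_cons]⟩
      · obtain ⟨-, l, hl, e⟩ := ih2.1 u hu
        exact ⟨_, .diag hl, by rw [e, List.map_cons, List.sum_cons]⟩
      · obtain ⟨-, l, hl, e⟩ := ih3.1 u hu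
        exact ⟨_, .right hl, by rw [e, List.map_cons, List.sum_cons]⟩
    · have key : ∀ u ∈ cell cost xs (y :: ys) ++ cell cost xs ys ++ cell cost (x :: xs) ys,
          ∀ s, fracVal u ≤ s → ∃ v ∈ minAdd (cost x y)
            (cell cost xs (y :: ys) ++ cell cost xs ys ++ cell cost (x :: xs) ys),
            fracVal v ≤ fracVal (cost x y) + s := by
        intro u hu s hs
        obtain ⟨v, hv, h⟩ := exists_mem_minAdd (hc x y) hpos hu
        exact ⟨v, hv, by linarith⟩
      cases hl with
      | diag h =>
        obtain ⟨u, hu, hs⟩ := ih2.2 _ h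
        exact key u (by simp [hu]) _ hs
      | right h =>
        obtain ⟨u, hu, hs⟩ := ih3.2 _ h
        exact key u (by simp [hu]) _ hs
      | down h =>
        obtain ⟨u, hu, hs⟩ := ih1.2 _ h
        exact key u (by simp [hu]) _ hs

theorem distinctBy_cons_eq {δ : Type} {F : β → δ} {e : β → β → Bool}
    (he : ∀ a b, e a b = true ↔ F a = F b) (a : β) (l : List β) :
    (F a ∈ (distinctBy e l).map F ∧ distinctBy e (a :: l) = distinctBy e l) ∨
      (F a ∉ (distinctBy e l).map F ∧ distinctBy e (a :: l) = a :: distinctBy e l) := by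
  have : ((distinctBy e l).any (e a) = true) ↔ F a ∈ (distinctBy e l).map F := by
    simp only [List.any_eq_true, List.mem_map, he]
    exact exists_congr fun b => and_congr_right fun _ => eq_comm
  rw [distinctBy_cons, ← this]
  by_cases hm : (distinctBy e l).any (e a) = true
  · exact .inl ⟨hm, if_pos hm⟩
  · exact .inr ⟨hm, if_neg hm⟩

theorem exists_mem_distinctBy {δ : Type} {F : β → δ} {e : β → β → Bool}
    (he : ∀ a b, e a b = true ↔ F a = F b) {a : β} {l : List β} (ha : a ∈ l) :
    ∃ b ∈ distinctBy e l, F b = F a := by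
  induction l with
  | nil => cases ha
  | cons c l ih =>
    rcases distinctBy_cons_eq he c l with ⟨h1, h2⟩ | ⟨h1, h2⟩ <;> rw [h2] <;>
      rcases List.mem_cons.1 ha with rfl | ha
    · simpa using h1
    · exact ih ha
    · exact ⟨a, List.mem_cons_self, rfl⟩
    · obtain ⟨b, hb, h⟩ := ih ha
      exact ⟨b, List.mem_cons_of_mem _ hb, h⟩

theorem distinctBy_map (e : β' → β' → Bool) (F : β → β') (l : List β) :
    distinctBy e (l.map F) = (distinctBy (fun a b => e (F a) (F b)) l).map F := by
  induction l with
  | nil => rfl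
  | cons a l ih =>
    rw [List.map_cons, distinctBy_cons, ih, distinctBy_cons, List.any_map]
    split_ifs with h1 h2 h2
    · rfl
    · exact absurd h1 h2
    · exact absurd h2 h1
    · rfl

/-- Along a warping path that visits only pairs of equal entries, both sequences have the same
distinct entries, in the same order. -/
theorem IsWarping.distinctBy_eq {δ : Type} {xs : List β} {ys : List γ} {l : List (β × γ)}
    (h : IsWarping xs ys l) {F : β → δ} {G : γ → δ} (heq : ∀ a ∈ l, F a.1 = G a.2)
    {e : β → β → Bool} {e' : γ → γ → Bool} (he : ∀ a b, e a b = true ↔ F a = F b)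
    (he' : ∀ a b, e' a b = true ↔ G a = G b) :
    (distinctBy e xs).map F = (distinctBy e' ys).map G := by
  induction h with
  | nil => rfl
  | @diag x xs y ys l _ ih =>
    have ih := ih fun a ha => heq a (List.mem_cons_of_mem _ ha)
    have hxy : F x = G y := heq _ List.mem_cons_self
    rcases distinctBy_cons_eq he x xs with ⟨h1, h2⟩ | ⟨h1, h2⟩ <;>
      rcases distinctBy_cons_eq he' y ys with ⟨h3, h4⟩ | ⟨h3, h4⟩ <;> rw [h2, h4]
    · exact ih
    · exact absurd (ih ▸ hxy ▸ h1) h3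
    · exact absurd (hxy ▸ ih ▸ h3) h1
    · rw [List.map_cons, List.map_cons, hxy, ih]
  | @right x xs y ys l _ ih =>
    have ih := ih fun a ha => heq a (List.mem_cons_of_mem _ ha)
    have hxy : F x = G y := heq _ List.mem_cons_self
    -- A step in one coordinate only: the value of `y` equals that of `x`, which by induction
    -- already occurs among the values for `ys`. So `y` has an equal later entry and is dropped.
    have hx : F x ∈ (distinctBy e (x :: xs)).map F :=
      have ⟨b, hb, h⟩ := exists_mem_distinctBy he (List.mem_cons_self (a := x) (l := xs))
      List.mem_map.2 ⟨b, hb, h⟩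
    rw [ih, hxy] at hx
    rcases distinctBy_cons_eq he' y ys with ⟨h3, h4⟩ | ⟨h3, h4⟩
    · rw [ih, h4]
    · exact absurd hx h3
  | @down x xs y ys l _ ih =>
    have ih := ih fun a ha => heq a (List.mem_cons_of_mem _ ha)
    have hxy : F x = G y := heq _ List.mem_cons_self
    have hy : G y ∈ (distinctBy e' (y :: ys)).map G :=
      have ⟨b, hb, h⟩ := exists_mem_distinctBy he' (List.mem_cons_self (a := y) (l := ys))
      List.mem_map.2 ⟨b, hb, h⟩
    rw [← ih, ← hxy] at hy
    rcases distinctBy_cons_eq he x xs with ⟨h3, h4⟩ | ⟨h3, h4⟩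
    · rw [h4, ih]
    · exact absurd hy h3

/-- A path starting at `(i, j)` is a warping of the suffixes of layers from `i` and from `j` on. -/
theorem IsWarping.of_isChain {T U : ℕ} (l : List (Fin T × Fin U)) (i j : ℕ) (hl : l.IsChain WarpStep)
    (hh : ∃ a ∈ l.head?, a.1.val = i ∧ a.2.val = j)
    (ht : ∃ b ∈ l.getLast?, b.1.val + 1 = T ∧ b.2.val + 1 = U) :
    IsWarping ((List.finRange T).drop i) ((List.finRange U).drop j) l := by
  have hd : ∀ (n : ℕ) (i : Fin n), (List.finRange n).drop i = i :: (List.finRange n).drop (i + 1) := by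
    intro n i
    rw [List.drop_eq_getElem_cons (by simp), List.getElem_finRange]
    rfl
  induction l generalizing i j with
  | nil => simp at hh
  | cons a l ih =>
    obtain ⟨_, ha, rfl, rfl⟩ := hh
    simp only [List.head?_cons, Option.mem_def, Option.some.injEq] at ha
    subst ha
    rw [hd, hd]
    cases l with
    | nil =>
      obtain ⟨b, hb, h1, h2⟩ := ht
      simp only [List.getLast?_singleton, Option.mem_def, Option.some.injEq] at hb
      subst hb
      rw [List.drop_eq_nil_of_le (by simp [h1]), List.drop_eq_nil_of_le (by simp [h2])]
      exact .diag .nil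
    | cons b l =>
      rw [List.isChain_cons_cons] at hl
      have ih' := ih b.1 b.2 hl.2 ⟨b, rfl, rfl, rfl⟩ (by simpa using ht)
      rcases hl.1 with ⟨h1, h2⟩ | ⟨h1, h2⟩ | ⟨h1, h2⟩ <;> rw [h1, h2] at ih'
      · exact .diag ih'
      · rw [hd] at ih'
        exact .right ih'
      · rw [hd _ a.2] at ih'
        exact .down ih'

/-- The empty alternative is the state after the last position, when both sequences are used up; the
induction passes through it. -/
theorem IsWarping.isChain {T U : ℕ} {xs : List (Fin T)} {ys : List (Fin U)}
    {l : List (Fin T × Fin U)} (h : IsWarping xs ys l) {i j : ℕ}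
    (hx : xs = (List.finRange T).drop i) (hy : ys = (List.finRange U).drop j) :
    (l = [] ∧ T ≤ i ∧ U ≤ j) ∨ (l.IsChain WarpStep ∧ (∃ a ∈ l.head?, a.1.val = i ∧ a.2.val = j) ∧
      ∃ b ∈ l.getLast?, b.1.val + 1 = T ∧ b.2.val + 1 = U) := by
  have hd : ∀ {n : ℕ} {i : ℕ} {x xs}, x :: xs = (List.finRange n).drop i →
      x.val = i ∧ xs = (List.finRange n).drop (i + 1) := by
    intro n i x xs h
    have hi : i < n := by
      by_contra hc
      rw [List.drop_eq_nil_of_le (by simp; omega)] at h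
      cases h
    rw [List.drop_eq_getElem_cons (by simpa using hi), List.getElem_finRange] at h
    injection h with h1 h2
    exact ⟨by rw [h1]; rfl, h2⟩
  have hc : ∀ {a : Fin T × Fin U} {l : List (Fin T × Fin U)} {i j i' j' : ℕ},
      a.1.val = i → a.2.val = j →
      (i' = i + 1 ∧ j' = j + 1 ∨ i' = i ∧ j' = j + 1 ∨ i' = i + 1 ∧ j' = j) →
      ((l = [] ∧ T ≤ i' ∧ U ≤ j') ∨ (l.IsChain WarpStep ∧
        (∃ a ∈ l.head?, a.1.val = i' ∧ a.2.val = j') ∧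
        ∃ b ∈ l.getLast?, b.1.val + 1 = T ∧ b.2.val + 1 = U)) →
      (a :: l).IsChain WarpStep ∧ (∃ b ∈ (a :: l).head?, b.1.val = i ∧ b.2.val = j) ∧
        ∃ b ∈ (a :: l).getLast?, b.1.val + 1 = T ∧ b.2.val + 1 = U := by
    rintro ⟨⟨a, haT⟩, ⟨b, hbU⟩⟩ l i j i' j' h1 h2 h3 (⟨rfl, h4, h5⟩ | ⟨h4, ⟨c, hc, h5, h6⟩, h7⟩)
    · simp only at h1 h2
      exact ⟨by simp, ⟨_, rfl, h1, h2⟩, ⟨_, rfl, by simp; omega, by simp; omega⟩⟩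
    · simp only at h1 h2
      cases l with
      | nil => cases hc
      | cons d l =>
        simp only [List.head?_cons, Option.mem_def, Option.some.injEq] at hc
        subst hc
        refine ⟨List.isChain_cons_cons.2 ⟨?_, h4⟩, ⟨_, rfl, h1, h2⟩, by simpa using h7⟩
        simp only [WarpStep]
        omega
  induction h generalizing i j with
  | nil =>
    have h1 := congrArg List.length hx
    have h2 := congrArg List.length hy
    simp only [List.length_nil, List.length_drop, List.length_finRange] at h1 h2
    exact .inl ⟨rfl, by omega, by omega⟩
  | diag _ ih =>
    obtain ⟨h1, h2⟩ := hd hx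
    obtain ⟨h3, h4⟩ := hd hy
    exact .inr (hc h1 h3 (.inl ⟨rfl, rfl⟩) (ih h2 h4))
  | right _ ih =>
    obtain ⟨h1, h2⟩ := hd hx
    obtain ⟨h3, h4⟩ := hd hy
    exact .inr (hc h1 h3 (.inr (.inl ⟨rfl, rfl⟩)) (ih hx h4))
  | down _ ih =>
    obtain ⟨h1, h2⟩ := hd hx
    obtain ⟨h3, h4⟩ := hd hy
    exact .inr (hc h1 h3 (.inr (.inr ⟨rfl, rfl⟩)) (ih h2 hy))

/-- The sum of the coordinates increases in each step. Hence sums over a path as a set and as a list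
agree. -/
theorem nodup_of_isChain {T U : ℕ} {l : List (Fin T × Fin U)} (h : l.IsChain WarpStep) :
    l.Nodup := by
  have h1 : l.IsChain fun a b => a.1.val + a.2.val < b.1.val + b.2.val :=
    h.imp fun a b h => by rcases h with h | h | h <;> omega
  have : IsTrans (Fin T × Fin U) fun a b => a.1.val + a.2.val < b.1.val + b.2.val :=
    ⟨fun a b c h h' => h.trans h'⟩
  exact (List.isChain_iff_pairwise.1 h1).imp fun {a b} h e => by rw [e] at h; omega

theorem IsWarping.nodup {T U : ℕ} {l : List (Fin T × Fin U)}
    (h : IsWarping (List.finRange T) (List.finRange U) l) : l.Nodup := by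
  rcases h.isChain (i := 0) (j := 0) (by simp) (by simp) with ⟨rfl, -⟩ | ⟨h, -⟩
  · exact List.nodup_nil
  · exact nodup_of_isChain h

theorem IsWarping.ne_nil {xs : List β} {ys : List γ} {l : List (β × γ)} (h : IsWarping xs ys l)
    (hx : xs ≠ []) : l ≠ [] := by
  cases h <;> simp_all

/-- Warping paths as sets correspond to warping paths as lists. -/
theorem isWarpingPath_iff {T U : ℕ} (hT : 1 ≤ T) {p : Finset (Fin T × Fin U)} :
    IsWarpingPath p ↔ ∃ l, IsWarping (List.finRange T) (List.finRange U) l ∧ l.toFinset = p := by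
  constructor
  · rintro ⟨l, h1, h2, h3, h4⟩
    exact ⟨l, by simpa using IsWarping.of_isChain l 0 0 h2 h3 h4, h1⟩
  · rintro ⟨l, h1, h2⟩
    rcases h1.isChain (i := 0) (j := 0) (by simp) (by simp) with ⟨-, h, -⟩ | ⟨h3, h4, h5⟩
    · omega
    · exact ⟨l, h2, h3, h4, h5⟩

end Paths

/-! ### Vertex mappings as lists of pairs -/

section Alignments

variable {α β X : Type} {n n' : ℕ}

/-- The algorithm permutes columns, whereas the correctness proof needs permutations of vertices;
these exist although different vertices may have equal columns. -/
theorem exists_perm_of_perm_map {f : α → β} {l : List α} {l' : List β} (h : l'.Perm (l.map f)) :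
    ∃ m : List α, m.Perm l ∧ l' = m.map f := by
  have : Relation.Comp (· = List.map f ·) List.Perm l' l := by
    rw [List.eq_map_comp_perm]; exact h
  obtain ⟨m, h1, h2⟩ := this
  exact ⟨m, h2, h1⟩

theorem sum_map_sum_comm (l : List α) (z : List β) (h : α → β → ℚ) :
    (l.map fun a => (z.map (h a)).sum).sum = (z.map fun b => (l.map fun a => h a b).sum).sum := by
  induction l with
  | nil => simp
  | cons a l ih => simp only [List.map_cons, List.sum_cons, ih, List.sum_map_add]

/-- The pairs `z` together with the unmatched elements `s`, `t` form a vertex mapping. -/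
structure IsAlignment (z : List (Fin n × Fin n')) (s : List (Fin n)) (t : List (Fin n')) :
    Prop where
  left : (z.map Prod.fst ++ s).Perm (List.finRange n)
  right : (z.map Prod.snd ++ t).Perm (List.finRange n')
  nil_or_nil : s = [] ∨ t = []

theorem exists_zip (σ : List α) (τ : List β) : ∃ (z : List (α × β)) (s : List α) (t : List β),
    σ = z.map Prod.fst ++ s ∧ τ = z.map Prod.snd ++ t ∧ (s = [] ∨ t = []) := by
  induction σ generalizing τ with
  | nil => exact ⟨[], [], τ, rfl, rfl, .inl rfl⟩
  | cons a σ ih =>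
    cases τ with
    | nil => exact ⟨[], a :: σ, [], rfl, rfl, .inr rfl⟩
    | cons b τ =>
      obtain ⟨z, s, t, h1, h2, h3⟩ := ih τ
      exact ⟨(a, b) :: z, s, t, by simp [h1], by simp [h2], h3⟩

theorem filter_eq_toFinset {γ : Type} [DecidableEq γ] {z : List γ} {s : List (Fin n)} {F : γ → Fin n}
    (h : (z.map F ++ s).Perm (List.finRange n)) :
    Finset.univ.filter (fun v => v ∉ z.toFinset.image F) = s.toFinset := by
  have hnd := (h.nodup_iff.2 (List.nodup_finRange n))
  ext v
  have hv : v ∈ z.map F ++ s := h.symm.subset (List.mem_finRange v)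
  have hd := List.disjoint_of_nodup_append hnd
  simp only [Finset.mem_filter, Finset.mem_univ, true_and, Finset.mem_image, List.mem_toFinset]
  rw [List.mem_append, List.mem_map] at hv
  constructor
  · intro h'
    exact hv.resolve_left h'
  · rintro h1 h2
    exact hd (List.mem_map.2 h2) h1

/-- The cost of an alignment. -/
def alignCost (d : X → X → ℚ) (f : Fin n → X) (g : Fin n' → X) (ΔG : Fin n → ℚ) (ΔH : Fin n' → ℚ)
    (z : List (Fin n × Fin n')) (s : List (Fin n)) (t : List (Fin n')) : ℚ :=
  (z.map fun a => d (f a.1) (g a.2)).sum + (s.map ΔG).sum + (t.map ΔH).sum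

theorem IsAlignment.mappingCost {z : List (Fin n × Fin n')} {s : List (Fin n)} {t : List (Fin n')}
    (h : IsAlignment z s t) (d : X → X → ℚ) (f : Fin n → X) (g : Fin n' → X) (ΔG : Fin n → ℚ)
    (ΔH : Fin n' → ℚ) :
    mappingCost d f g ΔG ΔH z.toFinset = alignCost d f g ΔG ΔH z s t := by
  have h1 := h.left.nodup_iff.2 (List.nodup_finRange n)
  have h2 := h.right.nodup_iff.2 (List.nodup_finRange n')
  rw [List.nodup_append] at h1 h2
  rw [DTGW.mappingCost, filter_eq_toFinset h.left, filter_eq_toFinset h.right,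
    List.sum_toFinset _ (h1.1.of_map _), List.sum_toFinset _ h1.2.1, List.sum_toFinset _ h2.2.1,
    alignCost]

theorem IsAlignment.isVertexMapping {z : List (Fin n × Fin n')} {s : List (Fin n)}
    {t : List (Fin n')} (h : IsAlignment z s t) : IsVertexMapping z.toFinset := by
  have h1 := (List.nodup_append.1 (h.left.nodup_iff.2 (List.nodup_finRange n))).1
  have h2 := (List.nodup_append.1 (h.right.nodup_iff.2 (List.nodup_finRange n'))).1
  have h3 := h.left.length_eq
  have h4 := h.right.length_eq
  simp only [List.length_append, List.length_map, List.length_finRange] at h3 h4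
  refine ⟨?_, fun a ha b hb => ?_, fun a ha b hb => ?_⟩
  · rw [List.toFinset_card_of_nodup (h1.of_map _), Fintype.card_fin, Fintype.card_fin]
    rcases h.nil_or_nil with rfl | rfl <;> simp only [List.length_nil] at h3 h4 <;> omega
  · exact List.inj_on_of_nodup_map h1 (List.mem_toFinset.1 ha) (List.mem_toFinset.1 hb)
  · exact List.inj_on_of_nodup_map h2 (List.mem_toFinset.1 ha) (List.mem_toFinset.1 hb)

/-- A mapping with the minimum of `n` and `n'` pairs exhausts one side, so unmatched vertices exist
on one side at most. This lets positions in two lists describe it. -/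
theorem exists_isAlignment {M : Finset (Fin n × Fin n')} (h : IsVertexMapping M) :
    ∃ z s t, IsAlignment z s t ∧ z.toFinset = M := by
  obtain ⟨hc, h1, h2⟩ := h
  have key : ∀ {k : ℕ} (F : Fin n × Fin n' → Fin k), (∀ a ∈ M, ∀ b ∈ M, F a = F b → a = b) →
      (M.toList.map F ++ (Finset.univ.filter fun v => v ∉ M.image F).toList).Perm
        (List.finRange k) := by
    intro k F hF
    refine List.perm_of_nodup_nodup_toFinset_eq (List.nodup_append.2 ⟨?_, Finset.nodup_toList _, ?_⟩)
      (List.nodup_finRange k) ?_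
    · refine List.Nodup.map_on (fun a ha b hb => ?_) (Finset.nodup_toList M)
      exact hF a (Finset.mem_toList.1 ha) b (Finset.mem_toList.1 hb)
    · rintro a ha b hb rfl
      obtain ⟨c, hc, rfl⟩ := List.mem_map.1 ha
      rw [Finset.mem_toList, Finset.mem_filter] at hb
      exact hb.2 (Finset.mem_image_of_mem F (Finset.mem_toList.1 hc))
    · ext v
      simp only [List.mem_toFinset, List.mem_append, List.mem_map, Finset.mem_toList,
        Finset.mem_filter, Finset.mem_univ, true_and, Finset.mem_image, List.mem_finRange, iff_true]
      exact em _
  refine ⟨M.toList, _, _, ⟨key Prod.fst h1, key Prod.snd h2, ?_⟩, M.toList_toFinset⟩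
  have h3 := (key Prod.fst h1).length_eq
  have h4 := (key Prod.snd h2).length_eq
  simp only [List.length_append, List.length_map, List.length_finRange, Finset.length_toList]
    at h3 h4
  rw [Fintype.card_fin, Fintype.card_fin] at hc
  rw [← List.length_eq_zero_iff, ← List.length_eq_zero_iff, Finset.length_toList,
    Finset.length_toList]
  omega

theorem rowCost_spec (d : X → X → ℚ) (F : α → X × ℚ) (G : β → X × ℚ) {z : List (α × β)}
    {s : List α} {t : List β} (h : s = [] ∨ t = []) :
    fracVal (rowCost d ((z.map Prod.fst ++ s).map F) ((z.map Prod.snd ++ t).map G)) =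
      (z.map fun a => |d (F a.1).1 (G a.2).1|).sum + ((s.map fun u => |(F u).2|).sum +
        (t.map fun v => |(G v).2|).sum) := by
  have h1 : ((z.map Prod.fst ++ s).map F).zip ((z.map Prod.snd ++ t).map G) =
      z.map fun a => (F a.1, G a.2) := by
    rw [List.map_append, List.map_append, List.zip_append (by simp), List.map_map, List.map_map,
      List.zip_map']
    rcases h with rfl | rfl <;> simp
  have h2 : ((z.map Prod.fst ++ s).map F).drop ((z.map Prod.snd ++ t).map G).length = s.map F := by
    rcases h with rfl | rfl
    · rw [List.drop_eq_nil_of_le (by simp), List.map_nil]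
    · rw [List.map_append (l₁ := z.map Prod.fst) (l₂ := s), List.drop_left' (by simp)]
  have h3 : ((z.map Prod.snd ++ t).map G).drop ((z.map Prod.fst ++ s).map F).length = t.map G := by
    rcases h with rfl | rfl
    · rw [List.map_append (l₁ := z.map Prod.snd) (l₂ := t), List.drop_left' (by simp)]
    · rw [List.drop_eq_nil_of_le (by simp), List.map_nil]
  rw [rowCost, h1, h2, h3, (fracSum_spec ?_).2]
  · simp only [List.map_append, List.map_map, List.sum_append, Function.comp_def, fracVal_fracAbs]
  · simp only [List.mem_append, List.mem_map]
    rintro p (⟨q, -, rfl⟩ | ⟨q, -, rfl⟩ | ⟨q, -, rfl⟩) <;> exact Rat.den_pos _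

theorem rowCost_pos (d : X → X → ℚ) (x y : List (X × ℚ)) : 0 < (rowCost d x y).2 := by
  refine (fracSum_spec ?_).1
  simp only [List.mem_append, List.mem_map]
  rintro p (⟨q, -, rfl⟩ | ⟨q, -, rfl⟩ | ⟨q, -, rfl⟩) <;> exact Rat.den_pos _

end Alignments

/-! ### Correctness of the algorithm -/

section Correctness

variable {X : Type} {T U n n' : ℕ}

/-- The rows of the table of signatures and deletion costs. -/
def table (f : Fin T → Fin n → X) (Δ : Fin T → Fin n → ℚ) : List (List (X × ℚ)) :=
  (List.finRange T).map fun i => (List.finRange n).map fun u => (f i u, Δ i u)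

/-- The columns of the table of signatures and deletion costs. -/
def column (f : Fin T → Fin n → X) (Δ : Fin T → Fin n → ℚ) (u : Fin n) : List (X × ℚ) :=
  (List.finRange T).map fun i => (f i u, Δ i u)

/-- The signatures of `u` in layers that represent all layers, as far as only the signatures of
the vertices in `ρ` are concerned. -/
def vertexKey (e : List X → List X → Bool) (f : Fin T → Fin n → X) (ρ : List (Fin n))
    (u : Fin n) : List X :=
  (distinctBy (fun i j => e (ρ.map (f i)) (ρ.map (f j))) (List.finRange T)).map fun i => f i u

variable {f : Fin T → Fin n → X} {Δ : Fin T → Fin n → ℚ} {g : Fin U → Fin n' → X}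
  {Δ' : Fin U → Fin n' → ℚ}

theorem transpose_table (hT : 1 ≤ T) :
    transpose ((table f Δ).headD []) (table f Δ) = (List.finRange n).map (column f Δ) := by
  refine transpose_map ?_ _ _
  obtain ⟨T, rfl⟩ := Nat.exists_eq_add_of_le' hT
  simp [table, List.finRange_succ]

theorem transpose_columns (ρ : List (Fin n)) : transpose (table f Δ) (ρ.map (column f Δ)) =
    (List.finRange T).map fun i => ρ.map fun u => (f i u, Δ i u) :=
  transpose_map (by simp [table]) _ fun u i => (f i u, Δ i u)

theorem columnKeys_columns (e : List X → List X → Bool) (ρ : List (Fin n)) :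
    columnKeys e (table f Δ) (ρ.map (column f Δ)) = ρ.map (vertexKey e f ρ) := by
  have h1 : (ρ.map (column f Δ)).map (fun c => c.map Prod.fst) =
      ρ.map fun u => (List.finRange T).map fun i => f i u := by
    rw [List.map_map]
    refine List.map_congr_left fun u _ => ?_
    simp [column]
  rw [columnKeys, h1, transpose_map (by simp [table]) ρ fun u i => f i u, distinctBy_map]
  exact transpose_map (by simp) _ f

/-- Layer `i` coincides on `ρ` with one of the layers that are kept, and the keys record the
signatures there. -/
theorem vertexKey_eq_iff {e : List X → List X → Bool} (he : ∀ a b, e a b = true ↔ a = b)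
    {ρ : List (Fin n)} {u v : Fin n} (hu : u ∈ ρ) (hv : v ∈ ρ)
    (h : vertexKey e f ρ u = vertexKey e f ρ v) (i : Fin T) : f i u = f i v := by
  obtain ⟨j, hj, hji⟩ := exists_mem_distinctBy (F := fun i => ρ.map (f i))
    (e := fun i j => e (ρ.map (f i)) (ρ.map (f j))) (fun _ _ => he _ _) (List.mem_finRange i)
  rw [List.map_inj_left] at hji
  rw [← hji u hu, ← hji v hv]
  exact List.map_inj_left.1 h j hj

theorem vertexKey_eq_of_isWarping {e : List X → List X → Bool} (he : ∀ a b, e a b = true ↔ a = b)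
    {l : List (Fin T × Fin U)} (hl : IsWarping (List.finRange T) (List.finRange U) l)
    {z : List (Fin n × Fin n')} (hz : ∀ a ∈ l, ∀ b ∈ z, f a.1 b.1 = g a.2 b.2)
    {ρ : List (Fin n)} {ρ' : List (Fin n')} (hρ : ρ.Perm (z.map Prod.fst))
    (hρ' : ρ'.Perm (z.map Prod.snd)) {b : Fin n × Fin n'} (hb : b ∈ z) :
    vertexKey e f ρ b.1 = vertexKey e g ρ' b.2 := by
  -- To compare layers of different graphs, both are viewed as functions on the pairs in `z`.
  -- Equality of such functions is what `e` tests on the lists `ρ` and `ρ'`, in whatever order these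
  -- list the vertices.
  have h := hl.distinctBy_eq (F := fun i => fun b : {b // b ∈ z} => f i b.1.1)
    (G := fun j => fun b : {b // b ∈ z} => g j b.1.2)
    (fun a ha => funext fun b => hz a ha b.1 b.2)
    (e := fun i j => e (ρ.map (f i)) (ρ.map (f j)))
    (e' := fun i j => e (ρ'.map (g i)) (ρ'.map (g j))) (fun i j => ?_) fun i j => ?_
  · have h' := congrArg (List.map fun F => F ⟨b, hb⟩) h
    rw [List.map_map, List.map_map] at h'
    exact h'
  · rw [he, List.map_inj_left, funext_iff]
    constructor
    · exact fun h b => h _ (hρ.symm.subset (List.mem_map.2 ⟨b.1, b.2, rfl⟩))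
    · intro h u hu
      obtain ⟨b, hb, rfl⟩ := List.mem_map.1 (hρ.subset hu)
      exact h ⟨b, hb⟩
  · rw [he, List.map_inj_left, funext_iff]
    constructor
    · exact fun h b => h _ (hρ'.symm.subset (List.mem_map.2 ⟨b.1, b.2, rfl⟩))
    · intro h u hu
      obtain ⟨b, hb, rfl⟩ := List.mem_map.1 (hρ'.subset hu)
      exact h ⟨b, hb⟩

/-- The first two claims hold for any input and serve soundness; the last one serves completeness.
-/
theorem matchColumns_columns (e : List X → List X → Bool) (A : List (List (X × ℚ)))
    (r : List (List (X × ℚ))) (ρ' : List (Fin n')) :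
    ∃ ρ₂ : List (Fin n'), ρ₂.Perm ρ' ∧ matchColumns e A (table g Δ') r (ρ'.map (column g Δ')) =
      ρ₂.map (column g Δ') ∧ ((∀ a b, e a b = true ↔ a = b) →
        (columnKeys e A r).Perm (ρ'.map (vertexKey e g ρ')) →
          ρ₂.map (vertexKey e g ρ') = columnKeys e A r) := by
  have h1 : (columnKeys e (table g Δ') (ρ'.map (column g Δ'))).zip (ρ'.map (column g Δ')) =
      ρ'.map fun v => (vertexKey e g ρ' v, column g Δ' v) := by
    rw [columnKeys_columns, List.zip_map']
  obtain ⟨ρ₂, h2, h3⟩ := exists_perm_of_perm_map ((greedy_perm e (columnKeys e A r) _).trans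
    (List.Perm.of_eq h1))
  refine ⟨ρ₂, h2, ?_, fun he hp => ?_⟩
  · rw [matchColumns, h3, List.map_map]
    rfl
  · have h4 := map_fst_greedy he (ks := columnKeys e A r)
      (pool := (columnKeys e (table g Δ') (ρ'.map (column g Δ'))).zip (ρ'.map (column g Δ')))
      (by rw [h1, List.map_map]; exact hp)
    rw [h3, List.map_map] at h4
    exact h4

/-- Back in row form, matched vertices occupy equal positions in every layer, and the surplus of the
longer row is `s` or `t`. So `cell` minimizes the cost of this alignment, with absolute values, over
all paths. -/
theorem accepts_iff (d : X → X → ℚ) {A B : List (List (X × ℚ))} (hA : A = table f Δ)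
    (hB : B = table g Δ') (e : List X → List X → Bool)
    {c : ℕ × ℕ} (hc : 0 < c.2) {q q' : List (List (X × ℚ)) × List (List (X × ℚ))}
    {z : List (Fin n × Fin n')} {s : List (Fin n)} {t : List (Fin n')} (hst : s = [] ∨ t = [])
    (hq : q.2 ++ q.1 = (z.map Prod.fst ++ s).map (column f Δ))
    (hq' : matchColumns e A B q.2 q'.2 ++ q'.1 = (z.map Prod.snd ++ t).map (column g Δ')) :
    accepts d e A B c q q' = true ↔ ∃ l, IsWarping (List.finRange T) (List.finRange U) l ∧
      (l.map fun a => (z.map fun b => |d (f a.1 b.1) (g a.2 b.2)|).sum +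
        ((s.map fun u => |Δ a.1 u|).sum + (t.map fun v => |Δ' a.2 v|).sum)).sum ≤ fracVal c := by
  rw [accepts, hq, hq', hA, hB, transpose_columns, transpose_columns, List.any_eq_true]
  have hcost : ∀ a : Fin T × Fin U, fracVal (rowCost d
      ((z.map Prod.fst ++ s).map fun u => (f a.1 u, Δ a.1 u))
      ((z.map Prod.snd ++ t).map fun v => (g a.2 v, Δ' a.2 v))) =
      (z.map fun b => |d (f a.1 b.1) (g a.2 b.2)|).sum +
        ((s.map fun u => |Δ a.1 u|).sum + (t.map fun v => |Δ' a.2 v|).sum) := fun a =>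
    rowCost_spec d (fun u => (f a.1 u, Δ a.1 u)) (fun v => (g a.2 v, Δ' a.2 v)) hst
  simp only [← hcost]
  have hs := cell_spec (rowCost_pos d)
    ((List.finRange T).map fun i => (z.map Prod.fst ++ s).map fun u => (f i u, Δ i u))
    ((List.finRange U).map fun j => (z.map Prod.snd ++ t).map fun v => (g j v, Δ' j v))
  constructor
  · rintro ⟨v, hv, hle⟩
    obtain ⟨hpos, l', hl', hv'⟩ := hs.1 v hv
    obtain ⟨l, hl, rfl⟩ := hl'.exists_of_map rfl rfl
    rw [fracLe_iff hpos hc, hv', List.map_map] at hle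
    exact ⟨l, hl, hle⟩
  · rintro ⟨l, hl, hle⟩
    obtain ⟨v, hv, hv'⟩ := hs.2 _ (hl.map (fun i => (z.map Prod.fst ++ s).map fun u =>
      (f i u, Δ i u)) (fun j => (z.map Prod.snd ++ t).map fun v => (g j v, Δ' j v)))
    rw [List.map_map] at hv'
    exact ⟨v, hv, (fracLe_iff (hs.1 v hv).1 hc).2 (hv'.trans hle)⟩

end Correctness

/-! ### Soundness and completeness of the search -/

section Search

variable {X : Type} {T U n n' : ℕ} {f : Fin T → Fin n → X} {Δ : Fin T → Fin n → ℚ}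
  {g : Fin U → Fin n' → X} {Δ' : Fin U → Fin n' → ℚ}

/-- The accepted column orders lift to orders of the vertices, and matching these position by
position is an alignment. Nothing about metric or keys is needed. -/
theorem exists_of_search {d : X → X → ℚ} {e : List X → List X → Bool} (hT : 1 ≤ T) (hU : 1 ≤ U)
    {c : ℕ × ℕ} (hc : 0 < c.2) {w : List Bool}
    (h : search d e (table f Δ) (table g Δ') c w = true) :
    ∃ z s t, IsAlignment z s t ∧ ∃ l, IsWarping (List.finRange T) (List.finRange U) l ∧
      (l.map fun a => (z.map fun b => |d (f a.1 b.1) (g a.2 b.2)|).sum +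
        ((s.map fun u => |Δ a.1 u|).sum + (t.map fun v => |Δ' a.2 v|).sum)).sum ≤ fracVal c := by
  rw [search, transpose_table hT, transpose_table hU, List.any_eq_true] at h
  obtain ⟨q, hq, h⟩ := h
  obtain ⟨q', hq', h⟩ := List.any_eq_true.1 h
  obtain ⟨σ, hσ, hqσ⟩ := exists_perm_of_perm_map
    (List.perm_append_comm.trans (perm_of_mem_picks hq))
  obtain ⟨τ, hτ, hqτ⟩ := exists_perm_of_perm_map
    (List.perm_append_comm.trans (perm_of_mem_picks hq'))
  obtain ⟨ρ', θ, rfl, h1, h2⟩ := List.map_eq_append_iff.1 hqτ.symm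
  obtain ⟨ρ₂, h3, h4, -⟩ := matchColumns_columns (g := g) (Δ' := Δ') e (table f Δ) q.2 ρ'
  rw [h1] at h4
  obtain ⟨z, s, t, rfl, h5, hst⟩ := exists_zip σ (ρ₂ ++ θ)
  obtain ⟨l, hl, hle⟩ := (accepts_iff d rfl rfl e hc hst hqσ (by
    rw [h4, ← h2, ← h5, List.map_append])).1 h
  exact ⟨z, s, t, ⟨hσ, h5 ▸ (h3.append_right θ).trans hτ, hst⟩, l, hl, hle⟩

/-- Here `z'` are the free pairs and `z` the others. The selections containing `z`, `s` and `t` are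
among those tried. The greedy matching may differ from `z'`, but only by exchanging vertices with
equal keys, so it is free along the same path `l`. -/
theorem search_of_isAlignment {d : X → X → ℚ} (hd : ∀ x, d x x = 0) {e : List X → List X → Bool}
    (he : ∀ a b, e a b = true ↔ a = b) (hT : 1 ≤ T) (hU : 1 ≤ U) {c : ℕ × ℕ} (hc : 0 < c.2)
    {w : List Bool} {z z' : List (Fin n × Fin n')} {s : List (Fin n)} {t : List (Fin n')}
    (hz : IsAlignment (z' ++ z) s t) (hs : z.length + s.length ≤ w.length)
    (ht : z.length + t.length ≤ w.length) {l : List (Fin T × Fin U)}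
    (hl : IsWarping (List.finRange T) (List.finRange U) l)
    (hz' : ∀ a ∈ l, ∀ b ∈ z', f a.1 b.1 = g a.2 b.2)
    (hle : (l.map fun a => (z.map fun b => |d (f a.1 b.1) (g a.2 b.2)|).sum +
      ((s.map fun u => |Δ a.1 u|).sum + (t.map fun v => |Δ' a.2 v|).sum)).sum ≤ fracVal c) :
    search d e (table f Δ) (table g Δ') c w = true := by
  have hcol : ∀ {k m : ℕ} (F : Fin k → List (X × ℚ)) (σ σ' : List (Fin k)),
      (σ' ++ σ).Perm (List.finRange k) → σ.length ≤ m →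
      m = w.length → ∃ ρ : List (Fin k), ρ.Perm σ' ∧
        (σ.map F, ρ.map F) ∈ picks w ((List.finRange k).map F) := by
    intro k m F σ σ' h1 h2 h3
    have h4 : (σ.map F ++ σ'.map F).Perm ((List.finRange k).map F) := by
      rw [← List.map_append]
      exact (List.perm_append_comm.trans h1).map F
    obtain ⟨r, hr, hm⟩ := exists_mem_picks (w := w) h4 (by rw [List.length_map]; omega)
    obtain ⟨ρ, h5, rfl⟩ := exists_perm_of_perm_map hr
    exact ⟨ρ, h5, hm⟩
  have hl1 := hz.left
  have hr1 := hz.right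
  rw [List.map_append, List.append_assoc] at hl1 hr1
  obtain ⟨ρ, hρ, hq⟩ := hcol (column f Δ) _ _ hl1 (by simpa using hs) rfl
  obtain ⟨ρ', hρ', hq'⟩ := hcol (column g Δ') _ _ hr1 (by simpa using ht) rfl
  -- List the free pairs in the order in which their first vertices remain after the selection.
  obtain ⟨y, hy, rfl⟩ := exists_perm_of_perm_map hρ
  have hy' : ρ'.Perm (y.map Prod.snd) := hρ'.trans (hy.symm.map _)
  have hzy : ∀ a ∈ l, ∀ b ∈ y, f a.1 b.1 = g a.2 b.2 := fun a ha b hb => hz' a ha b (hy.subset hb)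
  have hkey : ∀ b ∈ y, vertexKey e f (y.map Prod.fst) b.1 = vertexKey e g ρ' b.2 := fun b hb =>
    vertexKey_eq_of_isWarping he hl hzy (List.Perm.refl _) hy' hb
  obtain ⟨ρ₂, h3, h4, h5⟩ := matchColumns_columns (g := g) (Δ' := Δ') e (table f Δ)
    ((y.map Prod.fst).map (column f Δ)) ρ'
  have hkeys : columnKeys e (table f Δ) ((y.map Prod.fst).map (column f Δ)) =
      (y.map Prod.snd).map (vertexKey e g ρ') := by
    rw [columnKeys_columns, List.map_map, List.map_map]
    exact List.map_congr_left hkey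
  have h6 := h5 he (by rw [hkeys]; exact (hy'.symm.map _))
  rw [hkeys] at h6
  have hlen : ρ₂.length = y.length := by
    rw [(h3.trans hy').length_eq, List.length_map]
  have hx : ((y.map Prod.fst).zip ρ₂).map Prod.fst = y.map Prod.fst :=
    List.map_fst_zip (by simp [hlen])
  have hx' : ((y.map Prod.fst).zip ρ₂).map Prod.snd = ρ₂ := List.map_snd_zip (by simp [hlen])
  -- The greedy partner has the same key as the hidden partner in `y`, hence the same signature in
  -- every layer of the second graph.
  have hzero : ∀ a ∈ l, ∀ b ∈ (y.map Prod.fst).zip ρ₂, f a.1 b.1 = g a.2 b.2 := by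
    intro a ha b hb
    obtain ⟨k, hk, rfl⟩ := List.mem_iff_getElem.1 hb
    have hk1 : k < y.length := by simpa [hlen] using hk
    have hk2 : k < ρ₂.length := by omega
    rw [List.getElem_zip, List.getElem_map]
    have h7 : vertexKey e g ρ' ρ₂[k] = vertexKey e g ρ' y[k].2 := by
      have := congrArg (fun m : List (List X) => m[k]?) h6
      simpa [hk1, hk2] using this
    rw [hzy a ha _ (List.getElem_mem hk1)]
    refine (vertexKey_eq_iff he (h3.subset (List.getElem_mem hk2)) (hy'.symm.subset ?_) h7 a.2).symm
    exact List.mem_map.2 ⟨_, List.getElem_mem hk1, rfl⟩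
  rw [search, transpose_table hT, transpose_table hU, List.any_eq_true]
  refine ⟨_, hq, List.any_eq_true.2 ⟨_, hq', ?_⟩⟩
  refine (accepts_iff d rfl rfl e hc (z := (y.map Prod.fst).zip ρ₂ ++ z) hz.nil_or_nil ?_ ?_).2
    ⟨l, hl, ?_⟩
  · rw [List.map_append (l₁ := (y.map Prod.fst).zip ρ₂) (l₂ := z), hx, List.append_assoc,
      List.map_append (l₁ := y.map Prod.fst)]
  · rw [h4, List.map_append (l₁ := (y.map Prod.fst).zip ρ₂) (l₂ := z), hx', List.append_assoc,
      List.map_append (l₁ := ρ₂)]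
  · refine (congrArg List.sum (List.map_congr_left fun a ha => ?_)).trans_le hle
    have h8 : ((y.map Prod.fst).zip ρ₂).map (fun b => |d (f a.1 b.1) (g a.2 b.2)|) =
        ((y.map Prod.fst).zip ρ₂).map fun _ => 0 :=
      List.map_congr_left fun b hb => by rw [hzero a ha b hb, hd, abs_zero]
    rw [List.map_append, List.sum_append, h8]
    simp

/-- Each element that causes a cost of at least `ε` somewhere contributes at least `ε`. -/
theorem mul_length_le_sum {α β : Type} {l : List α} {z : List β} {h : α → β → ℚ} {ε : ℚ}
    (h0 : ∀ a b, 0 ≤ h a b) (hz : ∀ b ∈ z, ∃ a ∈ l, ε ≤ h a b) :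
    ε * z.length ≤ (l.map fun a => (z.map (h a)).sum).sum := by
  rw [sum_map_sum_comm, mul_comm, ← nsmul_eq_mul, ← List.length_map (as := z)
    (f := fun b => (l.map fun a => h a b).sum)]
  refine List.card_nsmul_le_sum _ _ fun x hx => ?_
  obtain ⟨b, hb, rfl⟩ := List.mem_map.1 hx
  obtain ⟨a, ha, hab⟩ := hz b hb
  exact hab.trans (List.single_le_sum (fun x hx => by
    obtain ⟨a, -, rfl⟩ := List.mem_map.1 hx
    exact h0 a b) _
    (List.mem_map.2 ⟨a, ha, rfl⟩))

theorem IsMetric.nonneg {d : X → X → ℚ} (hd : IsMetric d) (x y : X) : 0 ≤ d x y := by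
  have h1 := hd.triangle x y x
  rw [(hd.eq_zero_iff x x).2 rfl, hd.symm y x] at h1
  linarith

/-- If the vertex sets have equal size, then no vertex is unmatched. -/
theorem IsAlignment.nil_and_nil {z : List (Fin n × Fin n')} {s : List (Fin n)} {t : List (Fin n')}
    (h : IsAlignment z s t) (hn : n = n') : s = [] ∧ t = [] := by
  have h1 := h.left.length_eq
  have h2 := h.right.length_eq
  simp only [List.length_append, List.length_map, List.length_finRange] at h1 h2
  rcases h.nil_or_nil with rfl | rfl <;> simp only [List.length_nil] at h1 h2
  · exact ⟨rfl, List.length_eq_zero_iff.1 (by omega)⟩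
  · exact ⟨List.length_eq_zero_iff.1 (by omega), rfl⟩

theorem mappingCost_nonneg {d : X → X → ℚ} (hd : IsMetric d) {f : Fin n → X} {g : Fin n' → X}
    {Δ : Fin n → ℚ} {Δ' : Fin n' → ℚ} (hadm : n = n' ∨ (∀ u, 0 ≤ Δ u) ∧ ∀ v, 0 ≤ Δ' v)
    {M : Finset (Fin n × Fin n')} (hM : IsVertexMapping M) : 0 ≤ mappingCost d f g Δ Δ' M := by
  obtain ⟨z, s, t, hz, rfl⟩ := exists_isAlignment hM
  rw [hz.mappingCost, alignCost]
  have h0 : 0 ≤ (z.map fun a => d (f a.1) (g a.2)).sum := List.sum_nonneg fun x hx => by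
    obtain ⟨b, -, rfl⟩ := List.mem_map.1 hx
    exact hd.nonneg _ _
  rcases hadm with hn | ⟨h1, h2⟩
  · obtain ⟨rfl, rfl⟩ := hz.nil_and_nil hn
    simpa using h0
  · refine add_nonneg (add_nonneg h0 ?_) ?_ <;> refine List.sum_nonneg fun x hx => ?_ <;>
      obtain ⟨b, -, rfl⟩ := List.mem_map.1 hx
    exacts [h1 b, h2 b]

/-- The length of `w` only has to reach `c / ε`, the largest possible number of pairs that are not
free and deleted vertices. -/
theorem search_iff {d : X → X → ℚ} (hd : IsMetric d) {e : List X → List X → Bool}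
    (he : ∀ a b, e a b = true ↔ a = b) (hT : 1 ≤ T) (hU : 1 ≤ U) {ε : ℚ} (hε : 0 < ε)
    (hsep : ∀ i j u v, f i u ≠ g j v → ε ≤ d (f i u) (g j v))
    (hadm : n = n' ∨ (∀ i u, ε ≤ Δ i u) ∧ ∀ j v, ε ≤ Δ' j v) {c : ℚ} (hc : 0 ≤ c)
    {w : List Bool} (hw : c ≤ ε * w.length) :
    search d e (table f Δ) (table g Δ') (fracAbs c) w = true ↔
      ∃ M, IsVertexMapping M ∧ ∃ p, IsWarpingPath p ∧
        ∑ a ∈ p, mappingCost d (f a.1) (g a.2) (Δ a.1) (Δ' a.2) M ≤ c := by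
  have hcpos : 0 < (fracAbs c).2 := Rat.den_pos c
  have hcval : fracVal (fracAbs c) = c := by rw [fracVal_fracAbs, abs_of_nonneg hc]
  have hnil : ∀ {z : List (Fin n × Fin n')} {s t}, IsAlignment z s t →
      (s = [] ∧ t = []) ∨ (∀ i u, ε ≤ Δ i u) ∧ ∀ j v, ε ≤ Δ' j v :=
    fun h => hadm.imp_left h.nil_and_nil
  -- The program ignores signs. This is harmless: a deletion cost that occurs in an alignment is
  -- positive.
  have habs : ∀ {z : List (Fin n × Fin n')} {s t}, IsAlignment z s t → ∀ a : Fin T × Fin U,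
      (s.map fun u => |Δ a.1 u|) = s.map (Δ a.1) ∧ (t.map fun v => |Δ' a.2 v|) = t.map (Δ' a.2) := by
    intro z s t h a
    rcases hnil h with ⟨rfl, rfl⟩ | ⟨h1, h2⟩
    · simp
    · exact ⟨List.map_congr_left fun u _ => abs_of_pos (hε.trans_le (h1 _ _)),
        List.map_congr_left fun v _ => abs_of_pos (hε.trans_le (h2 _ _))⟩
  have hsum : ∀ {z : List (Fin n × Fin n')} {s t}, IsAlignment z s t → ∀ a : Fin T × Fin U,
      (z.map fun b => |d (f a.1 b.1) (g a.2 b.2)|).sum +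
        ((s.map fun u => |Δ a.1 u|).sum + (t.map fun v => |Δ' a.2 v|).sum) =
      mappingCost d (f a.1) (g a.2) (Δ a.1) (Δ' a.2) z.toFinset := by
    intro z s t h a
    rw [h.mappingCost, alignCost, (habs h a).1, (habs h a).2, add_assoc]
    simp only [abs_of_nonneg (hd.nonneg _ _)]
  constructor
  · intro h
    obtain ⟨z, s, t, h1, l, hl, hle⟩ := exists_of_search hT hU hcpos h
    refine ⟨z.toFinset, h1.isVertexMapping, l.toFinset,
      (isWarpingPath_iff hT).2 ⟨l, hl, rfl⟩, ?_⟩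
    rw [List.sum_toFinset _ hl.nodup]
    simp only [hsum h1, hcval] at hle
    exact hle
  · rintro ⟨M, hM, p, hp, hle⟩
    obtain ⟨z, s, t, hz, rfl⟩ := exists_isAlignment hM
    obtain ⟨l, hl, rfl⟩ := (isWarpingPath_iff hT).1 hp
    rw [List.sum_toFinset _ hl.nodup] at hle
    have hlne : ∃ a, a ∈ l := List.exists_mem_of_ne_nil l (hl.ne_nil fun h => by
      have := congrArg List.length h
      rw [List.length_finRange, List.length_nil] at this
      omega)
    classical
    -- The free pairs with respect to the path `l`.
    set P : Fin n × Fin n' → Bool := fun b => decide (∀ a ∈ l, f a.1 b.1 = g a.2 b.2) with hP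
    set z₀ := z.filter P
    set z₁ := z.filter fun b => !P b
    have hperm : (z₀ ++ z₁).Perm z := List.filter_append_perm P z
    have hz2 : IsAlignment (z₀ ++ z₁) s t :=
      ⟨((hperm.map _).append_right s).trans hz.left, ((hperm.map _).append_right t).trans hz.right,
        hz.nil_or_nil⟩
    have hset : (z₀ ++ z₁).toFinset = z.toFinset := List.toFinset_eq_of_perm _ _ hperm
    simp only [← hset, ← hsum hz2] at hle
    have hz0 : ∀ a ∈ l, ∀ b ∈ z₀, f a.1 b.1 = g a.2 b.2 := fun a ha b hb =>
      of_decide_eq_true (List.mem_filter.1 hb).2 a ha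
    have hle2 : (l.map fun a => (z₁.map fun b => |d (f a.1 b.1) (g a.2 b.2)|).sum +
        ((s.map fun u => |Δ a.1 u|).sum + (t.map fun v => |Δ' a.2 v|).sum)).sum ≤ c := by
      refine (List.sum_le_sum fun a _ => ?_).trans hle
      rw [List.map_append, List.sum_append]
      have : 0 ≤ (z₀.map fun b => |d (f a.1 b.1) (g a.2 b.2)|).sum :=
        List.sum_nonneg fun x hx => by
          obtain ⟨b, -, rfl⟩ := List.mem_map.1 hx
          exact abs_nonneg _
      linarith
    -- A pair in `z₁` costs at least `ε` at some position of the path; an unmatched vertex does so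
    -- at every position, and there is one because the path is nonempty.
    have hlen : ε * (z₁.length + (s.length + t.length)) ≤ c := by
      refine le_trans ?_ hle2
      rw [List.sum_map_add, List.sum_map_add, mul_add, mul_add]
      refine add_le_add (mul_length_le_sum (fun _ _ => abs_nonneg _) fun b hb => ?_)
        (add_le_add (mul_length_le_sum (fun _ _ => abs_nonneg _) fun u hu => ?_)
          (mul_length_le_sum (fun _ _ => abs_nonneg _) fun v hv => ?_))
      · have h1 := (List.mem_filter.1 hb).2
        simp only [hP, Bool.not_eq_true', decide_eq_false_iff_not, not_forall] at h1
        obtain ⟨a, ha, hne⟩ := h1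
        exact ⟨a, ha, (hsep _ _ _ _ hne).trans (le_abs_self _)⟩
      · obtain ⟨a, ha⟩ := hlne
        rcases hnil hz with ⟨rfl, -⟩ | ⟨h1, -⟩
        · cases hu
        · exact ⟨a, ha, (h1 _ _).trans (le_abs_self _)⟩
      · obtain ⟨a, ha⟩ := hlne
        rcases hnil hz with ⟨-, rfl⟩ | ⟨-, h1⟩
        · cases hv
        · exact ⟨a, ha, (h1 _ _).trans (le_abs_self _)⟩
    have hlen2 : z₁.length + (s.length + t.length) ≤ w.length := by
      have := le_of_mul_le_mul_left (hlen.trans hw) hε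
      exact_mod_cast this
    exact search_of_isAlignment (fun x => (hd.eq_zero_iff x x).2 rfl) he hT hU hcpos hz2 (by omega)
      (by omega) hl hz0 (hle2.trans_eq hcval.symm)

end Search

/-! ### Membership in XP -/

section XP

variable {α β : Type} [Enc α] [Enc β]

/-- For a monomial use `a ≤ 2 ^ a ≤ (s + 2) ^ a`; a sum costs one more factor, which is at least 2.
-/
theorem exists_eval_le_pow (P : Polynomial ℕ) : ∃ c, ∀ s, P.eval s ≤ (s + 2) ^ c := by
  induction P using Polynomial.induction_on' with
  | add p q hp hq =>
    obtain ⟨a, ha⟩ := hp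
    obtain ⟨b, hb⟩ := hq
    refine ⟨a + b + 1, fun s => ?_⟩
    have h1 : (s + 2) ^ a ≤ (s + 2) ^ (a + b) := Nat.pow_le_pow_right (by omega) (by omega)
    have h2 : (s + 2) ^ b ≤ (s + 2) ^ (a + b) := Nat.pow_le_pow_right (by omega) (by omega)
    have h3 := Nat.mul_le_mul_left ((s + 2) ^ (a + b)) (show 2 ≤ s + 2 by omega)
    rw [Polynomial.eval_add, pow_succ]
    linarith [ha s, hb s]
  | monomial n a =>
    refine ⟨a + n, fun s => ?_⟩
    rw [Polynomial.eval_monomial, pow_add]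
    exact Nat.mul_le_mul ((Nat.lt_two_pow_self.le).trans (Nat.pow_le_pow_left (by omega) _))
      (Nat.pow_le_pow_left (by omega) _)

theorem PolyTime.pt {F : α → β} (h : PolyTime F) : PT F := by
  obtain ⟨p, P, h⟩ := h
  obtain ⟨c, hc⟩ := exists_eval_le_pow P
  refine ⟨p, fun _ => c, fun x => ?_⟩
  obtain ⟨t, ht, hr⟩ := h x
  exact ⟨t, ht.trans (hc _), hr⟩

/-- An encoding depends only on the encodings of the entries. So the signature table, whose type
depends on the graph, may be regarded as a list of lists. -/
theorem enc_ofFn_congr {n : ℕ} {v : Fin n → α} {w : Fin n → β}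
    (h : ∀ i, Enc.enc (v i) = Enc.enc (w i)) :
    Enc.enc (List.ofFn v) = Enc.enc (List.ofFn w) := by
  have key : ∀ {γ : Type} [Enc γ] (u : Fin n → γ), Enc.enc (List.ofFn u) =
      (List.ofFn fun i => Enc.enc (u i)).foldr Data.cons .nil := by
    intro γ _ u
    change (List.ofFn u).foldr (fun a t => Data.cons (Enc.enc a) t) .nil = _
    rw [← List.foldr_map (f := Enc.enc) (g := Data.cons), List.map_ofFn]
    rfl
  rw [key, key, funext h]

theorem PolyTimeSignature.pt {X : Type} [Enc X] {f : Signature X} (h : PolyTimeSignature f) :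
    PT (fun G : TemporalGraph => List.ofFn fun i => List.ofFn (f G i)) := by
  obtain ⟨p, P, h⟩ := h
  obtain ⟨c, hc⟩ := exists_eval_le_pow P
  refine ⟨p, fun _ => c, fun G => ?_⟩
  obtain ⟨t, ht, hr⟩ := h G
  refine ⟨t, ht.trans (hc _), ?_⟩
  rwa [show Enc.enc (List.ofFn fun i => List.ofFn (f G i)) = Enc.enc (List.ofFn (f G)) from
    enc_ofFn_congr fun i => rfl]

theorem PT.table {X : Type} [Enc X] {f : Signature X} {Δ : Signature ℚ}
    (hf : PolyTimeSignature f) (hΔ : PolyTimeSignature Δ) :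
    PT (fun G : TemporalGraph => table (f G) (Δ G)) :=
  (CT.zipWith (g := fun _ => List.zip) hf.pt hΔ.pt (.zip (.fst (.snd .id)) (.snd (.snd .id)))).of_eq
    fun G => by
      refine List.ext_getElem (by simp [DTGW.table]) fun i hi hi' => ?_
      simp only [DTGW.table, List.getElem_zipWith, List.getElem_ofFn, List.getElem_map,
        List.getElem_finRange]
      exact List.ext_getElem (by simp) fun j hj hj' => by simp

/-- Two signatures are equal if and only if their distance is zero, that is, if its numerator has no
binary digits. -/
theorem IsMetric.exists_beq {X : Type} [Enc X] {d : X → X → ℚ} (hd : IsMetric d)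
    (h : PT (fun q : X × X => d q.1 q.2)) :
    ∃ e : X → X → Bool, PT (fun q : X × X => e q.1 q.2) ∧ ∀ x y, e x y = true ↔ x = y := by
  refine ⟨fun x y => (fracAbs (d x y)).1.bits.isEmpty,
    .isEmpty (.bits (.fst (.fracAbs h))), fun x y => ?_⟩
  rw [← hd.eq_zero_iff, List.isEmpty_iff_length_eq_zero, Nat.size_eq_bits_len, Nat.size_eq_zero,
    fracAbs, Int.natAbs_eq_zero, Rat.num_eq_zero]

open Classical in
/-- Running times that are powers of the input size plus a constant suffice for XP. -/
theorem InXP.of_ct {K : Type} {L : α → Prop} {κ : α → K} {F : α → Bool} (hF : CT κ F)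
    (h : ∀ x, F x = true ↔ L x) (hs : ∀ x : α, 2 ≤ inputSize x) : InXP L κ := by
  obtain ⟨p, φ, hp⟩ := hF
  refine ⟨p, fun k => 2 * φ k, fun x => ?_⟩
  obtain ⟨t, ht, hr⟩ := hp x
  refine ⟨t, ht.trans ?_, ?_⟩
  -- For `s ≥ 2` one has `s + 2 ≤ s ^ 2`, so doubling the exponent removes the added constant.
  · rw [pow_mul]
    exact Nat.pow_le_pow_left (by nlinarith [hs x]) _
  · rwa [show decide (L x) = F x by rw [Bool.eq_iff_iff, decide_eq_true_iff, h]]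

theorem isYes_iff {X : Type} {d : X → X → ℚ} {f : Signature X} {Δ : Signature ℚ} {I : Instance} :
    IsYes d f Δ I ↔ ∃ M, IsVertexMapping M ∧ ∃ p, IsWarpingPath p ∧
      ∑ a ∈ p, mappingCost d (f I.G a.1) (f I.H a.2) (Δ I.G a.1) (Δ I.H a.2) M ≤ I.c := by
  simp [IsYes, dtgw, Finset.inf'_le_iff, vertexMappings, warpingPaths]

end XP
end DTGW

/-! ### Assembly of the decision procedure -/

theorem mainTheorem8 (k : ℕ) (d : (Fin k → ℚ) → (Fin k → ℚ) → ℚ) (hd : DTGW.IsMetric d)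
    (hdpoly : DTGW.PolyTime (fun x : (Fin k → ℚ) × (Fin k → ℚ) => d x.1 x.2))
    (f : DTGW.Signature (Fin k → ℚ)) (hf : DTGW.PolyTimeSignature f)
    (Δ : DTGW.Signature ℚ) (hΔ : DTGW.PolyTimeSignature Δ)
    (δ : ℝ) (hδ : 0 < δ)
    (hsep : ∀ (G H : DTGW.TemporalGraph) (i : Fin G.T) (j : Fin H.T) (u : Fin G.n) (v : Fin H.n),
      f G i u ≠ f H j v → δ ≤ (d (f G i u) (f H j v) : ℝ)) :
    DTGW.InXP (α := {I : DTGW.Instance // DTGW.Admissible δ Δ I})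
      (fun I => DTGW.IsYes d f Δ I.1) (fun I => I.1.c) := by
  obtain ⟨e, he, hee⟩ := hd.exists_beq hdpoly.pt
  obtain ⟨E, hE, hEE⟩ := DTGW.PT.list_beq he hee
  -- The costs are rational, so the real bound `δ` is replaced by a smaller unit fraction `ε`; then
  -- the number of selected vertices can be a multiple of `m + 1`.
  obtain ⟨m, hm⟩ := exists_nat_one_div_lt hδ
  set ε : ℚ := 1 / ((m : ℚ) + 1) with hε
  have hεδ : (ε : ℝ) < δ := by rw [hε]; push_cast; exact hm
  have hε0 : 0 < ε := by positivity
  have hle : ∀ q : ℚ, δ ≤ (q : ℝ) → ε ≤ q := fun q hq => by exact_mod_cast hεδ.le.trans hq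
  let κ : {I : DTGW.Instance // DTGW.Admissible δ Δ I} → ℚ := fun I => I.1.c
  -- An instance is encoded as this triple, so the identity program computes it.
  have hI : DTGW.CT κ (fun I => (I.1.G, I.1.H, I.1.c)) := DTGW.CT.id (κ := κ)
  have hc : DTGW.CT κ (fun I => I.1.c) := hI.snd.snd
  -- Its length is `(m + 1) * |c.num|`, at least `c / ε` because `|c| ≤ |c.num|`. Being wasteful
  -- here is harmless, since the exponent may depend on `c` arbitrarily.
  have hw : DTGW.CT κ (fun I => DTGW.unary (m + 1) (DTGW.fracAbs I.1.c).1) :=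
    .unary (.fst (.fracAbs hc)) (m + 1) (φ := fun c => c.num.natAbs) fun I => le_rfl
  have hT : DTGW.PT (fun G => DTGW.table (f G) (Δ G)) := .table hf hΔ
  -- The search is given the absolute value of `c`, so negative bounds are rejected separately.
  refine .of_ct (.and (.not (.rat_neg hc)) (.search hdpoly.pt hE (.comp hT hI.fst)
    (.comp hT hI.snd.fst) (.fracAbs hc) hw (φ := fun c => (m + 1) * c.num.natAbs)
    fun I => (DTGW.length_unary _ _).le)) (fun I => ?_) fun I => ?_
  · have hadm : I.1.G.n = I.1.H.n ∨
        (∀ i u, ε ≤ Δ I.1.G i u) ∧ ∀ j v, ε ≤ Δ I.1.H j v :=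
      I.2.imp_right fun h => ⟨fun i u => hle _ (h.1 i u), fun j v => hle _ (h.2 j v)⟩
    rw [DTGW.isYes_iff, Bool.and_eq_true, Bool.not_eq_true', decide_eq_false_iff_not, Rat.num_neg,
      not_lt]
    have key := fun hc0 => DTGW.search_iff (f := f I.1.G) (g := f I.1.H) hd hEE I.1.G.T_pos
      I.1.H.T_pos hε0 (fun i j u v h => hle _ (hsep _ _ i j u v h)) hadm (c := I.1.c) hc0
      (w := DTGW.unary (m + 1) (DTGW.fracAbs I.1.c).1) ?_
    · refine ⟨fun h => (key h.1).1 h.2, fun h => ?_⟩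
      obtain ⟨M, hM, p, hp, hle'⟩ := id h
      -- On admissible instances every mapping has nonnegative cost, so a yes-instance has a
      -- nonnegative bound.
      have hc0 : 0 ≤ I.1.c := (Finset.sum_nonneg fun a _ => DTGW.mappingCost_nonneg hd
        (hadm.imp_right fun h => ⟨fun u => hε0.le.trans (h.1 _ u), fun v => hε0.le.trans (h.2 _ v)⟩)
        hM).trans hle'
      exact ⟨hc0, (key hc0).2 h⟩
    · have h1 : ((I.1.c.num.natAbs : ℕ) : ℚ) = |(I.1.c.num : ℚ)| := by
        rw [Nat.cast_natAbs, Int.cast_abs]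
      have h2 : I.1.c ≤ |(I.1.c.num : ℚ)| := by
        have h3 := Rat.num_div_den I.1.c
        calc I.1.c ≤ |I.1.c| := le_abs_self _
          _ = |(I.1.c.num : ℚ)| / I.1.c.den := by
            conv_lhs => rw [← h3]
            rw [abs_div, Nat.abs_cast]
          _ ≤ _ := div_le_self (abs_nonneg _) (by exact_mod_cast I.1.c.den_pos)
      rw [DTGW.length_unary, DTGW.fracAbs, Nat.cast_mul, h1, ← mul_assoc, hε]
      push_cast
      rw [one_div, inv_mul_cancel₀ (by positivity), one_mul]
      exact h2
  · have h1 := DTGW.one_le_inputSize I.1.G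
    have h2 := DTGW.one_le_inputSize (I.1.H, I.1.c)
    change 2 ≤ DTGW.inputSize I.1.G + DTGW.inputSize (I.1.H, I.1.c) + 1
    omega
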